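/- **Setting.** Let $d\ge 3$, $l>0$, $\eta=\mathrm{diag}(-1,1,\dots,1,-1)$ on $\mathbb R^{d+1}$ (indices $A=0,\dots,d$, raised and lowered with $\eta$), and let $U\subset\mathbb R^d$ be open with coordinates $x^\mu$. Let $V^A$, $e^A=e^A_\mu dx^\mu$, $\omega^A{}_B=\omega_\mu{}^A{}_B\,dx^\mu$ be smooth on $U$, with $\omega$ $\eta$-antisymmetric, $(e_\mu^A)$ of rank $d$, and $$d\omega+\omega\omega=0,\qquad de+\omega e=0,\qquad dV+\omega V=e,\qquad V^AV_A+l^2=0$$ (anti-de Sitter space in an arbitrary local frame). States are functions of $x,Y^A,a^{\dagger A},b^\dagger,\theta^\mu$: formal power series in $Y$ with coefficients polynomial in $a^\dagger$ and in the Grassmann odd variables $b^\dagger,\theta^\mu$ and smooth in $x\in U$; the ghost numbers are $\mathrm{gh}(\theta^\mu)=1$, $\mathrm{gh}(b^\dagger)=-1$. Put $$S^\dagger=a^{\dagger A}\tfrac{\partial}{\partial Y^A},\quad \bar S^\dagger=(Y^A+V^A)\tfrac{\partial}{\partial a^{\dagger A}},\quad h=a^{\dagger A}\tfrac{\partial}{\partial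 a^{\dagger A}}-(Y^A+V^A)\tfrac{\partial}{\partial Y^A},$$ $$\nabla=\theta^\mu\Big(\tfrac{\partial}{\partial x^\mu}-\omega_\mu{}^B{}_A Y^A\tfrac{\partial}{\partial Y^B}-\omega_\mu{}^B{}_A a^{\dagger A}\tfrac{\partial}{\partial a^{\dagger B}}\Big),\quad \sigma=-\theta^\mu e_\mu^A\tfrac{\partial}{\partial Y^A},\quad \bar\sigma=-\theta^\mu e_\mu^A\tfrac{\partial}{\partial a^{\dagger A}}.$$ A state is traceless if it is annihilated by $\frac{\partial}{\partial Y^A}\frac{\partial}{\partial Y_A}$, $\frac{\partial}{\partial a^{\dagger A}}\frac{\partial}{\partial Y_A}$ and $\frac{\partial}{\partial a^{\dagger A}}\frac{\partial}{\partial a^{\dagger}_A}$. Let $\Gamma(\hat E)$ be the space of traceless states with $(h-2+2b^\dagger\frac{\partial}{\partial b^\dagger})\phi=0$ and $\bar S^\dagger\phi=0$. Let $\Gamma(E_0)\subset\Gamma(\hat E)$ consist of the $b^\dagger$-independent $\phi$ with $V^A\frac{\partial}{\partial a^{\dagger A}}\phi=0$, and $\Gamma(E_1)\subset\Gamma(\hat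 E)$ of the elements $b^\dagger\chi$ with $S^\dagger\chi=0$; put $E=E_0\oplus E_1$ and $\Gamma(G)=S^\dagger\frac{\partial}{\partial b^\dagger}\Gamma(\hat E)$. A BRST operator is a nilpotent differential operator of finite order and ghost number $1$. A system $(\Omega,\Gamma(H))$ is consistently reduced to $(\tilde\Omega,\Gamma(E))$ if there is a decomposition $H=E\oplus G\oplus F$ into graded subbundles, with projectors $P_E,P_G,P_F$, such that $\Omega^{GF}=P_G\Omega P_F:\Gamma(F)\to\Gamma(G)$ has an inverse that is a differential operator of finite order, and $\tilde\Omega=\Omega^{EE}-\Omega^{EF}(\Omega^{GF})^{-1}\Omega^{GE}$. **Proposition.** The operators $\nabla+\sigma$ and $\hat\Omega=\nabla+\sigma+S^\dagger\frac{\partial}{\partial b^\dagger}$ preserve $\Gamma(\hat E)$, and $\hat\Omega$ is a BRST operator on it. The intermediate system $(\hat\Omega,\Gamma(\hat E))$ can be consistently reduced to the unfolded system $(\Omega^{\rm unf},\Gamma(E))$, by means of a decomposition $\hat E=E\oplus G\oplus F$ with $E=E_0\oplus E_1$ and $G$ as above and with $F$ consisting of elements of the form $b^\dagger\chi$. Here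 $$\Omega^{\rm unf}=P_E(\nabla+\sigma)-b^\dagger\sigma\bar\sigma\,\mathscr P_R$$ is a BRST operator on $\Gamma(E)$, and $\mathscr P_R$ extracts the component of degree zero with respect to $a^{\dagger A}\frac{\partial}{\partial a^{\dagger A}}-Y^A\frac{\partial}{\partial Y^A}$. On $\Gamma(E_1)$ the projector $P_E$ is not needed, as $\nabla+\sigma$ preserves $\Gamma(E_1)$, and $b^\dagger\sigma\bar\sigma\mathscr P_R$ maps $\Gamma(E_0)$ to $\Gamma(E_1)$. On $\Gamma(E_0)$ the degree takes only the values $0,-1,-2,\dots$, and $\mathscr P_R\phi$, $\phi\in\Gamma(E_0)$, is traceless and described by rectangular Young tableaux, i.e. annihilated by $a^{\dagger A}\frac{\partial}{\partial Y^A}$ and $Y^A\frac{\partial}{\partial a^{\dagger A}}$. -/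

import Mathlib

open scoped ContDiff

noncomputable section

namespace AdSParent

/-! ## First-quantized BRST systems and their consistent reductions

`R` plays the role of the algebra of smooth functions on space-time, `M` that of the `R`-module of
sections of a (graded) vector bundle, and `gh k` that of the sections of ghost number `k`. -/

section General

variable (R : Type*) [CommRing R] [Algebra ℝ R]
variable {M : Type*} [AddCommGroup M] [Module ℝ M] [Module R M] [IsScalarTower ℝ R M]

/-- Linear differential operators of order at most `k`: order zero means linear over the functions,
and `T` has order at most `k + 1` when all commutators `[T, f]` with functions `f` have order at
most `k`. -/
def IsDiffOp : ℕ → (M →ₗ[ℝ] M) → Prop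
  | 0, T => ∀ (f : R) (m : M), T (f • m) = f • T m
  | k + 1, T => ∀ f : R, IsDiffOp k (T ∘ₗ Algebra.lsmul ℝ ℝ M f - Algebra.lsmul ℝ ℝ M f ∘ₗ T)

/-- `Ω` is a BRST operator: a nilpotent differential operator of finite order and of ghost number
one (hence Grassmann odd, the parity being the ghost number modulo two). -/
structure IsBRST (gh : ℤ → Submodule R M) (Ω : M →ₗ[ℝ] M) : Prop where
  finite_order : ∃ k, IsDiffOp R k Ω
  ghost : ∀ k, ∀ m ∈ gh k, Ω m ∈ gh (k + 1)
  nilpotent : Ω ∘ₗ Ω = 0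

/-- The data of a consistent reduction of `(Ω, M)`: a decomposition of the bundle into a direct sum
`E ⊕ G ⊕ F` of graded subbundles, given by its projectors (complete orthogonal idempotents that are
linear over the functions and preserve the ghost number), such that the component `P_G Ω P_F` is
algebraically invertible as an operator from `F` to `G`, i.e. has an inverse which is a differential
operator of finite order. -/
structure Reduction (gh : ℤ → Submodule R M) (Ω : M →ₗ[ℝ] M) where
  prE : Module.End R M
  prG : Module.End R M
  prF : Module.End R M
  splitting : CompleteOrthogonalIdempotents ![prE, prG, prF]
  prE_ghost : ∀ k, ∀ m ∈ gh k, prE m ∈ gh k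
  prG_ghost : ∀ k, ∀ m ∈ gh k, prG m ∈ gh k
  prF_ghost : ∀ k, ∀ m ∈ gh k, prF m ∈ gh k
  inv : M →ₗ[ℝ] M
  inv_finite_order : ∃ k, IsDiffOp R k inv
  inv_range : ∀ m, prF (inv m) = inv m
  inv_support : ∀ m, inv (prG m) = inv m
  right_inv : ∀ m, prG (Ω (prF (inv m))) = prG m
  left_inv : ∀ m, inv (prG (Ω (prF m))) = prF m

variable {R}

/-- The reduced operator `Ω^{EE} - Ω^{EF} (Ω^{GF})⁻¹ Ω^{GE}`, extended by zero to `G ⊕ F`. -/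
def Reduction.op {gh : ℤ → Submodule R M} {Ω : M →ₗ[ℝ] M} (r : Reduction R gh Ω) : M →ₗ[ℝ] M :=
  let pE : M →ₗ[ℝ] M := r.prE.restrictScalars ℝ
  let pG : M →ₗ[ℝ] M := r.prG.restrictScalars ℝ
  let pF : M →ₗ[ℝ] M := r.prF.restrictScalars ℝ
  pE ∘ₗ Ω ∘ₗ pE - pE ∘ₗ Ω ∘ₗ pF ∘ₗ r.inv ∘ₗ pG ∘ₗ Ω ∘ₗ pE

/-- Restriction of an `ℝ`-linear operator to an invariant submodule over the functions. -/
def restrictOp (T : M →ₗ[ℝ] M) (N : Submodule R M) (h : ∀ m ∈ N, T m ∈ N) : N →ₗ[ℝ] N where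
  toFun m := ⟨T m, h m m.2⟩
  map_add' m n := Subtype.ext (by simp)
  map_smul' c m := Subtype.ext (by simp)

end General

/-! ## Smooth functions on a coordinate domain -/

section Smooth

variable {d : ℕ} (U : TopologicalSpace.Opens (Fin d → ℝ))

/-- The extension by zero of a function on `U`. -/
def ext0 (f : U → ℝ) : (Fin d → ℝ) → ℝ := Function.extend Subtype.val f 0

variable {U}

theorem ext0_apply (f : U → ℝ) (x : U) : ext0 U f x = f x :=
  Subtype.val_injective.extend_apply f 0 x

theorem ext0_eqOn {f : U → ℝ} {g : (Fin d → ℝ) → ℝ} (h : ∀ x : U, f x = g x) :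
    Set.EqOn (ext0 U f) g U := fun x hx => by
  rw [← h ⟨x, hx⟩]; exact ext0_apply f ⟨x, hx⟩

variable (U)

/-- The algebra of smooth real functions on the open set `U`. -/
def smoothSubalgebra : Subalgebra ℝ (U → ℝ) where
  carrier := {f | ContDiffOn ℝ ∞ (ext0 U f) U}
  mul_mem' {f g} hf hg := (ContDiffOn.mul hf hg).congr
    (ext0_eqOn fun x => by simp [ext0_apply])
  add_mem' {f g} hf hg := (ContDiffOn.add hf hg).congr
    (ext0_eqOn fun x => by simp [ext0_apply])
  algebraMap_mem' c := (contDiffOn_const (c := c)).congr (ext0_eqOn fun x => by simp)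

/-- The ring `C^∞(U)`. -/
def Smooth : Type := smoothSubalgebra U

instance : CommRing (Smooth U) := inferInstanceAs (CommRing (smoothSubalgebra U))

instance : Algebra ℝ (Smooth U) := inferInstanceAs (Algebra ℝ (smoothSubalgebra U))

variable {U}

/-- The partial derivative `∂/∂x^μ` on smooth functions. -/
def pd (μ : Fin d) : Smooth U →ₗ[ℝ] Smooth U where
  toFun f := ⟨fun x => fderiv ℝ (ext0 U f.1) x (Pi.single μ 1), by
    have h : ContDiffOn ℝ ∞ (fderiv ℝ (ext0 U f.1)) U :=
      ((contDiffOn_infty_iff_fderiv_of_isOpen U.isOpen).1 f.2).2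
    exact (h.clm_apply contDiffOn_const).congr (ext0_eqOn fun x => rfl)⟩
  map_add' f g := by
    refine Subtype.ext (funext fun x => ?_)
    have hx : (U : Set (Fin d → ℝ)) ∈ nhds (x : Fin d → ℝ) := U.isOpen.mem_nhds x.2
    have hf : DifferentiableAt ℝ (ext0 U f.1) x :=
      (ContDiffOn.contDiffAt f.2 hx).differentiableAt (by simp)
    have hg : DifferentiableAt ℝ (ext0 U g.1) x :=
      (ContDiffOn.contDiffAt g.2 hx).differentiableAt (by simp)
    have e : ext0 U (f.1 + g.1) =ᶠ[nhds (x : Fin d → ℝ)] ext0 U f.1 + ext0 U g.1 :=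
      Filter.eventuallyEq_of_mem hx (ext0_eqOn fun y => by simp [ext0_apply])
    change fderiv ℝ (ext0 U (f.1 + g.1)) x (Pi.single μ 1) =
      fderiv ℝ (ext0 U f.1) x (Pi.single μ 1) + fderiv ℝ (ext0 U g.1) x (Pi.single μ 1)
    rw [e.fderiv_eq, fderiv_add hf hg]; rfl
  map_smul' c f := by
    refine Subtype.ext (funext fun x => ?_)
    have hx : (U : Set (Fin d → ℝ)) ∈ nhds (x : Fin d → ℝ) := U.isOpen.mem_nhds x.2
    have hf : DifferentiableAt ℝ (ext0 U f.1) x :=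
      (ContDiffOn.contDiffAt f.2 hx).differentiableAt (by simp)
    have e : ext0 U (c • f.1) =ᶠ[nhds (x : Fin d → ℝ)] c • ext0 U f.1 :=
      Filter.eventuallyEq_of_mem hx (ext0_eqOn fun y => by simp [ext0_apply])
    change fderiv ℝ (ext0 U (c • f.1)) x (Pi.single μ 1) =
      c • fderiv ℝ (ext0 U f.1) x (Pi.single μ 1)
    rw [e.fderiv_eq, fderiv_const_smul hf c]; rfl

end Smooth

/-! ## Background geometry -/

/-- The flat metric `diag(-1, 1, …, 1, -1)` of the embedding space, as a list of diagonal entries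
indexed by `0, …, d`; it is its own inverse. -/
def eta (d : ℕ) (A : Fin (d + 1)) : ℝ := if A = 0 ∨ A = Fin.last d then -1 else 1

/-- The anti-de Sitter background in local coordinates `x^μ` on `U` and an arbitrary local
orthonormal frame: the compensator `V^A`, the vielbein `e_μ^A` (of maximal rank) and the connection
`ω_μ^A_B` (written `w μ A B`). -/
structure Background (d : ℕ) (l : ℝ) (U : TopologicalSpace.Opens (Fin d → ℝ)) where
  V : Fin (d + 1) → Smooth U
  e : Fin d → Fin (d + 1) → Smooth U
  w : Fin d → Fin (d + 1) → Fin (d + 1) → Smooth U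
  /-- The connection is compatible with the metric. -/
  metric : ∀ μ A B, eta d A • w μ A B + eta d B • w μ B A = 0
  /-- `dω + ω ω = 0`. -/
  flat : ∀ μ ν A B, pd μ (w ν A B) - pd ν (w μ A B)
    + ∑ C, (w μ A C * w ν C B - w ν A C * w μ C B) = 0
  /-- `de + ω e = 0`. -/
  torsion : ∀ μ ν A, pd μ (e ν A) - pd ν (e μ A) + ∑ B, (w μ A B * e ν B - w ν A B * e μ B) = 0
  /-- `dV + ω V = e`. -/
  vielbein : ∀ μ A, pd μ (V A) + ∑ B, w μ A B * V B = e μ A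
  /-- `V² + l² = 0`. -/
  norm : ∑ A, eta d A • (V A * V A) + algebraMap ℝ (Smooth U) (l ^ 2) = 0
  rank : ∀ x : U, LinearIndependent ℝ (fun (μ : Fin d) (A : Fin (d + 1)) => (e μ A).1 x)

/-! ## The space of states

The coefficient ring `R` will be `C^∞(U)`. -/

section States

section Types

variable (d : ℕ) (R : Type) [CommRing R]

/-- Polynomials in the oscillators `a^{†A}`, `A = 0, …, d`, with coefficients in `R`. -/
abbrev Osc : Type := MvPolynomial (Fin (d + 1)) R

/-- Formal power series in `Y^A`, `A = 0, …, d`, whose coefficients are polynomials in the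
`a^{†A}`. -/
def Ser : Type := MvPowerSeries (Fin (d + 1)) (Osc d R)

instance : CommRing (Ser d R) := inferInstanceAs (CommRing (MvPowerSeries _ (Osc d R)))

instance : Algebra R (Ser d R) := inferInstanceAs (Algebra R (MvPowerSeries _ (Osc d R)))

instance [Algebra ℝ R] : Module ℝ (Ser d R) := inferInstanceAs (Module ℝ (MvPowerSeries _ (Osc d R)))

instance [Algebra ℝ R] : IsScalarTower ℝ R (Ser d R) :=
  inferInstanceAs (IsScalarTower ℝ R (MvPowerSeries _ (Osc d R)))

/-- Polynomials in the Grassmann odd variables `θ^μ` with coefficients in `Ser d R`: the function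
`F` stands for `∑_I θ^I F_I`, where `θ^I = θ^{μ₁} ⋯ θ^{μ_k}` if `I = {μ₁ < ⋯ < μ_k}`. -/
abbrev Form : Type := Finset (Fin d) → Ser d R

/-- Functions of `x, Y, a†, b†, θ`: the pair `(F, G)` stands for `F + b† G`. -/
abbrev State : Type := Form d R × Form d R

end Types

variable {d : ℕ} {R : Type} [CommRing R]

/-- The coefficient of `Y^α (a†)^β`. -/
def coef (α β : Fin (d + 1) →₀ ℕ) (f : Ser d R) : R :=
  MvPolynomial.coeff β (MvPowerSeries.coeff (R := Osc d R) α f)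

/-- The states of ghost number `k`, with `gh(θ^μ) = 1` and `gh(b†) = -1`. -/
def gh (k : ℤ) : Submodule R (State d R) where
  carrier := {Φ | (∀ I, Φ.1 I ≠ 0 → (I.card : ℤ) = k) ∧ (∀ I, Φ.2 I ≠ 0 → (I.card : ℤ) - 1 = k)}
  zero_mem' := by simp
  add_mem' {Φ Ψ} hΦ hΨ := by
    constructor <;> intro I hI
    · by_cases h : Φ.1 I = 0
      · exact hΨ.1 I fun h' => hI (by simp [h, h'])
      · exact hΦ.1 I h
    · by_cases h : Φ.2 I = 0
      · exact hΨ.2 I fun h' => hI (by simp [h, h'])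
      · exact hΦ.2 I h
  smul_mem' c Φ hΦ :=
    ⟨fun I hI => hΦ.1 I fun h => hI (by simp [h]), fun I hI => hΦ.2 I fun h => hI (by simp [h])⟩

/-! ### Even operators on power series -/

/-- `∂/∂Y^A`. -/
def dY (A : Fin (d + 1)) : Module.End R (Ser d R) where
  toFun f := MvPowerSeries.pderivFun (R := Osc d R) A f
  map_add' f g := MvPowerSeries.pderivFun_add (R := Osc d R) f g
  map_smul' c f := funext fun α => smul_mul_assoc c (f (α + Finsupp.single A 1) : Osc d R) _

/-- `∂/∂a^{†A}`. -/
def da (A : Fin (d + 1)) : Module.End R (Ser d R) where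
  toFun f := fun α => MvPolynomial.pderiv A (f α)
  map_add' f g := funext fun α => map_add (MvPolynomial.pderiv A) (f α) (g α)
  map_smul' c f := funext fun α => (MvPolynomial.pderiv A).map_smul c (f α)

/-- Multiplication by `Y^A`. -/
def mY (A : Fin (d + 1)) : Module.End R (Ser d R) :=
  LinearMap.mulLeft R (MvPowerSeries.X (R := Osc d R) A : Ser d R)

/-- Multiplication by `a^{†A}`. -/
def ma (A : Fin (d + 1)) : Module.End R (Ser d R) :=
  LinearMap.mulLeft R (MvPowerSeries.C (R := Osc d R) (MvPolynomial.X A) : Ser d R)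

/-- `S† = a^{†A} ∂/∂Y^A`. -/
def Sdag : Module.End R (Ser d R) := ∑ A, ma A * dY A

/-- `Y^A ∂/∂a^{†A}`. -/
def Yda : Module.End R (Ser d R) := ∑ A, mY A * da A

/-- The projector `P_R` onto the component of degree zero with respect to
`a^{†A} ∂/∂a^{†A} - Y^A ∂/∂Y^A`. -/
def rect : Module.End R (Ser d R) where
  toFun f := fun α => MvPolynomial.homogeneousComponent α.degree (f α)
  map_add' f g := funext fun α => map_add (MvPolynomial.homogeneousComponent _) (f α) (g α)
  map_smul' c f := funext fun α => map_smul (MvPolynomial.homogeneousComponent _) c (f α)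

theorem coef_rect (f : Ser d R) (α β : Fin (d + 1) →₀ ℕ) :
    coef α β (rect f) = if β.degree = α.degree then coef α β f else 0 :=
  MvPolynomial.coeff_homogeneousComponent _ _ _

variable [Algebra ℝ R]

/-- An `ℝ`-linear operator on `R`, acting on all coefficients. -/
def onCoef (T : R →ₗ[ℝ] R) : Ser d R →ₗ[ℝ] Ser d R :=
  (((AddMonoidAlgebra.coeffLinearEquiv ℝ).symm.toLinearMap ∘ₗ
    Finsupp.mapRange.linearMap T ∘ₗ
    (AddMonoidAlgebra.coeffLinearEquiv ℝ).toLinearMap : Osc d R →ₗ[ℝ] Osc d R)).compLeft _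

theorem coef_onCoef (T : R →ₗ[ℝ] R) (f : Ser d R) (α β : Fin (d + 1) →₀ ℕ) :
    coef α β (onCoef T f) = T (coef α β f) := rfl

/-- `□ = ∂_Y · ∂_Y`. -/
def box : Module.End R (Ser d R) := ∑ A, algebraMap ℝ R (eta d A) • (dY A * dY A)

/-- `S = ∂_{a†} · ∂_Y`. -/
def opS : Module.End R (Ser d R) := ∑ A, algebraMap ℝ R (eta d A) • (da A * dY A)

/-- `T = ∂_{a†} · ∂_{a†}`. -/
def opT : Module.End R (Ser d R) := ∑ A, algebraMap ℝ R (eta d A) • (da A * da A)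

/-! ### Extension to states; the Grassmann odd variables -/

/-- The action of an even operator on the coefficients of a state. -/
def lift {S : Type} [Semiring S] [Module S (Ser d R)] (T : Ser d R →ₗ[S] Ser d R) :
    State d R →ₗ[S] State d R :=
  (T.compLeft _).prodMap (T.compLeft _)

/-- Left multiplication by `θ^μ` on polynomials in `θ`. -/
def thetaForm (μ : Fin d) : Module.End R (Form d R) :=
  LinearMap.pi fun I =>
    if μ ∈ I then (-1 : R) ^ (I.filter (· < μ)).card • LinearMap.proj (I.erase μ) else 0

/-- Left multiplication by `θ^μ` on states; note that `θ^μ b† = - b† θ^μ`. -/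
def theta (μ : Fin d) : Module.End R (State d R) := (thetaForm μ).prodMap (-thetaForm μ)

/-- Left multiplication by `b†`. -/
def mb : Module.End R (State d R) :=
  LinearMap.inr R (Form d R) (Form d R) ∘ₗ LinearMap.fst R (Form d R) (Form d R)

/-- `∂/∂b†`. -/
def db : Module.End R (State d R) :=
  LinearMap.inl R (Form d R) (Form d R) ∘ₗ LinearMap.snd R (Form d R) (Form d R)

/-- `S† ∂/∂b†`. -/
def Sdb : Module.End R (State d R) := lift Sdag * db

/-- The projector `P_R` on states. -/
def PR : Module.End R (State d R) := lift rect

/-- Totally traceless states. -/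
def traceless : Submodule R (State d R) :=
  LinearMap.ker (lift (box (d := d) (R := R))) ⊓ LinearMap.ker (lift (opS (d := d) (R := R))) ⊓
    LinearMap.ker (lift (opT (d := d) (R := R)))

end States

/-! ## The intermediate and the unfolded system -/

namespace Background

variable {d : ℕ} {l : ℝ} {U : TopologicalSpace.Opens (Fin d → ℝ)} (B : Background d l U)

/-- `V^A ∂/∂a^{†A}`. -/
def Vda : Module.End (Smooth U) (Ser d (Smooth U)) := ∑ A, B.V A • da A

/-- `S̄† = (Y^A + V^A) ∂/∂a^{†A}`. -/
def Sbar : Module.End (Smooth U) (Ser d (Smooth U)) := Yda + B.Vda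

/-- `h = a^{†A} ∂/∂a^{†A} - (Y^A + V^A) ∂/∂Y^A`. -/
def h : Module.End (Smooth U) (Ser d (Smooth U)) := ∑ A, (ma A * da A - mY A * dY A - B.V A • dY A)

/-- `∇ = θ^μ (∂_μ - ω_μ^B_A Y^A ∂/∂Y^B - ω_μ^B_A a^{†A} ∂/∂a^{†B})`. -/
def nabla : State d (Smooth U) →ₗ[ℝ] State d (Smooth U) :=
  ∑ μ, (theta μ).restrictScalars ℝ ∘ₗ
    lift (onCoef (pd μ) - (∑ A, ∑ C, B.w μ C A • (mY A * dY C + ma A * da C) :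
      Module.End (Smooth U) (Ser d (Smooth U))).restrictScalars ℝ)

/-- `σ = - θ^μ e_μ^A ∂/∂Y^A`. -/
def sigma : Module.End (Smooth U) (State d (Smooth U)) := -∑ μ, theta μ * lift (∑ A, B.e μ A • dY A)

/-- `σ̄ = - θ^μ e_μ^A ∂/∂a^{†A}`. -/
def sigmaBar : Module.End (Smooth U) (State d (Smooth U)) := -∑ μ, theta μ * lift (∑ A, B.e μ A • da A)

/-- `D = ∇ + σ`. -/
def D : State d (Smooth U) →ₗ[ℝ] State d (Smooth U) := B.nabla + B.sigma.restrictScalars ℝ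

/-- The BRST operator `∇ + σ + S† ∂/∂b†` of the intermediate system. -/
def hatOmega : State d (Smooth U) →ₗ[ℝ] State d (Smooth U) := B.D + Sdb.restrictScalars ℝ

/-- `Γ(Ê)`: traceless states with `(h - 2 + 2 b† ∂/∂b†) Φ = 0` and `S̄† Φ = 0`. -/
def hatE : Submodule (Smooth U) (State d (Smooth U)) :=
  traceless ⊓ LinearMap.ker (lift B.h - 2 + 2 * (mb * db)) ⊓ LinearMap.ker (lift B.Sbar)

/-- `Γ(E₀)`: the states of `Γ(Ê)` that do not depend on `b†` and satisfy
`V^A ∂/∂a^{†A} Φ = 0`. -/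
def E0 : Submodule (Smooth U) (State d (Smooth U)) :=
  B.hatE ⊓ LinearMap.ker (db (d := d) (R := Smooth U)) ⊓ LinearMap.ker (lift B.Vda)

/-- `Γ(E₁)`: the states of `Γ(Ê)` of the form `b† χ` with `S† χ = 0`. -/
def E1 : Submodule (Smooth U) (State d (Smooth U)) :=
  B.hatE ⊓ LinearMap.range (mb (d := d) (R := Smooth U)) ⊓ LinearMap.ker (lift (Sdag (d := d) (R := Smooth U)))

/-- `Γ(E)` with `E = E₀ ⊕ E₁`. -/
def E : Submodule (Smooth U) (State d (Smooth U)) := B.E0 ⊔ B.E1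

/-- `Γ(G)`, the image of `S† ∂/∂b†` in `Γ(Ê)`. -/
def G : Submodule (Smooth U) (State d (Smooth U)) := B.hatE.map Sdb

/-- The term `b† σ σ̄ P_R` of the unfolded operator. -/
def gluing : Module.End (Smooth U) (State d (Smooth U)) := mb * B.sigma * B.sigmaBar * PR

/-- The ghost number on `Γ(Ê)`. -/
def ghHat (k : ℤ) : Submodule (Smooth U) B.hatE := (gh k).comap B.hatE.subtype

end Background

end AdSParent

end

noncomputable section

set_option linter.unusedSectionVars false

namespace AdSParent

/-! ### Calculus of differential operators of finite order. -/

section DiffOp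

variable {R : Type*} [CommRing R] [Algebra ℝ R]
variable {M : Type*} [AddCommGroup M] [Module ℝ M] [Module R M] [IsScalarTower ℝ R M]

/-! Put e = S†, f = Y·∂/∂a† and h0 = [e, f], the degree in a† minus the degree in Y. This is an sl₂
acting with e and f nilpotent on each bihomogeneous component. Hence the states split both as ker f
⊕ im e and as ker e ⊕ im f, and e : im f → im e is invertible (`BigradedSl2.isCompl`,
`BigradedSl2.restrict_bijective`). These splittings are the reduction: ker f without b† and ker e
with b† give E, im e gives G, b† im f gives F, the component of the BRST operator from F to G is S†
∂/∂b†, and its inverse is algebraic.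

The difficulty is that Γ(Ê) is cut out by f + V·∂/∂a† and h0 - V·∂/∂Y, which form an sl₂ with e but
are not homogeneous. That the homogeneous projectors and the homogeneous inverse of e still preserve
Γ(Ê) is the content of `shifted_projF` and `shifted_of_e_f`: the obstruction turns out to be an
h0-eigenvector in ker f of weight 1, or in ker e of weight -1, while weights are ≤ 0 on ker f and ≥
0 on ker e.

The operator ∇ + σ is θ^μ times the commuting covariant derivatives `cov μ`. They commute with S†,
and by dV + ωV = e also with both shifted constraints. This gives nilpotency on Γ(Ê), and nilpotency
passes to any reduced operator (`Reduction.op_nilpotent`).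

For the gluing term take φ in E₀ and let x be the preimage under S† of the G-component of (∇ + σ)φ.
Then x lies in im f and also in ker f (`Yda_invS_formD`), so its weights are ≤ -1 and h0 x = σ̄φ.
Since ∇ preserves im f, only σ contributes to the projection of (∇ + σ)x to ker S†. As σ raises the
weight by one and ker S† has weights ≥ 0, only the part of x of weight -1 survives; it is -σ̄ of the
weight zero part of φ. This is why exactly `rect` appears (`projS_formD_invS_formD`). -/

theorem IsDiffOp.zero : ∀ k, IsDiffOp R k (0 : M →ₗ[ℝ] M)
  | 0 => fun f m => by simp
  | k + 1 => fun f => by simpa using IsDiffOp.zero k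

theorem IsDiffOp.add {k : ℕ} : ∀ {S T : M →ₗ[ℝ] M}, IsDiffOp R k S → IsDiffOp R k T →
    IsDiffOp R k (S + T) := by
  induction k with
  | zero => intro S T hS hT f m; simp [hS f m, hT f m]
  | succ k ih =>
    intro S T hS hT f
    have := ih (hS f) (hT f)
    convert this using 1
    ext m; simp; abel

theorem IsDiffOp.succ {k : ℕ} : ∀ {T : M →ₗ[ℝ] M}, IsDiffOp R k T → IsDiffOp R (k + 1) T := by
  induction k with
  | zero =>
    intro T hT f
    have : T ∘ₗ Algebra.lsmul ℝ ℝ M f - Algebra.lsmul ℝ ℝ M f ∘ₗ T = 0 := by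
      ext m; simp [hT f m]
    rw [this]; exact IsDiffOp.zero 0
  | succ k ih => intro T hT f; exact ih (hT f)

theorem IsDiffOp.mono {k n : ℕ} (h : k ≤ n) {T : M →ₗ[ℝ] M} (hT : IsDiffOp R k T) :
    IsDiffOp R n T := by
  induction h with
  | refl => exact hT
  | step _ ih => exact ih.succ

/-- Induction along the Leibniz rule [ST, f] = [S, f] T + S [T, f]; a factor of order zero commutes
with f, so its term is absent. -/
theorem IsDiffOp.comp : ∀ {j k : ℕ} {S T : M →ₗ[ℝ] M}, IsDiffOp R j S → IsDiffOp R k T →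
    IsDiffOp R (j + k) (S ∘ₗ T)
  | 0, 0, S, T, hS, hT => fun f m => by simp [hT f m, hS f]
  | 0, k + 1, S, T, hS, hT => fun f => by
    have e : (S ∘ₗ T) ∘ₗ Algebra.lsmul ℝ ℝ M f - Algebra.lsmul ℝ ℝ M f ∘ₗ S ∘ₗ T
        = S ∘ₗ (T ∘ₗ Algebra.lsmul ℝ ℝ M f - Algebra.lsmul ℝ ℝ M f ∘ₗ T) := by
      ext m; simp [hS f]
    exact e ▸ IsDiffOp.comp hS (hT f)
  | j + 1, 0, S, T, hS, hT => fun f => by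
    have e : (S ∘ₗ T) ∘ₗ Algebra.lsmul ℝ ℝ M f - Algebra.lsmul ℝ ℝ M f ∘ₗ S ∘ₗ T
        = (S ∘ₗ Algebra.lsmul ℝ ℝ M f - Algebra.lsmul ℝ ℝ M f ∘ₗ S) ∘ₗ T := by
      ext m; simp [hT f]
    exact e ▸ IsDiffOp.comp (hS f) hT
  | j + 1, k + 1, S, T, hS, hT => by
    rw [← add_assoc]
    intro f
    have e : (S ∘ₗ T) ∘ₗ Algebra.lsmul ℝ ℝ M f - Algebra.lsmul ℝ ℝ M f ∘ₗ S ∘ₗ T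
        = (S ∘ₗ Algebra.lsmul ℝ ℝ M f - Algebra.lsmul ℝ ℝ M f ∘ₗ S) ∘ₗ T
          + S ∘ₗ (T ∘ₗ Algebra.lsmul ℝ ℝ M f - Algebra.lsmul ℝ ℝ M f ∘ₗ T) := by
      ext m; simp
    rw [e, show j + 1 + k = j + (k + 1) by omega]
    have h1 := IsDiffOp.comp (hS f) hT
    have h2 := IsDiffOp.comp hS (hT f)
    rw [add_assoc, add_comm 1 k] at h2
    exact h1.add h2

theorem IsDiffOp.of_linear (T : Module.End R M) : IsDiffOp R 0 (T.restrictScalars ℝ) :=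
  fun f m => T.map_smul f m

end DiffOp

/-! ### Nilpotency of reduced operators. -/

section ReductionNilpotent

variable {R : Type*} [CommRing R] [Algebra ℝ R]
variable {M : Type*} [AddCommGroup M] [Module ℝ M] [Module R M] [IsScalarTower ℝ R M]
variable {gh : ℤ → Submodule R M} {Ω : M →ₗ[ℝ] M}

theorem Reduction.op_apply (r : Reduction R gh Ω) (m : M) :
    r.op m = r.prE (Ω (r.prE m)) - r.prE (Ω (r.prF (r.inv (r.prG (Ω (r.prE m)))))) := rfl

/-- The operator obtained by a consistent reduction of a nilpotent operator is nilpotent. -/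
theorem Reduction.op_nilpotent (r : Reduction R gh Ω) (h : Ω ∘ₗ Ω = 0) : r.op ∘ₗ r.op = 0 := by
  have hΩ : ∀ m, Ω (Ω m) = 0 := fun m => LinearMap.congr_fun h m
  have hsum : ∀ m, r.prE m + r.prG m + r.prF m = m := fun m => by
    have := LinearMap.congr_fun r.splitting.complete m
    simpa [Fin.sum_univ_three] using this
  have hEE : ∀ m, r.prE (r.prE m) = r.prE m := fun m =>
    LinearMap.congr_fun (r.splitting.idem 0) m
  -- The lift ℓ(x) = x - inv (P_G Ω x) intertwines the two operators: Ω ℓ(x) = ℓ(op x). Indeed κ = Ω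
  -- ℓ(x) has no G-component, and Ω κ = 0 then determines its F-component from its E-component.
  have key : ∀ x, r.prE x = x → ∀ κ, κ = Ω (x - r.inv (r.prG (Ω x))) →
      r.prG κ = 0 ∧ r.op x = r.prE κ ∧
        κ = r.op x - r.inv (r.prG (Ω (r.op x))) := by
    intro x hx κ hκ
    have h1 : r.prG κ = 0 := by
      have := r.right_inv (Ω x)
      rw [← r.inv_support, r.inv_range] at this
      rw [hκ, map_sub, map_sub, this, sub_self]
    have h2 : r.op x = r.prE κ := by
      rw [r.op_apply, hx, r.inv_range, hκ, map_sub, map_sub]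
    refine ⟨h1, h2, ?_⟩
    have h3 : κ = r.prE κ + r.prF κ := by
      conv_lhs => rw [← hsum κ, h1, add_zero]
    have h4 : r.prG (Ω (r.prE κ)) + r.prG (Ω (r.prF κ)) = 0 := by
      rw [← map_add, ← map_add, ← h3, hκ, hΩ, map_zero]
    have h5 := r.left_inv κ
    rw [eq_neg_of_add_eq_zero_right h4, map_neg] at h5
    rw [h2, sub_eq_add_neg, h5]
    exact h3
  ext m
  obtain ⟨-, -, h3⟩ := key (r.prE m) (hEE m) _ rfl
  have e1 : r.op m = r.op (r.prE m) := by simp [r.op_apply, hEE]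
  have hop : r.prE (r.op m) = r.op m := by simp [r.op_apply, hEE]
  obtain ⟨-, h2, -⟩ := key (r.op m) hop _ rfl
  rw [e1] at h2
  rw [← h3, hΩ, map_zero] at h2
  simp [e1, h2]

end ReductionNilpotent

/-! ### Representation theory of sl₂ on completed bigraded modules. -/

section BigradedSl2

variable {R : Type*} [CommRing R] [Algebra ℝ R]
variable {M : Type*} [AddCommGroup M] [Module ℝ M] [Module R M] [IsScalarTower ℝ R M]

/-- An action of `sl₂` on a completion of a bigraded module, `e` having bidegree `(-1, 1)` and `f`
bidegree `(1, -1)`; `comp m s` is the projection to the component of bidegree `(m, s)`, on which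
`h = [e, f]` acts by `s - m`. -/
structure BigradedSl2 (e f h : Module.End R M) (comp : ℕ → ℕ → Module.End R M) : Prop where
  ef : ∀ x, e (f x) = f (e x) + h x
  he : ∀ x, h (e x) = e (h x) + (2 : ℝ) • e x
  hf : ∀ x, h (f x) = f (h x) - (2 : ℝ) • f x
  comp_e : ∀ m s x, comp m (s + 1) (e x) = e (comp (m + 1) s x)
  comp_e_zero : ∀ m x, comp m 0 (e x) = 0
  comp_f : ∀ m s x, comp (m + 1) s (f x) = f (comp m (s + 1) x)
  comp_f_zero : ∀ s x, comp 0 s (f x) = 0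
  comp_comp : ∀ m s m' s' x, comp m s (comp m' s' x) = if m = m' ∧ s = s' then comp m s x else 0
  h_comp : ∀ m s x, h (comp m s x) = ((s : ℝ) - m) • comp m s x
  comp_h : ∀ m s x, comp m s (h x) = h (comp m s x)
  ext : ∀ x, (∀ m s, comp m s x = 0) → x = 0
  -- Arbitrary families cannot be glued, as coefficients are polynomial in a†; the support is
  -- therefore required to lie in that of an actual vector.
  glue : ∀ (x : M) (g : ℕ → ℕ → M), (∀ m s, comp m s x = 0 → g m s = 0) →
    ∃ y, ∀ m s, comp m s y = comp m s (g m s)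

/-- A submodule that is stable under `e` and `f` and consists of all the elements whose components
it contains. -/
structure IsGraded (e f : Module.End R M) (comp : ℕ → ℕ → Module.End R M) (N : Submodule R M) :
    Prop where
  e_mem : ∀ x ∈ N, e x ∈ N
  f_mem : ∀ x ∈ N, f x ∈ N
  comp_mem : ∀ x ∈ N, ∀ m s, comp m s x ∈ N
  mem_of_comp : ∀ x, (∀ m s, comp m s x ∈ N) → x ∈ N

variable {e f h : Module.End R M} {comp : ℕ → ℕ → Module.End R M} {N : Submodule R M}

theorem IsGraded.symm (hN : IsGraded e f comp N) : IsGraded f e (fun m s => comp s m) N :=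
  ⟨hN.f_mem, hN.e_mem, fun x hx m s => hN.comp_mem x hx s m,
    fun x hx => hN.mem_of_comp x fun m s => hx s m⟩

theorem IsGraded.pow_e_mem (hN : IsGraded e f comp N) {x : M} (hx : x ∈ N) :
    ∀ n : ℕ, (e ^ n) x ∈ N
  | 0 => hx
  | n + 1 => by rw [pow_succ']; exact hN.e_mem _ (hN.pow_e_mem hx n)

theorem IsGraded.pow_f_mem (hN : IsGraded e f comp N) {x : M} (hx : x ∈ N) (n : ℕ) :
    (f ^ n) x ∈ N := hN.symm.pow_e_mem hx n

namespace BigradedSl2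

/-- The Weyl reflection. Every result on ker f and im e yields its mirror image on ker e and im f.
-/
theorem symm (S : BigradedSl2 e f h comp) : BigradedSl2 f e (-h) (fun m s => comp s m) where
  ef x := by simp [S.ef]
  he x := by simp [S.hf]; abel
  hf x := by simp [S.he]; abel
  comp_e m s x := S.comp_f s m x
  comp_e_zero m x := S.comp_f_zero m x
  comp_f m s x := S.comp_e s m x
  comp_f_zero s x := S.comp_e_zero s x
  comp_comp m s m' s' x := by rw [S.comp_comp]; simp only [and_comm]
  h_comp m s x := by rw [LinearMap.neg_apply, S.h_comp, ← neg_smul, neg_sub]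
  comp_h m s x := by simp [S.comp_h]
  ext x hx := S.ext x fun m s => hx s m
  glue x g hg := by
    obtain ⟨y, hy⟩ := S.glue x (fun m s => g s m) fun m s => hg s m
    exact ⟨y, fun m s => hy s m⟩

variable (S : BigradedSl2 e f h comp)
include S

theorem h_pow_e {x : M} {c : ℝ} (hx : h x = c • x) :
    ∀ n : ℕ, h ((e ^ n) x) = (c + 2 * n) • (e ^ n) x
  | 0 => by simp [hx]
  | n + 1 => by
    rw [pow_succ', Module.End.mul_apply, S.he, h_pow_e hx n, LinearMap.map_smul_of_tower,
      ← add_smul]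
    push_cast; ring_nf

theorem h_pow_f {x : M} {c : ℝ} (hx : h x = c • x) (n : ℕ) :
    h ((f ^ n) x) = (c - 2 * n) • (f ^ n) x := by
  have := S.symm.h_pow_e (x := x) (c := -c) (by simp [hx]) n
  rw [LinearMap.neg_apply, neg_eq_iff_eq_neg, ← neg_smul] at this
  rw [this]; ring_nf

/-- `[f, e^n]` on a vector of weight `c`. -/
theorem f_pow_e {x : M} {c : ℝ} (hx : h x = c • x) : ∀ n : ℕ,
    f ((e ^ (n + 1)) x) = (e ^ (n + 1)) (f x) - ((n + 1) * (c + n) : ℝ) • (e ^ n) x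
  | 0 => by
    have := S.ef x
    simp [this, hx]
  | n + 1 => by
    have h1 := S.ef ((e ^ (n + 1)) x)
    have h2 : ∀ (k : ℕ) (y : M), e ((e ^ k) y) = (e ^ (k + 1)) y := fun k y => by
      rw [pow_succ', Module.End.mul_apply]
    rw [S.h_pow_e hx, f_pow_e hx n, map_sub, LinearMap.map_smul_of_tower, h2, h2, h2] at h1
    rw [← sub_eq_iff_eq_add.2 h1, sub_sub, ← add_smul]
    push_cast; ring_nf

theorem e_pow_f {x : M} {c : ℝ} (hx : h x = c • x) (n : ℕ) :
    e ((f ^ (n + 1)) x) = (f ^ (n + 1)) (e x) - ((n + 1) * (-c + n) : ℝ) • (f ^ n) x :=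
  S.symm.f_pow_e (x := x) (c := -c) (by simp [hx]) n

theorem f_comp_zero (m x) : f (comp m 0 x) = 0 := by
  refine S.ext _ fun m' s' => ?_
  cases m' with
  | zero => exact S.comp_f_zero _ _
  | succ m' => rw [S.comp_f, S.comp_comp]; simp

theorem f_comp_succ (m s x) : f (comp m (s + 1) x) = comp (m + 1) s (f x) := (S.comp_f m s x).symm

theorem pow_f_comp : ∀ (s m : ℕ) (x : M), (f ^ (s + 1)) (comp m s x) = 0
  | 0, m, x => by simpa using S.f_comp_zero m x
  | s + 1, m, x => by
    rw [pow_succ, Module.End.mul_apply, S.f_comp_succ, pow_f_comp]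

theorem pow_e_comp (s m : ℕ) (x : M) : (e ^ (m + 1)) (comp m s x) = 0 := S.symm.pow_f_comp m s x

/-- A lowest weight vector of positive weight that generates a finite-dimensional module is zero. -/
theorem eq_zero_of_f {x : M} {c : ℝ} (hx : h x = c • x) (hc : 0 < c) (hf : f x = 0) :
    ∀ n : ℕ, (e ^ n) x = 0 → x = 0
  | 0, h0 => by simpa using h0
  | n + 1, h0 => by
    have h1 := S.f_pow_e hx n
    rw [h0, hf, map_zero, map_zero, zero_sub, eq_comm, neg_eq_zero] at h1
    have : ((n + 1) * (c + n) : ℝ) ≠ 0 := by positivity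
    exact eq_zero_of_f hx hc hf n ((smul_eq_zero_iff_right this).1 h1)

/-- Since f^(n+1) e x = 0, the vector e f^(n+1) x is the multiple of f^n x by -(n+1)(n-c) ≠ 0; the
vanishing of a power of f thus descends to x. -/
theorem eq_zero_of_f_e {x : M} {c : ℝ} (hx : h x = c • x) (hc : c < 0) (hf : f (e x) = 0) :
    ∀ n : ℕ, (f ^ n) x = 0 → x = 0
  | 0, h0 => by simpa using h0
  | n + 1, h0 => by
    have h1 := S.e_pow_f hx n
    rw [h0, pow_succ, Module.End.mul_apply, hf, map_zero, map_zero, zero_sub, eq_comm,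
      neg_eq_zero] at h1
    have : ((n + 1) * (-c + n) : ℝ) ≠ 0 := by
      have : 0 < -c + n := add_pos_of_pos_of_nonneg (by linarith) (by positivity)
      positivity
    exact eq_zero_of_f_e hx hc hf n ((smul_eq_zero_iff_right this).1 h1)

/-- Lowest weight vectors of locally finite modules have weight s - m ≤ 0. -/
theorem comp_eq_zero_of_f {x : M} (hf : f x = 0) {m s : ℕ} (hms : m < s) : comp m s x = 0 := by
  obtain ⟨s, rfl⟩ : ∃ t, s = t + 1 := ⟨s - 1, by omega⟩
  refine S.eq_zero_of_f (S.h_comp m (s + 1) x) ?_ ?_ (m + 1) (S.pow_e_comp _ _ _)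
  · rw [sub_pos]; exact_mod_cast hms
  · rw [S.f_comp_succ, hf, map_zero]

theorem comp_eq_zero_of_e {x : M} (he : e x = 0) {m s : ℕ} (hms : s < m) : comp m s x = 0 :=
  S.symm.comp_eq_zero_of_f he hms

/-- Here x need not be homogeneous: components with m < s vanish because f kills x, the others
because their weight s - m ≤ 0 differs from c. -/
theorem eq_zero_of_f_of_h {x : M} (hf : f x = 0) {c : ℝ} (hc : 0 < c) (hx : h x = c • x) :
    x = 0 := by
  refine S.ext x fun m s => ?_
  by_cases hms : m < s
  · exact S.comp_eq_zero_of_f hf hms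
  · have h1 : comp m s (h x) = comp m s (c • x) := by rw [hx]
    rw [S.comp_h, S.h_comp, LinearMap.map_smul_of_tower, ← sub_eq_zero, ← sub_smul] at h1
    refine (smul_eq_zero_iff_right ?_).1 h1
    have : (s : ℝ) ≤ m := by exact_mod_cast not_lt.1 hms
    linarith

theorem eq_zero_of_e_of_h {x : M} (he : e x = 0) {c : ℝ} (hc : c < 0) (hx : h x = c • x) :
    x = 0 :=
  S.symm.eq_zero_of_f_of_h he (c := -c) (by linarith) (by simp [hx])

/-- This is ker f ∩ im e = 0. A component of e x of nonpositive weight comes from one of x of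
negative weight, to which `eq_zero_of_f_e` applies. -/
theorem e_eq_zero_of_f_e {x : M} (hx : f (e x) = 0) : e x = 0 := by
  refine S.ext _ fun m s => ?_
  rcases lt_or_ge m s with hms | hms
  · exact S.comp_eq_zero_of_f hx hms
  cases s with
  | zero => exact S.comp_e_zero _ _
  | succ s =>
    rw [S.comp_e]
    rw [S.eq_zero_of_f_e (S.h_comp (m + 1) s x) ?_ ?_ (s + 1) (S.pow_f_comp _ _ _), map_zero]
    · rw [sub_neg]; exact_mod_cast (by omega)
    · rw [← S.comp_e, S.f_comp_succ, hx, map_zero]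

theorem f_eq_zero_of_e_f {x : M} (hx : e (f x) = 0) : f x = 0 := S.symm.e_eq_zero_of_f_e hx

/-- A homogeneous vector of positive weight is in the image of `e`. -/
theorem exists_e_of_pos (hN : IsGraded e f comp N) {c : ℝ} (hc : 0 < c) : ∀ (n : ℕ) {x : M},
    x ∈ N → h x = c • x → (e ^ n) x = 0 → ∃ z ∈ N, x = e z
  | 0, x, _, _, h0 => ⟨0, zero_mem _, by simpa using h0⟩
  | n + 1, x, hxN, hx, h0 => by
    -- The vector y is killed by e, and e^n f^n y is a nonzero multiple of y, so subtracting a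
    -- multiple of f^n y from x lowers n. The subtracted term is itself in im e: the coefficient b
    -- relating e f^(n+1) y to f^n y is nonzero because c > 0.
    set y := (e ^ n) x with hy
    have hey : e y = 0 := by rw [hy, ← Module.End.mul_apply, ← pow_succ', h0]
    have hyw : h y = (c + 2 * n) • y := S.h_pow_e hx n
    have hyN : y ∈ N := hN.pow_e_mem hxN n
    have step : ∀ j : ℕ, e ((f ^ (j + 1)) y) = ((j + 1) * (c + 2 * n - j) : ℝ) • (f ^ j) y := by
      intro j
      rw [S.e_pow_f hyw, hey, map_zero, zero_sub, ← neg_smul]; ring_nf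
    have hpow : ∀ j ≤ n, ∃ a : ℝ, a ≠ 0 ∧ (e ^ j) ((f ^ j) y) = a • y := by
      intro j
      induction j with
      | zero => intro _; exact ⟨1, one_ne_zero, by simp⟩
      | succ j ih =>
        intro hj
        obtain ⟨a, ha, h1⟩ := ih (by omega)
        refine ⟨((j + 1) * (c + 2 * n - j) : ℝ) * a, mul_ne_zero ?_ ha, ?_⟩
        · have : (j : ℝ) ≤ n := by exact_mod_cast (by omega : j ≤ n)
          have : 0 < c + 2 * n - j := by nlinarith
          positivity
        · rw [pow_succ, Module.End.mul_apply, step, LinearMap.map_smul_of_tower, h1, smul_smul]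
    obtain ⟨a, ha, h1⟩ := hpow n le_rfl
    have hb : ((n + 1) * (c + 2 * n - n) : ℝ) ≠ 0 := by
      have : 0 < c + 2 * n - n := by nlinarith [(Nat.cast_nonneg n : (0 : ℝ) ≤ n)]
      positivity
    set b : ℝ := (n + 1) * (c + 2 * n - n)
    have hfw : h ((f ^ n) y) = c • (f ^ n) y := by rw [S.h_pow_f hyw]; ring_nf
    obtain ⟨z, hzN, hz⟩ := exists_e_of_pos hN hc n (x := x - a⁻¹ • (f ^ n) y)
      (N.sub_mem hxN (N.smul_of_tower_mem _ (hN.pow_f_mem hyN n)))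
      (by rw [map_sub, LinearMap.map_smul_of_tower, hx, hfw, smul_sub, smul_comm])
      (by rw [map_sub, LinearMap.map_smul_of_tower, h1, smul_smul, inv_mul_cancel₀ ha, one_smul,
            ← hy, sub_self])
    refine ⟨z + (a⁻¹ * b⁻¹) • (f ^ (n + 1)) y,
      N.add_mem hzN (N.smul_of_tower_mem _ (hN.pow_f_mem hyN _)), ?_⟩
    · rw [map_add, LinearMap.map_smul_of_tower, step, smul_smul, mul_assoc, inv_mul_cancel₀ hb,
        mul_one, ← hz, sub_add_cancel]

/-- A homogeneous vector of nonpositive weight is the sum of a vector killed by `f` and of one in the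
image of `e`. -/
theorem exists_add_of_nonpos (hN : IsGraded e f comp N) {c : ℝ} (hc : c ≤ 0) : ∀ (n : ℕ) {x : M},
    x ∈ N → h x = c • x → (f ^ n) x = 0 →
    ∃ y ∈ N, ∃ z ∈ N, f y = 0 ∧ x = y + e z
  | 0, x, _, _, h0 => ⟨0, zero_mem _, 0, zero_mem _, by simp, by simpa using h0⟩
  | n + 1, x, hxN, hx, h0 => by
    -- The mirror argument: subtracting a multiple of e^n y from x lowers the power of f that kills
    -- it.
    set y := (f ^ n) x with hy
    have hfy : f y = 0 := by rw [hy, ← Module.End.mul_apply, ← pow_succ', h0]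
    have hyw : h y = (c - 2 * n) • y := S.h_pow_f hx n
    have hyN : y ∈ N := hN.pow_f_mem hxN n
    have step : ∀ j : ℕ, f ((e ^ (j + 1)) y) = (-((j + 1) * (c - 2 * n + j)) : ℝ) • (e ^ j) y := by
      intro j
      rw [S.f_pow_e hyw, hfy, map_zero, zero_sub, ← neg_smul]
    have hpow : ∀ j ≤ n, ∃ a : ℝ, a ≠ 0 ∧ (f ^ j) ((e ^ j) y) = a • y := by
      intro j
      induction j with
      | zero => intro _; exact ⟨1, one_ne_zero, by simp⟩
      | succ j ih =>
        intro hj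
        obtain ⟨a, ha, h1⟩ := ih (by omega)
        refine ⟨(-((j + 1) * (c - 2 * n + j)) : ℝ) * a, mul_ne_zero (neg_ne_zero.2 ?_) ha, ?_⟩
        · have : (j : ℝ) + 1 ≤ n := by exact_mod_cast hj
          have : c - 2 * n + j < 0 := by nlinarith [(Nat.cast_nonneg j : (0 : ℝ) ≤ j)]
          exact mul_ne_zero (by positivity) this.ne
        · rw [pow_succ, Module.End.mul_apply, step, LinearMap.map_smul_of_tower, h1, smul_smul]
    obtain ⟨a, ha, h1⟩ := hpow n le_rfl
    have hew : h ((e ^ n) y) = c • (e ^ n) y := by rw [S.h_pow_e hyw]; ring_nf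
    obtain ⟨y', hyN', z, hzN, hfy', hz⟩ :=
      exists_add_of_nonpos hN hc n (x := x - a⁻¹ • (e ^ n) y)
      (N.sub_mem hxN (N.smul_of_tower_mem _ (hN.pow_e_mem hyN n)))
      (by rw [map_sub, LinearMap.map_smul_of_tower, hx, hew, smul_sub, smul_comm])
      (by rw [map_sub, LinearMap.map_smul_of_tower, h1, smul_smul, inv_mul_cancel₀ ha, one_smul,
            ← hy, sub_self])
    rw [sub_eq_iff_eq_add] at hz
    -- For n = 0 the subtracted vector is a multiple of y and belongs to ker f; otherwise e^n y = e
    -- (e^(n-1) y) belongs to im e.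
    cases n with
    | zero =>
      refine ⟨y' + a⁻¹ • y, N.add_mem hyN' (N.smul_of_tower_mem _ hyN), z, hzN, ?_, ?_⟩
      · rw [map_add, LinearMap.map_smul_of_tower, hfy', hfy, smul_zero, add_zero]
      · rw [hz, pow_zero, Module.End.one_apply]; abel
    | succ n =>
      refine ⟨y', hyN', z + a⁻¹ • (e ^ n) y,
        N.add_mem hzN (N.smul_of_tower_mem _ (hN.pow_e_mem hyN _)), hfy', ?_⟩
      · rw [hz, map_add, LinearMap.map_smul_of_tower, pow_succ', Module.End.mul_apply]; abel

theorem exists_add_of_comp (hN : IsGraded e f comp N) {x : M} {c : ℝ} (hxN : x ∈ N)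
    (hx : h x = c • x) {n : ℕ} (he : (e ^ n) x = 0) (hf : (f ^ n) x = 0) :
    ∃ y ∈ N, ∃ z ∈ N, f y = 0 ∧ x = y + e z := by
  rcases lt_or_ge 0 c with hc | hc
  · obtain ⟨z, hzN, hz⟩ := S.exists_e_of_pos hN hc n hxN hx he
    exact ⟨0, zero_mem _, z, hzN, map_zero _, by rw [zero_add, hz]⟩
  · exact S.exists_add_of_nonpos hN hc n hxN hx hf

theorem comp_self (m s x) : comp m s (comp m s x) = comp m s x := by
  rw [S.comp_comp]; simp

theorem eq_of_comp {x y : M} (hxy : ∀ m s, comp m s x = comp m s y) : x = y := by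
  rw [← sub_eq_zero]
  exact S.ext _ fun m s => by rw [map_sub, hxy, sub_self]

theorem comp_e_f (m s x) : comp m s (e (f x)) = e (f (comp m s x)) := by
  cases s with
  | zero => rw [S.comp_e_zero, S.f_comp_zero, map_zero]
  | succ s => rw [S.comp_e, S.comp_f]

theorem f_comp_eq_zero {x : M} (hx : f x = 0) (m s) : f (comp m s x) = 0 := by
  cases s with
  | zero => exact S.f_comp_zero m x
  | succ s => rw [S.f_comp_succ, hx, map_zero]

theorem pow_e_eq_zero {m n : ℕ} (hmn : m < n) (s x) : (e ^ n) (comp m s x) = 0 := by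
  obtain ⟨k, rfl⟩ := Nat.exists_eq_add_of_lt hmn
  rw [show m + k + 1 = k + (m + 1) by omega, pow_add, Module.End.mul_apply, S.pow_e_comp, map_zero]

theorem pow_f_eq_zero {s n : ℕ} (hsn : s < n) (m x) : (f ^ n) (comp m s x) = 0 :=
  S.symm.pow_e_eq_zero hsn m x

/-- After splitting off e z, the mirror splitting of z into ker e and im f replaces z by f w, since
e forgets the part in ker e. -/
theorem exists_add_e_f_of_comp (hN : IsGraded e f comp N) {x : M} (hxN : x ∈ N) (m s : ℕ) :
    ∃ y ∈ N, ∃ w ∈ N, f y = 0 ∧ comp m s x = y + e (f w) := by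
  obtain ⟨y, hyN, z, hzN, hfy, hz⟩ := S.exists_add_of_comp hN (hN.comp_mem x hxN m s)
    (S.h_comp m s x) (n := m + s + 1) (S.pow_e_eq_zero (by omega) _ _)
    (S.pow_f_eq_zero (by omega) _ _)
  cases s with
  | zero =>
    refine ⟨comp m 0 x, hN.comp_mem x hxN _ _, 0, zero_mem _, S.f_comp_zero m x, by simp⟩
  | succ s =>
    obtain ⟨y₁, -, w, hwN, hy₁, hw⟩ := S.symm.exists_add_of_comp hN.symm
      (hN.comp_mem z hzN (m + 1) s) (S.symm.h_comp s (m + 1) z) (n := m + s + 2)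
      (S.pow_f_eq_zero (by omega) _ _) (S.pow_e_eq_zero (by omega) _ _)
    refine ⟨comp m (s + 1) y, hN.comp_mem y hyN _ _, w, hwN, S.f_comp_eq_zero hfy _ _, ?_⟩
    have h1 := congrArg (comp m (s + 1)) hz
    rw [S.comp_self, map_add, S.comp_e, hw, map_add, hy₁, zero_add] at h1
    exact h1

theorem exists_add_e_f (hN : IsGraded e f comp N) {x : M} (hxN : x ∈ N) :
    ∃ y ∈ N, ∃ w ∈ N, f y = 0 ∧ x = y + e (f w) := by
  -- The choices are zero wherever the component of x is, as gluing demands.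
  have : ∀ m s, ∃ y ∈ N, ∃ w ∈ N, f y = 0 ∧ comp m s x = y + e (f w) ∧
      (comp m s x = 0 → y = 0) ∧ (comp m s x = 0 → w = 0) := by
    intro m s
    by_cases h0 : comp m s x = 0
    · exact ⟨0, zero_mem _, 0, zero_mem _, by simp, by simp [h0], fun _ => rfl, fun _ => rfl⟩
    · obtain ⟨y, hy, w, hw, hfy, hx⟩ := S.exists_add_e_f_of_comp hN hxN m s
      exact ⟨y, hy, w, hw, hfy, hx, fun h => (h0 h).elim, fun h => (h0 h).elim⟩
  choose gy hgy gw hgw hfy hx hy0 hw0 using this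
  obtain ⟨y, hy⟩ := S.glue x gy hy0
  obtain ⟨w, hw⟩ := S.glue x gw hw0
  refine ⟨y, hN.mem_of_comp _ fun m s => ?_, w, hN.mem_of_comp _ fun m s => ?_,
    S.ext _ fun m s => ?_, S.eq_of_comp fun m s => ?_⟩
  · rw [hy]; exact hN.comp_mem _ (hgy m s) _ _
  · rw [hw]; exact hN.comp_mem _ (hgw m s) _ _
  · cases m with
    | zero => exact S.comp_f_zero _ _
    | succ m => rw [S.comp_f, hy, S.f_comp_eq_zero (hfy _ _)]
  · have h1 := congrArg (comp m s) (hx m s)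
    rw [S.comp_self, map_add, S.comp_e_f] at h1
    rw [map_add, S.comp_e_f, hy, hw, h1]

theorem isGraded_top : IsGraded e f comp ⊤ :=
  ⟨fun _ _ => trivial, fun _ _ => trivial, fun _ _ _ _ => trivial, fun _ _ => trivial⟩

theorem isCompl : IsCompl (LinearMap.ker f) (LinearMap.range e) := by
  refine IsCompl.of_le ?_ fun x _ => ?_
  · rintro _ ⟨hx, z, rfl⟩
    exact S.e_eq_zero_of_f_e hx
  · obtain ⟨y, -, w, -, hy, rfl⟩ := S.exists_add_e_f S.isGraded_top (x := x) trivial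
    exact Submodule.add_mem_sup hy ⟨_, rfl⟩

/-- The projector onto the kernel of `f` along the image of `e`. -/
def projF : Module.End R M := Submodule.projection _ _ S.isCompl

/-- The projector onto the kernel of `e` along the image of `f`. -/
def projE : Module.End R M := S.symm.projF

/-- Injectivity is ker e ∩ im f = 0; surjectivity holds because e annihilates the first summand of
ker e ⊕ im f. -/
theorem restrict_bijective : Function.Bijective
    ((e.domRestrict (LinearMap.range f)).codRestrict (LinearMap.range e) fun x => ⟨x, rfl⟩) := by
  refine ⟨(injective_iff_map_eq_zero _).2 ?_, ?_⟩
  · rintro ⟨_, w, rfl⟩ hx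
    exact Subtype.ext (S.f_eq_zero_of_e_f (congrArg Subtype.val hx))
  · rintro ⟨_, z, rfl⟩
    obtain ⟨y, -, w, -, hy, rfl⟩ := S.symm.exists_add_e_f S.symm.isGraded_top (x := z) trivial
    exact ⟨⟨_, e w, rfl⟩, Subtype.ext (show e (f (e w)) = e (y + f (e w)) by
      rw [map_add, hy, zero_add])⟩

/-- The inverse of `e`, as a map from the image of `f` to that of `e`, extended by zero to the kernel
of `f`. -/
def invE : Module.End R M :=
  (LinearMap.range f).subtype ∘ₗ (LinearEquiv.ofBijective _ S.restrict_bijective).symm.toLinearMap ∘ₗ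
    Submodule.projectionOnto _ _ S.isCompl.symm

theorem projF_of_f {x : M} (hx : f x = 0) : S.projF x = x :=
  Submodule.projection_apply_of_mem_left S.isCompl hx

theorem projF_e (x : M) : S.projF (e x) = 0 :=
  (Submodule.projection_apply_eq_zero_iff S.isCompl).2 ⟨x, rfl⟩

theorem f_projF (x : M) : f (S.projF x) = 0 := Submodule.projection_apply_mem S.isCompl x

theorem projF_projF (x : M) : S.projF (S.projF x) = S.projF x := S.projF_of_f (S.f_projF x)

theorem invE_of_f {x : M} (hx : f x = 0) : S.invE x = 0 := by
  simp only [invE, LinearMap.comp_apply]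
  rw [(Submodule.projectionOnto_apply_eq_zero_iff S.isCompl.symm).2 hx, map_zero, map_zero]

theorem invE_e_f (x : M) : S.invE (e (f x)) = f x := by
  simp only [invE, LinearMap.comp_apply]
  rw [Submodule.projectionOnto_apply_of_mem_left S.isCompl.symm ⟨f x, rfl⟩]
  have : (⟨e (f x), f x, rfl⟩ : LinearMap.range e) =
      LinearEquiv.ofBijective _ S.restrict_bijective ⟨f x, x, rfl⟩ := rfl
  rw [this, LinearEquiv.coe_coe, LinearEquiv.symm_apply_apply]
  rfl

/-- The decomposition exists inside N and is unique in M, so the projector and the inverse of e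
respect N. It is needed for the traceless states. -/
theorem exists_projF_invE (hN : IsGraded e f comp N) {x : M} (hx : x ∈ N) :
    S.projF x ∈ N ∧ x = S.projF x + e (S.invE x) ∧ ∃ w ∈ N, S.invE x = f w := by
  obtain ⟨y, hy, w, hw, hfy, rfl⟩ := S.exists_add_e_f hN hx
  rw [map_add, S.projF_of_f hfy, S.projF_e, add_zero, map_add, S.invE_of_f hfy, S.invE_e_f,
    zero_add]
  exact ⟨hy, rfl, w, hw, rfl⟩

theorem eq_projF_add (x : M) : x = S.projF x + e (S.invE x) :=
  (S.exists_projF_invE S.isGraded_top (x := x) trivial).2.1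

theorem exists_invE (x : M) : ∃ w, S.invE x = f w := by
  obtain ⟨w, -, h⟩ := (S.exists_projF_invE S.isGraded_top (x := x) trivial).2.2
  exact ⟨w, h⟩

theorem projE_of_e {x : M} (hx : e x = 0) : S.projE x = x := S.symm.projF_of_f hx

theorem projE_f (x : M) : S.projE (f x) = 0 := S.symm.projF_e x

theorem e_projE (x : M) : e (S.projE x) = 0 := S.symm.f_projF x

theorem projE_projE (x : M) : S.projE (S.projE x) = S.projE x := S.symm.projF_projF x

theorem eq_zero_of_f_of_e {x : M} (h1 : f x = 0) (z : M) (h2 : x = e z) : x = 0 := by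
  rw [h2] at h1 ⊢; exact S.e_eq_zero_of_f_e h1

theorem eq_zero_of_e_of_f {x : M} (h1 : e x = 0) (z : M) (h2 : x = f z) : x = 0 :=
  S.symm.eq_zero_of_f_of_e h1 z h2

theorem eq_projE_add (x : M) : ∃ w, x = S.projE x + f w :=
  ⟨_, S.symm.eq_projF_add x⟩

theorem f_h {x : M} (hx : f x = 0) : f (h x) = 0 := by
  have := S.hf x
  rw [hx, map_zero, smul_zero, sub_zero] at this
  exact this.symm

theorem e_h {x : M} (hx : e x = 0) : e (h x) = 0 := by
  have := S.he x
  rw [hx, map_zero, smul_zero, add_zero] at this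
  exact this.symm

/-- The part of x in ker e lives where m ≤ s. There x vanishes, so this part equals minus the part
in im f, and ker e ∩ im f = 0. -/
theorem projE_eq_zero {x : M} (hx : ∀ m s, m ≤ s → comp m s x = 0) : S.projE x = 0 := by
  obtain ⟨w, hw⟩ := S.eq_projE_add x
  have he := S.e_projE x
  refine S.ext _ fun m s => ?_
  rcases lt_or_ge s m with hms | hms
  · exact S.comp_eq_zero_of_e he hms
  have h1 := hx m s hms
  rw [hw, map_add] at h1
  cases m with
  | zero => rw [S.comp_f_zero, add_zero] at h1; exact h1
  | succ m =>
    rw [S.comp_f, add_eq_zero_iff_eq_neg, ← map_neg] at h1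
    exact S.eq_zero_of_e_of_f (S.symm.f_comp_eq_zero he s (m + 1)) _ h1

/-- A vector in the image of `f` on which `f e` takes a value killed by `f`. -/
theorem f_eq_zero_of_f_f_e {x : M} {w : M} (hx : x = f w) (h0 : f (f (e x)) = 0) : f x = 0 := by
  -- In an irreducible module f e acts on the weight vectors in im f by nonzero scalars, so f (f e
  -- x) and f x vanish together. Without decomposing into irreducibles: x = y + e z along ker f ⊕ im
  -- e, the hypothesis forces e e z = 0, and the part t of y in ker e satisfies f x = -f t, where e
  -- f t lies in ker e ∩ im f.
  set y := S.projF x with hy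
  set z := S.invE x with hz
  have hxy : x = y + e z := S.eq_projF_add x
  have hfy : f y = 0 := S.f_projF x
  have h1 : f (e y) = -h y := by
    have := S.ef y
    rw [hfy, map_zero] at this
    exact eq_neg_of_add_eq_zero_left this.symm
  have h2 : f (f (e (e z))) = 0 := by
    rw [hxy, map_add, map_add, map_add, h1, map_neg, S.f_h hfy, neg_zero, zero_add] at h0
    exact h0
  have h3 : f (e (e z)) = e (f (e z) - h z - (2 : ℝ) • z) := by
    have := S.ef (e z)
    rw [S.he] at this
    rw [map_sub, map_sub, LinearMap.map_smul_of_tower, this]; abel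
  have h4 : e (e z) = 0 := S.e_eq_zero_of_f_e (S.eq_zero_of_f_of_e h2 _ h3)
  obtain ⟨u, hu⟩ := S.eq_projE_add y
  set t := S.projE y
  have het : e t = 0 := S.e_projE y
  have h5 : x = f u := by
    rw [← sub_eq_zero]
    refine S.eq_zero_of_e_of_f ?_ (w - u) (by rw [map_sub, hx])
    rw [hxy, hu, show t + f u + e z - f u = t + e z by abel, map_add, het, h4, add_zero]
  have h6 : f x = -f t := by
    have : f y = f t + f (f u) := by rw [← map_add, ← hu]
    rw [h5, eq_neg_iff_add_eq_zero, add_comm, ← this, hfy]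
  have h7 : e (f t) = h t := by rw [S.ef, het, map_zero, zero_add]
  have h8 : e (f t) = 0 := by
    refine S.eq_zero_of_e_of_f (by rw [h7]; exact S.e_h het)
      (-(e (f u) + h u - (2 : ℝ) • u)) ?_
    have h9 : e (f t) = -e (f x) := by rw [h6, map_neg, neg_neg]
    rw [h9, h5, S.ef (f u), S.hf, map_neg, map_sub, map_add, LinearMap.map_smul_of_tower]; abel
  rw [h6, S.f_eq_zero_of_e_f h8, neg_zero]

/-- A vector of ker f ∩ im f has only negative weights: a weight zero component in ker f is
invariant, hence killed by e, and ker e ∩ im f = 0. -/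
theorem comp_eq_zero_of_f_of_mem {x : M} (hx : f x = 0) {w : M} (hw : x = f w) {m s : ℕ}
    (hms : m ≤ s) : comp m s x = 0 := by
  rcases hms.lt_or_eq with hms | rfl
  · exact S.comp_eq_zero_of_f hx hms
  have h1 : e (comp m m x) = 0 := by
    refine S.e_eq_zero_of_f_e ?_
    have := S.ef (comp m m x)
    rw [S.f_comp_eq_zero hx, map_zero, S.h_comp, sub_self, zero_smul, add_zero] at this
    exact this.symm
  cases m with
  | zero => rw [hw]; exact S.comp_f_zero _ _
  | succ m => exact S.eq_zero_of_e_of_f h1 (comp m (m + 2) w) (by rw [hw, S.comp_f])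

end BigradedSl2

/-! ### Compatibility of the homogeneous splittings with the shifted sl₂ (e, f + v, h - p). -/

/-- A doublet of operators under `sl₂`. -/
structure Doublet (e f v p : Module.End R M) : Prop where
  ev : ∀ x, e (v x) = v (e x) - p x
  ep : ∀ x, e (p x) = p (e x)
  fp : ∀ x, f (p x) = p (f x) - v x
  fv : ∀ x, f (v x) = v (f x)

namespace BigradedSl2

variable {v p : Module.End R M} (S : BigradedSl2 e f h comp) (T : Doublet e f v p)
include S T

/-- By the doublet relations [e, f + v] = h - p and [h - p, e] = 2e. -/
theorem shifted_e {x : M} (h1 : f x + v x = 0) (h2 : h x - p x = 0) :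
    f (e x) + v (e x) = 0 ∧ h (e x) - p (e x) = (2 : ℝ) • e x := by
  constructor
  · have h3 := S.ef x
    have h4 := T.ev x
    have h5 : e (f x) + e (v x) = 0 := by rw [← map_add, h1, map_zero]
    rw [h3, h4] at h5
    rw [← h5, sub_eq_zero.1 h2]; abel
  · rw [S.he, ← T.ep, sub_eq_zero.1 h2]; abel

/-- For x = y + e z with y in ker f, the obstruction is v y. It lies in ker f, and both constraints
together force h (v y) = v y, a weight excluded there. -/
theorem shifted_projF {x : M} (h1 : f x + v x = 0) (h2 : h x - p x = (2 : ℝ) • x) :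
    v (S.projF x) = 0 ∧ h (S.projF x) - p (S.projF x) = (2 : ℝ) • S.projF x := by
  have hx := S.eq_projF_add x
  have hfy := S.f_projF x
  set y := S.projF x
  set z := S.invE x
  set A := h z - p z with hA
  have hAB : A = v y + e (f z + v z) := by
    rw [hx, map_add, map_add, hfy, zero_add] at h1
    have h3 := S.ef z
    have h4 := T.ev z
    rw [map_add, h3, h4, hA, ← sub_eq_zero, ← neg_zero, ← h1]; abel
  have heA : e A = (2 : ℝ) • y - (h y - p y) := by
    rw [hx, map_add, map_add, smul_add, S.he, ← T.ep] at h2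
    rw [hA, map_sub, eq_sub_iff_add_eq, ← sub_eq_zero, ← sub_eq_zero.2 h2]; abel
  have hvy : f (e A) = -v y := by
    rw [heA, map_sub, map_sub, T.fp, LinearMap.map_smul_of_tower, hfy, S.f_h hfy]; simp
  have hfvy : f (v y) = 0 := by rw [T.fv, hfy, map_zero]
  have h5 : f (e (v y)) = -h (v y) := by
    have := S.ef (v y)
    rw [hfvy, map_zero] at this
    exact eq_neg_of_add_eq_zero_left this.symm
  -- This difference lies in ker f, and computing f e A in two ways exhibits it as an element of im
  -- e.
  have h6 : v y - h (v y) = 0 := by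
    set B := f z + v z
    refine S.eq_zero_of_f_of_e (by rw [map_sub, hfvy, S.f_h hfvy, sub_zero])
      (-(f (e B) - h B - (2 : ℝ) • B)) ?_
    have h7 := S.ef (e B)
    rw [hAB, map_add, map_add, h5] at hvy
    rw [map_neg, map_sub, map_sub, LinearMap.map_smul_of_tower, h7, S.he]
    linear_combination (norm := module) hvy
  have h8 : v y = 0 :=
    S.eq_zero_of_f_of_h hfvy one_pos (by rw [one_smul]; exact (sub_eq_zero.1 h6).symm)
  refine ⟨h8, ?_⟩
  rw [h8, neg_zero] at hvy
  rw [S.e_eq_zero_of_f_e hvy, eq_comm, sub_eq_zero] at heA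
  exact heA.symm

/-- A converse of `shifted_e` on im f. The failure A of the weight condition lies in ker e and is
shown to have weight -1, so it vanishes; the failure of the other condition is then in ker e ∩ im f.
-/
theorem shifted_of_e_f {w : M} (h1 : f (e (f w)) + v (e (f w)) = 0)
    (h2 : h (e (f w)) - p (e (f w)) = (2 : ℝ) • e (f w)) :
    f (f w) + v (f w) = 0 ∧ h (f w) - p (f w) = 0 := by
  set A := h (f w) - p (f w) with hA
  have heA : e A = 0 := by
    rw [S.he, ← T.ep] at h2
    rw [hA, map_sub, ← sub_eq_zero.2 h2]; abel
  have hB : f (f w) + v (f w) = f (f w + v w) := by rw [map_add, T.fv]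
  have heB : e (f (f w) + v (f w)) = A := by
    have h3 := S.ef (f w)
    have h4 := T.ev (f w)
    rw [map_add, h3, h4, hA, ← sub_eq_zero, ← h1]; abel
  -- Moving f to the left in A gives A = f (h w - p w) - 2 f w - v w, whence the witness.
  obtain ⟨u, hu⟩ : ∃ u, f w + v w = -A + f u := by
    refine ⟨h w - w - p w, ?_⟩
    rw [hA, S.hf, map_sub, map_sub, T.fp]
    module
  clear_value A
  have h5 : A + h A = 0 := by
    refine S.eq_zero_of_e_of_f (by rw [map_add, heA, S.e_h heA, add_zero])
      (e (f u) + h u - (2 : ℝ) • u) ?_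
    have h6 := S.ef A
    rw [heA, map_zero, zero_add] at h6
    have h7 := S.ef (f u)
    rw [S.hf] at h7
    rw [hB, hu, map_add, map_add, map_neg, map_neg, h6, h7] at heB
    rw [map_sub, map_add, LinearMap.map_smul_of_tower]
    linear_combination (norm := module) -heB
  have hA0 : A = 0 := S.eq_zero_of_e_of_h heA (c := -1) (by norm_num)
    (by rw [neg_one_smul]; exact eq_neg_of_add_eq_zero_right h5)
  refine ⟨?_, hA0⟩
  exact S.eq_zero_of_e_of_f (by rw [heB, hA0]) _ hB

end BigradedSl2

end BigradedSl2

/-! ### Coefficient formulas and the Weyl algebra relations of Y, a† and their derivatives. -/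

section Weyl

variable {d : ℕ} {R : Type} [CommRing R]

open MvPowerSeries in
theorem coef_ext {f g : Ser d R} (h : ∀ α β, coef α β f = coef α β g) : f = g :=
  MvPowerSeries.ext fun α => MvPolynomial.ext _ _ fun β => h α β

@[simp] theorem coef_add (α β) (f g : Ser d R) : coef α β (f + g) = coef α β f + coef α β g := rfl

@[simp] theorem coef_zero (α β) : coef α β (0 : Ser d R) = 0 := rfl

@[simp] theorem coef_smul (α β) (c : R) (f : Ser d R) : coef α β (c • f) = c * coef α β f := rfl

theorem coef_dY (A : Fin (d + 1)) (α β) (f : Ser d R) :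
    coef α β (dY A f) = coef (α + Finsupp.single A 1) β f * (α A + 1) := by
  change MvPolynomial.coeff β (MvPowerSeries.coeff (R := Osc d R) (α + Finsupp.single A 1) f *
    ((α A : Osc d R) + 1)) = _
  have : ((α A : Osc d R) + 1) = MvPolynomial.C ((α A : R) + 1) := by simp
  rw [this, mul_comm, MvPolynomial.coeff_C_mul, mul_comm]; rfl

theorem coef_da (A : Fin (d + 1)) (α β) (f : Ser d R) :
    coef α β (da A f) = coef α (β + Finsupp.single A 1) f * (β A + 1) := by
  change MvPolynomial.coeff β (MvPolynomial.pderiv A (MvPowerSeries.coeff (R := Osc d R) α f)) = _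
  rw [MvPolynomial.coeff_pderiv]; rfl

theorem coef_mY (A : Fin (d + 1)) (α β) (f : Ser d R) :
    coef α β (mY A f) = if α A = 0 then 0 else coef (α - Finsupp.single A 1) β f := by
  have key : ∀ g : MvPowerSeries (Fin (d + 1)) (Osc d R),
      MvPowerSeries.coeff α (MvPowerSeries.monomial (Finsupp.single A 1) 1 * g) =
        if α A = 0 then 0 else MvPowerSeries.coeff (α - Finsupp.single A 1) g := by
    intro g
    rw [MvPowerSeries.coeff_monomial_mul]
    by_cases h : α A = 0
    · rw [if_pos h, if_neg]
      rw [Finsupp.single_le_iff, h]; simp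
    · rw [if_neg h, if_pos, one_mul]
      rw [Finsupp.single_le_iff]; omega
  refine (congrArg (MvPolynomial.coeff β) (key f)).trans ?_
  split_ifs <;> rfl

theorem coef_ma (A : Fin (d + 1)) (α β) (f : Ser d R) :
    coef α β (ma A f) = if β A = 0 then 0 else coef α (β - Finsupp.single A 1) f := by
  have key : ∀ g : MvPowerSeries (Fin (d + 1)) (Osc d R),
      MvPolynomial.coeff β (MvPowerSeries.coeff α (MvPowerSeries.C (MvPolynomial.X A) * g)) =
        if β A = 0 then 0 else
          MvPolynomial.coeff (β - Finsupp.single A 1) (MvPowerSeries.coeff α g) := by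
    intro g
    rw [MvPowerSeries.coeff_C_mul, mul_comm, MvPolynomial.coeff_mul_X']
    by_cases h : β A = 0
    · rw [if_pos h, if_neg (by simpa using h)]
    · rw [if_neg h, if_pos (by simpa using h)]
  exact key f

theorem dY_mY (A B : Fin (d + 1)) (f : Ser d R) :
    dY A (mY B f) = mY B (dY A f) + if A = B then f else 0 := by
  refine coef_ext fun α β => ?_
  rw [coef_add, coef_mY, coef_dY, coef_mY]
  rcases eq_or_ne A B with rfl | hAB
  · rw [if_pos rfl, if_neg (by simp), add_tsub_cancel_right]
    split_ifs with h
    · simp [h]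
    · rw [coef_dY, tsub_add_cancel_of_le (by rw [Finsupp.single_le_iff]; omega)]
      simp only [Finsupp.tsub_apply, Finsupp.single_eq_same]
      rw [Nat.cast_sub (by omega)]; push_cast; ring
  · rw [if_neg hAB, coef_zero, add_zero]
    simp only [Finsupp.add_apply, Finsupp.single_eq_of_ne' hAB, add_zero]
    split_ifs with h
    · simp
    · rw [coef_dY, tsub_add_eq_add_tsub (by rw [Finsupp.single_le_iff]; omega)]
      simp [Finsupp.single_eq_of_ne hAB]

theorem da_ma (A B : Fin (d + 1)) (f : Ser d R) :
    da A (ma B f) = ma B (da A f) + if A = B then f else 0 := by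
  refine coef_ext fun α β => ?_
  rw [coef_add, coef_ma, coef_da, coef_ma]
  rcases eq_or_ne A B with rfl | hAB
  · rw [if_pos rfl, if_neg (by simp), add_tsub_cancel_right]
    split_ifs with h
    · simp [h]
    · rw [coef_da, tsub_add_cancel_of_le (by rw [Finsupp.single_le_iff]; omega)]
      simp only [Finsupp.tsub_apply, Finsupp.single_eq_same]
      rw [Nat.cast_sub (by omega)]; push_cast; ring
  · rw [if_neg hAB, coef_zero, add_zero]
    simp only [Finsupp.add_apply, Finsupp.single_eq_of_ne' hAB, add_zero]
    split_ifs with h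
    · simp
    · rw [coef_da, tsub_add_eq_add_tsub (by rw [Finsupp.single_le_iff]; omega)]
      simp [Finsupp.single_eq_of_ne hAB]

theorem dY_dY (A B : Fin (d + 1)) (f : Ser d R) : dY A (dY B f) = dY B (dY A f) := by
  refine coef_ext fun α β => ?_
  simp only [coef_dY, Finsupp.add_apply, add_right_comm α]
  rcases eq_or_ne A B with rfl | hAB
  · rfl
  · simp [Finsupp.single_eq_of_ne hAB, Finsupp.single_eq_of_ne hAB.symm]; ring

theorem da_da (A B : Fin (d + 1)) (f : Ser d R) : da A (da B f) = da B (da A f) := by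
  refine coef_ext fun α β => ?_
  simp only [coef_da, Finsupp.add_apply, add_right_comm β]
  rcases eq_or_ne A B with rfl | hAB
  · rfl
  · simp [Finsupp.single_eq_of_ne hAB, Finsupp.single_eq_of_ne hAB.symm]; ring

theorem da_dY (A B : Fin (d + 1)) (f : Ser d R) : da A (dY B f) = dY B (da A f) := by
  refine coef_ext fun α β => ?_
  simp only [coef_da, coef_dY]; ring

theorem da_mY (A B : Fin (d + 1)) (f : Ser d R) : da A (mY B f) = mY B (da A f) := by
  refine coef_ext fun α β => ?_
  simp only [coef_da, coef_mY]; split_ifs <;> simp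

theorem dY_ma (A B : Fin (d + 1)) (f : Ser d R) : dY A (ma B f) = ma B (dY A f) := by
  refine coef_ext fun α β => ?_
  simp only [coef_dY, coef_ma]; split_ifs <;> simp

theorem mY_mY (A B : Fin (d + 1)) (f : Ser d R) : mY A (mY B f) = mY B (mY A f) :=
  mul_left_comm _ _ f

theorem ma_ma (A B : Fin (d + 1)) (f : Ser d R) : ma A (ma B f) = ma B (ma A f) :=
  mul_left_comm _ _ f

theorem ma_mY (A B : Fin (d + 1)) (f : Ser d R) : ma A (mY B f) = mY B (ma A f) :=
  mul_left_comm _ _ f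

end Weyl

/-! ### Bihomogeneous components of power series. -/

section Components

variable {d : ℕ} {R : Type} [CommRing R]

/-- The component of degree `m` in `Y` and degree `s` in `a†`. -/
def comp (m s : ℕ) : Module.End R (Ser d R) where
  toFun f := fun α => if α.degree = m then MvPolynomial.homogeneousComponent s (f α) else 0
  map_add' f g := funext fun α => by
    change (if α.degree = m then MvPolynomial.homogeneousComponent s (f α + g α) else 0) =
      (if α.degree = m then MvPolynomial.homogeneousComponent s (f α) else 0) +
      (if α.degree = m then MvPolynomial.homogeneousComponent s (g α) else 0)
    split_ifs <;> simp
  map_smul' c f := funext fun α => by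
    change (if α.degree = m then MvPolynomial.homogeneousComponent s (c • f α : Osc d R) else 0) =
      c • (if α.degree = m then MvPolynomial.homogeneousComponent s (f α : Osc d R) else 0)
    split_ifs <;> simp

theorem coef_comp (m s : ℕ) (f : Ser d R) (α β) :
    coef α β (comp m s f) = if α.degree = m ∧ β.degree = s then coef α β f else 0 := by
  change MvPolynomial.coeff β (if α.degree = m then MvPolynomial.homogeneousComponent s (f α) else 0) = _
  by_cases h : α.degree = m
  · rw [if_pos h, MvPolynomial.coeff_homogeneousComponent]; simp only [h, true_and]; rfl
  · rw [if_neg h, if_neg (by tauto)]; simp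

theorem ext_of_comp {f g : Ser d R} (h : ∀ m s, comp m s f = comp m s g) : f = g := by
  refine coef_ext fun α β => ?_
  have := congrArg (coef α β) (h α.degree β.degree)
  simpa [coef_comp] using this

theorem comp_dY (m s A) (f : Ser d R) : comp m s (dY A f) = dY A (comp (m + 1) s f) := by
  refine coef_ext fun α β => ?_
  simp only [coef_comp, coef_dY, map_add, Finsupp.degree_single, add_left_inj]
  split_ifs <;> simp

theorem comp_da (m s A) (f : Ser d R) : comp m s (da A f) = da A (comp m (s + 1) f) := by
  refine coef_ext fun α β => ?_
  simp only [coef_comp, coef_da, map_add, Finsupp.degree_single, add_left_inj]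
  split_ifs <;> simp

theorem degree_sub_single {α : Fin (d + 1) →₀ ℕ} {A} (h : α A ≠ 0) :
    (α - Finsupp.single A 1).degree + 1 = α.degree := by
  conv_rhs => rw [← tsub_add_cancel_of_le
    (show Finsupp.single A 1 ≤ α by rw [Finsupp.single_le_iff]; omega)]
  simp

theorem comp_mY (m s A) (f : Ser d R) : comp (m + 1) s (mY A f) = mY A (comp m s f) := by
  refine coef_ext fun α β => ?_
  simp only [coef_comp, coef_mY]
  by_cases h : α A = 0
  · simp [h]
  · simp only [h, if_false, ← degree_sub_single h, add_left_inj]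

theorem comp_mY_zero (s A) (f : Ser d R) : comp 0 s (mY A f) = 0 := by
  refine coef_ext fun α β => ?_
  simp only [coef_comp, coef_mY, coef_zero]
  by_cases h : α A = 0
  · simp [h]
  · simp [← degree_sub_single h]

theorem comp_ma (m s A) (f : Ser d R) : comp m (s + 1) (ma A f) = ma A (comp m s f) := by
  refine coef_ext fun α β => ?_
  simp only [coef_comp, coef_ma]
  by_cases h : β A = 0
  · simp [h]
  · simp only [h, if_false, ← degree_sub_single h, add_left_inj]

theorem comp_ma_zero (m A) (f : Ser d R) : comp m 0 (ma A f) = 0 := by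
  refine coef_ext fun α β => ?_
  simp only [coef_comp, coef_ma, coef_zero]
  by_cases h : β A = 0
  · simp [h]
  · simp [← degree_sub_single h]

theorem comp_comp (m s m' s') (f : Ser d R) :
    comp m s (comp m' s' f) = if m = m' ∧ s = s' then comp m s f else 0 := by
  refine coef_ext fun α β => ?_
  split_ifs with h
  · obtain ⟨rfl, rfl⟩ := h
    simp only [coef_comp]; split_ifs <;> rfl
  · simp only [coef_comp, coef_zero]
    split_ifs <;> first | rfl | omega

theorem coef_mY_dY (A α β) (f : Ser d R) : coef α β (mY A (dY A f)) = α A * coef α β f := by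
  rw [coef_mY, coef_dY]
  split_ifs with h
  · simp [h]
  · rw [tsub_add_cancel_of_le (by rw [Finsupp.single_le_iff]; omega)]
    simp only [Finsupp.tsub_apply, Finsupp.single_eq_same]
    rw [Nat.cast_sub (by omega)]; push_cast; ring

theorem coef_ma_da (A α β) (f : Ser d R) : coef α β (ma A (da A f)) = β A * coef α β f := by
  rw [coef_ma, coef_da]
  split_ifs with h
  · simp [h]
  · rw [tsub_add_cancel_of_le (by rw [Finsupp.single_le_iff]; omega)]
    simp only [Finsupp.tsub_apply, Finsupp.single_eq_same]
    rw [Nat.cast_sub (by omega)]; push_cast; ring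

/-- `a^{†A} ∂/∂a^{†A} - Y^A ∂/∂Y^A`. -/
def h0 : Module.End R (Ser d R) := ∑ A, (ma A * da A - mY A * dY A)

/-- Evaluation of a coefficient, as a linear map. -/
def coefₗ (α β : Fin (d + 1) →₀ ℕ) : Ser d R →ₗ[R] R where
  toFun := coef α β
  map_add' _ _ := rfl
  map_smul' _ _ := rfl

theorem coef_sum {ι : Type*} (s : Finset ι) (g : ι → Ser d R) (α β) :
    coef α β (∑ i ∈ s, g i) = ∑ i ∈ s, coef α β (g i) := map_sum (coefₗ α β) g s

theorem coef_sub (α β) (f g : Ser d R) : coef α β (f - g) = coef α β f - coef α β g :=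
  map_sub (coefₗ α β) f g

theorem coef_h0 (α β) (f : Ser d R) :
    coef α β (h0 f) = ((β.degree : R) - α.degree) * coef α β f := by
  simp only [h0, LinearMap.sum_apply, LinearMap.sub_apply, Module.End.mul_apply, coef_sum, coef_sub,
    coef_mY_dY, coef_ma_da, ← sub_mul, ← Finset.sum_mul, Finset.sum_sub_distrib,
    Finsupp.degree_eq_sum, Nat.cast_sum]

/-- Only finitely many monomials in Y have degree m, and each has a polynomial coefficient. -/
theorem exists_comp_eq_zero (f : Ser d R) (m : ℕ) : ∃ n, ∀ s, n ≤ s → comp m s f = 0 := by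
  have hfin : {α : Fin (d + 1) →₀ ℕ | α.degree = m}.Finite :=
    (Finsupp.finite_of_degree_le m).subset fun α hα => le_of_eq hα
  refine ⟨hfin.toFinset.sup (fun α => MvPolynomial.totalDegree (f α : Osc d R)) + 1, fun s hs => ?_⟩
  refine coef_ext fun α β => ?_
  rw [coef_comp, coef_zero]
  split_ifs with h
  · refine MvPolynomial.coeff_eq_zero_of_totalDegree_lt (f := (f α : Osc d R)) ?_
    have h1 : MvPolynomial.totalDegree (f α : Osc d R) ≤ _ :=
      Finset.le_sup (f := fun α => MvPolynomial.totalDegree (f α : Osc d R))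
        (hfin.mem_toFinset.2 h.1)
    rw [← Finsupp.degree_apply, h.2]
    omega
  · rfl

/-- The bounds on the a†-degree for x serve for g as well, so each coefficient of the glued series
is a finite sum. -/
theorem exists_glue (x : Ser d R) (g : ℕ → ℕ → Ser d R)
    (hg : ∀ m s, comp m s x = 0 → g m s = 0) : ∃ y, ∀ m s, comp m s y = comp m s (g m s) := by
  choose n hn using exists_comp_eq_zero x
  let y : Ser d R := fun α => ∑ s ∈ Finset.range (n α.degree),
    MvPolynomial.homogeneousComponent s (g α.degree s α : Osc d R)
  refine ⟨y, fun m s => coef_ext fun α β => ?_⟩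
  rw [coef_comp, coef_comp]
  split_ifs with h
  · obtain ⟨rfl, rfl⟩ := h
    change MvPolynomial.coeff β (∑ s ∈ Finset.range (n α.degree),
      MvPolynomial.homogeneousComponent s (g α.degree s α : Osc d R)) = _
    simp only [MvPolynomial.coeff_sum, MvPolynomial.coeff_homogeneousComponent]
    rw [Finset.sum_ite_eq]
    split_ifs with h
    · rfl
    · rw [hg _ _ (hn _ _ (by simpa using h)), coef_zero]
  · rfl

end Components

/-! ### The sl₂ action, linear vector fields and traces on power series. -/

section Operators

variable {d : ℕ} {R : Type} [CommRing R]

theorem Sdag_apply (f : Ser d R) : Sdag f = ∑ A, ma A (dY A f) := by simp [Sdag]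

theorem Yda_apply (f : Ser d R) : Yda f = ∑ A, mY A (da A f) := by simp [Yda]

theorem h0_apply (f : Ser d R) : h0 f = ∑ A, (ma A (da A f) - mY A (dY A f)) := by simp [h0]

theorem map_ite_zero (T : Module.End R (Ser d R)) (p : Prop) [Decidable p] (f : Ser d R) :
    T (if p then f else 0) = if p then T f else 0 := by
  split_ifs <;> simp

theorem Sdag_mY (B) (f : Ser d R) : Sdag (mY B f) = mY B (Sdag f) + ma B f := by
  simp only [Sdag_apply, dY_mY, ma_mY, map_add, map_sum, map_ite_zero, Finset.sum_add_distrib,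
    Finset.sum_ite_eq', Finset.mem_univ, if_true]

theorem Sdag_dY (B) (f : Ser d R) : Sdag (dY B f) = dY B (Sdag f) := by
  simp only [Sdag_apply, dY_ma, dY_dY _ B, map_sum]

theorem Sdag_da (B) (f : Ser d R) : Sdag (da B f) = da B (Sdag f) - dY B f := by
  simp only [Sdag_apply, da_ma, da_dY, map_sum, Finset.sum_add_distrib, Finset.sum_ite_eq,
    Finset.mem_univ, if_true, add_sub_cancel_right]

theorem Yda_dY (B) (f : Ser d R) : Yda (dY B f) = dY B (Yda f) - da B f := by
  simp only [Yda_apply, dY_mY, ← da_dY, map_sum, Finset.sum_add_distrib, Finset.sum_ite_eq,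
    Finset.mem_univ, if_true, add_sub_cancel_right]

theorem Yda_da (B) (f : Ser d R) : Yda (da B f) = da B (Yda f) := by
  simp only [Yda_apply, da_mY, da_da _ B, map_sum]

theorem Sdag_Yda (f : Ser d R) : Sdag (Yda f) = Yda (Sdag f) + h0 f := by
  simp only [Yda_apply, map_sum, Sdag_mY, Sdag_da, map_sub, h0_apply, ← Finset.sum_add_distrib]
  exact Finset.sum_congr rfl fun A _ => by abel

theorem h0_dY (B) (f : Ser d R) : h0 (dY B f) = dY B (h0 f) + dY B f := by
  simp only [h0_apply, dY_mY, dY_ma, da_dY, dY_dY _ B, map_sum, map_sub, Finset.sum_sub_distrib,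
    Finset.sum_add_distrib, Finset.sum_ite_eq, Finset.mem_univ, if_true]; abel

theorem h0_da (B) (f : Ser d R) : h0 (da B f) = da B (h0 f) - da B f := by
  simp only [h0_apply, da_mY, da_ma, ← da_dY, da_da _ B, map_sum, map_sub, Finset.sum_sub_distrib,
    Finset.sum_add_distrib, Finset.sum_ite_eq, Finset.mem_univ, if_true]; abel

theorem h0_mY (B) (f : Ser d R) : h0 (mY B f) = mY B (h0 f) - mY B f := by
  simp only [h0_apply, dY_mY, da_mY, ma_mY, mY_mY _ B, map_sum, map_sub, map_add, map_ite_zero,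
    Finset.sum_sub_distrib, Finset.sum_add_distrib, Finset.sum_ite_eq', Finset.mem_univ, if_true]
  abel

theorem h0_ma (B) (f : Ser d R) : h0 (ma B f) = ma B (h0 f) + ma B f := by
  simp only [h0_apply, dY_ma, da_ma, ma_mY, ma_ma _ B, map_sum, map_sub, map_add, map_ite_zero,
    Finset.sum_sub_distrib, Finset.sum_add_distrib, Finset.sum_ite_eq', Finset.mem_univ, if_true]
  abel

variable [Algebra ℝ R]

theorem h0_Sdag (f : Ser d R) : h0 (Sdag f) = Sdag (h0 f) + (2 : ℝ) • Sdag f := by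
  simp only [Sdag_apply, map_sum, h0_dY, h0_ma, map_add, Finset.sum_add_distrib]; module

theorem h0_Yda (f : Ser d R) : h0 (Yda f) = Yda (h0 f) - (2 : ℝ) • Yda f := by
  simp only [Yda_apply, map_sum, h0_da, h0_mY, map_sub, Finset.sum_sub_distrib]; module

theorem comp_Sdag (m s) (f : Ser d R) : comp m (s + 1) (Sdag f) = Sdag (comp (m + 1) s f) := by
  simp only [Sdag_apply, map_sum, comp_ma, comp_dY]

theorem comp_Yda (m s) (f : Ser d R) : comp (m + 1) s (Yda f) = Yda (comp m (s + 1) f) := by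
  simp only [Yda_apply, map_sum, comp_mY, comp_da]

theorem coef_real_smul (c : ℝ) (α β) (f : Ser d R) :
    coef α β (c • f) = algebraMap ℝ R c * coef α β f := by
  rw [← algebraMap_smul R c f, coef_smul]

theorem bigradedSl2 : BigradedSl2 (Sdag (d := d) (R := R)) Yda h0 comp where
  ef := Sdag_Yda
  he := h0_Sdag
  hf := h0_Yda
  comp_e := comp_Sdag
  comp_e_zero m x := by simp only [Sdag_apply, map_sum, comp_ma_zero, Finset.sum_const_zero]
  comp_f := comp_Yda
  comp_f_zero m x := by simp only [Yda_apply, map_sum, comp_mY_zero, Finset.sum_const_zero]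
  comp_comp := comp_comp
  h_comp m s x := coef_ext fun α β => by
    rw [coef_h0, coef_real_smul, coef_comp]
    split_ifs with h
    · simp [h.1, h.2]
    · simp
  comp_h m s x := coef_ext fun α β => by
    rw [coef_h0, coef_comp, coef_comp, coef_h0]
    split_ifs <;> simp
  ext x hx := ext_of_comp fun m s => by rw [hx, map_zero]
  glue := exists_glue

/-- `c^A ∂/∂Y^A`. -/
def vdY (c : Fin (d + 1) → R) : Module.End R (Ser d R) := ∑ A, c A • dY A

/-- `c^A ∂/∂a^{†A}`. -/
def vda (c : Fin (d + 1) → R) : Module.End R (Ser d R) := ∑ A, c A • da A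

/-- The action of the matrix `w` on `Y` and `a†`. -/
def glAct (w : Fin (d + 1) → Fin (d + 1) → R) : Module.End R (Ser d R) :=
  ∑ A, ∑ C, w C A • (mY A * dY C + ma A * da C)

theorem vdY_apply (c) (f : Ser d R) : vdY c f = ∑ A, c A • dY A f := by simp [vdY]

theorem vda_apply (c) (f : Ser d R) : vda c f = ∑ A, c A • da A f := by simp [vda]

theorem glAct_apply (w) (f : Ser d R) : glAct w f =
    (∑ A, ∑ C, w C A • mY A (dY C f)) + ∑ A, ∑ C, w C A • ma A (da C f) := by
  simp [glAct, Finset.sum_add_distrib]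

theorem glAct_mY (w) (B) (f : Ser d R) :
    glAct w (mY B f) = mY B (glAct w f) + ∑ A, w B A • mY A f := by
  simp only [glAct_apply, dY_mY, da_mY, ma_mY, mY_mY _ B, map_sum, map_add, map_smul, map_ite_zero,
    smul_add, smul_ite, smul_zero, Finset.sum_add_distrib, Finset.sum_ite_eq', Finset.mem_univ,
    if_true]
  exact add_right_comm _ _ _

theorem glAct_ma (w) (B) (f : Ser d R) :
    glAct w (ma B f) = ma B (glAct w f) + ∑ A, w B A • ma A f := by
  simp only [glAct_apply, dY_ma, da_ma, ma_mY, ma_ma _ B, map_sum, map_add, map_smul, map_ite_zero,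
    smul_add, smul_ite, smul_zero, Finset.sum_add_distrib, Finset.sum_ite_eq', Finset.mem_univ,
    if_true]
  exact (add_assoc _ _ _).symm

theorem glAct_dY (w) (B) (f : Ser d R) :
    glAct w (dY B f) = dY B (glAct w f) - ∑ C, w C B • dY C f := by
  have h : ∀ A C, dY B (mY A (dY C f)) = mY A (dY C (dY B f)) + if B = A then dY C f else 0 :=
    fun A C => by rw [dY_mY, dY_dY]
  simp only [glAct_apply, h, dY_ma, da_dY, map_sum, map_add, map_smul, smul_add, smul_ite,
    smul_zero, Finset.sum_add_distrib]
  rw [Finset.sum_comm (f := fun A C => if B = A then w C A • dY C f else 0)]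
  simp only [Finset.sum_ite_eq, Finset.mem_univ, if_true]
  rw [add_right_comm, add_sub_cancel_right]

theorem glAct_da (w) (B) (f : Ser d R) :
    glAct w (da B f) = da B (glAct w f) - ∑ C, w C B • da C f := by
  have h : ∀ A C, da B (ma A (da C f)) = ma A (da C (da B f)) + if B = A then da C f else 0 :=
    fun A C => by rw [da_ma, da_da]
  simp only [glAct_apply, h, da_mY, da_dY, map_sum, map_add, map_smul, smul_add, smul_ite,
    smul_zero, Finset.sum_add_distrib]
  rw [Finset.sum_comm (f := fun A C => if B = A then w C A • da C f else 0)]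
  simp only [Finset.sum_ite_eq, Finset.mem_univ, if_true]
  rw [← add_assoc, add_sub_cancel_right]

theorem glAct_Sdag (w) (f : Ser d R) : glAct w (Sdag f) = Sdag (glAct w f) := by
  simp only [Sdag_apply, map_sum, glAct_ma, glAct_dY, map_sub, map_smul, Finset.sum_add_distrib,
    Finset.sum_sub_distrib]
  rw [Finset.sum_comm, sub_add_cancel]

theorem glAct_Yda (w) (f : Ser d R) : glAct w (Yda f) = Yda (glAct w f) := by
  simp only [Yda_apply, map_sum, glAct_mY, glAct_da, map_sub, map_smul, Finset.sum_add_distrib,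
    Finset.sum_sub_distrib]
  rw [Finset.sum_comm, sub_add_cancel]

/-- Inherited from S† and Y·∂/∂a†, whose commutator is `h0`. -/
theorem glAct_h0 (w) (f : Ser d R) : glAct w (h0 f) = h0 (glAct w f) := by
  rw [← sub_eq_iff_eq_add'.2 (Sdag_Yda f), map_sub, glAct_Sdag, glAct_Yda, glAct_Yda, glAct_Sdag,
    Sdag_Yda]; abel

theorem glAct_vdY (w c) (f : Ser d R) :
    glAct w (vdY c f) = vdY c (glAct w f) - vdY (fun C => ∑ D, w C D * c D) f := by
  simp only [vdY_apply, map_sum, map_smul, glAct_dY, smul_sub, Finset.sum_sub_distrib,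
    Finset.smul_sum, Finset.sum_smul, smul_smul]
  rw [Finset.sum_comm]; simp only [mul_comm]

theorem glAct_vda (w c) (f : Ser d R) :
    glAct w (vda c f) = vda c (glAct w f) - vda (fun C => ∑ D, w C D * c D) f := by
  simp only [vda_apply, map_sum, map_smul, glAct_da, smul_sub, Finset.sum_sub_distrib,
    Finset.smul_sum, Finset.sum_smul, smul_smul]
  rw [Finset.sum_comm]; simp only [mul_comm]

/-- The relabelling of indices common to the Y and the a† halves of `glAct_glAct`. -/
theorem sum_commutator_smul (w w' : Fin (d + 1) → Fin (d + 1) → R)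
    (P : Fin (d + 1) → Fin (d + 1) → Ser d R) :
    ∑ A, ∑ C, w' C A • (∑ B, w A B • P B C - ∑ D, w D C • P A D) =
      ∑ A, ∑ C, (∑ D, (w' C D * w D A - w C D * w' D A)) • P A C := by
  simp only [smul_sub, Finset.smul_sum, smul_smul, Finset.sum_smul, sub_smul,
    Finset.sum_sub_distrib]
  congr 1
  · calc ∑ A, ∑ C, ∑ B, (w' C A * w A B) • P B C
        = ∑ A, ∑ B, ∑ C, (w' C A * w A B) • P B C :=
          Finset.sum_congr rfl fun A _ => Finset.sum_comm
      _ = ∑ B, ∑ A, ∑ C, (w' C A * w A B) • P B C := Finset.sum_comm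
      _ = _ := Finset.sum_congr rfl fun B _ => Finset.sum_comm
  · refine Finset.sum_congr rfl fun A _ => ?_
    rw [Finset.sum_comm]
    simp only [mul_comm]

/-- Linear vector fields represent matrices with reversed bracket: the matrix on the right is w'w -
ww'. -/
theorem glAct_glAct (w w') (f : Ser d R) : glAct w (glAct w' f) = glAct w' (glAct w f) +
    glAct (fun C A => ∑ D, (w' C D * w D A - w C D * w' D A)) f := by
  have hY : ∀ A C, glAct w (mY A (dY C f)) = mY A (dY C (glAct w f)) +
      (∑ B, w A B • mY B (dY C f) - ∑ D, w D C • mY A (dY D f)) := fun A C => by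
    rw [glAct_mY, glAct_dY, map_sub, map_sum]; simp only [map_smul]; abel
  have ha : ∀ A C, glAct w (ma A (da C f)) = ma A (da C (glAct w f)) +
      (∑ B, w A B • ma B (da C f) - ∑ D, w D C • ma A (da D f)) := fun A C => by
    rw [glAct_ma, glAct_da, map_sub, map_sum]; simp only [map_smul]; abel
  rw [glAct_apply w' f, map_add, map_sum, map_sum]
  simp only [map_sum, map_smul, hY, ha]
  simp only [smul_add, Finset.sum_add_distrib, sum_commutator_smul]
  exact (add_add_add_comm _ _ _ _).trans
    (congrArg₂ (· + ·) (glAct_apply _ _).symm (glAct_apply _ _).symm)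

theorem Sdag_vdY (c) (f : Ser d R) : Sdag (vdY c f) = vdY c (Sdag f) := by
  simp only [vdY_apply, map_sum, map_smul, Sdag_dY]

theorem Sdag_vda (c) (f : Ser d R) : Sdag (vda c f) = vda c (Sdag f) - vdY c f := by
  simp only [vda_apply, vdY_apply, map_sum, map_smul, Sdag_da, smul_sub, Finset.sum_sub_distrib]

theorem Yda_vdY (c) (f : Ser d R) : Yda (vdY c f) = vdY c (Yda f) - vda c f := by
  simp only [vda_apply, vdY_apply, map_sum, map_smul, Yda_dY, smul_sub, Finset.sum_sub_distrib]

theorem Yda_vda (c) (f : Ser d R) : Yda (vda c f) = vda c (Yda f) := by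
  simp only [vda_apply, map_sum, map_smul, Yda_da]

theorem h0_vdY (c) (f : Ser d R) : h0 (vdY c f) = vdY c (h0 f) + vdY c f := by
  simp only [vdY_apply, map_sum, map_smul, h0_dY, smul_add, Finset.sum_add_distrib]

theorem vdY_vdY (c c') (f : Ser d R) : vdY c (vdY c' f) = vdY c' (vdY c f) := by
  simp only [vdY_apply, map_sum, map_smul, Finset.smul_sum]
  rw [Finset.sum_comm]
  exact Finset.sum_congr rfl fun A _ => Finset.sum_congr rfl fun B _ => by rw [dY_dY, smul_comm]

theorem vda_vdY (c c') (f : Ser d R) : vda c (vdY c' f) = vdY c' (vda c f) := by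
  simp only [vdY_apply, vda_apply, map_sum, map_smul, Finset.smul_sum]
  rw [Finset.sum_comm]
  exact Finset.sum_congr rfl fun A _ => Finset.sum_congr rfl fun B _ => by rw [da_dY, smul_comm]

theorem doublet (c : Fin (d + 1) → R) : Doublet (Sdag (d := d) (R := R)) Yda (vda c) (vdY c) where
  ev := Sdag_vda c
  ep := Sdag_vdY c
  fp := Yda_vdY c
  fv := Yda_vda c

theorem box_apply (f : Ser d R) : box f = ∑ A, algebraMap ℝ R (eta d A) • dY A (dY A f) := by
  simp [box]

theorem opS_apply (f : Ser d R) : opS f = ∑ A, algebraMap ℝ R (eta d A) • da A (dY A f) := by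
  simp [opS]

theorem opT_apply (f : Ser d R) : opT f = ∑ A, algebraMap ℝ R (eta d A) • da A (da A f) := by
  simp [opT]

theorem comp_box (m s) (f : Ser d R) : comp m s (box f) = box (comp (m + 2) s f) := by
  simp only [box_apply, map_sum, map_smul, comp_dY]

theorem comp_opS (m s) (f : Ser d R) : comp m s (opS f) = opS (comp (m + 1) (s + 1) f) := by
  simp only [opS_apply, map_sum, map_smul, comp_dY, comp_da]

theorem comp_opT (m s) (f : Ser d R) : comp m s (opT f) = opT (comp m (s + 2) f) := by
  simp only [opT_apply, map_sum, map_smul, comp_da]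

/-- Traceless power series. -/
def tracelessSer : Submodule R (Ser d R) := LinearMap.ker box ⊓ LinearMap.ker opS ⊓ LinearMap.ker opT

theorem mem_tracelessSer {f : Ser d R} : f ∈ tracelessSer ↔ box f = 0 ∧ opS f = 0 ∧ opT f = 0 := by
  simp [tracelessSer, and_assoc]

/-- The span of □, S and T is stable under commutators with S† and Y·∂/∂a†, and each of the three is
bihomogeneous. -/
theorem isGraded_tracelessSer : IsGraded (Sdag (d := d) (R := R)) Yda comp tracelessSer where
  e_mem x hx := by
    rw [mem_tracelessSer] at *
    have h1 : box (Sdag x) = Sdag (box x) := by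
      simp only [box_apply, map_sum, map_smul, Sdag_dY]
    have h2 : opS (Sdag x) = Sdag (opS x) + box x := by
      simp only [box_apply, opS_apply, map_sum, map_smul, Sdag_dY, Sdag_da, smul_sub,
        Finset.sum_sub_distrib, sub_add_cancel]
    have h3 : opT (Sdag x) = Sdag (opT x) + opS x + opS x := by
      simp only [opT_apply, opS_apply, map_sum, map_smul, Sdag_da, map_sub, smul_sub,
        Finset.sum_sub_distrib, da_dY]; abel
    simp [h1, h2, h3, hx]
  f_mem x hx := by
    rw [mem_tracelessSer] at *
    have h1 : box (Yda x) = Yda (box x) + opS x + opS x := by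
      simp only [box_apply, opS_apply, map_sum, map_smul, Yda_dY, map_sub, smul_sub,
        Finset.sum_sub_distrib, da_dY]; abel
    have h2 : opS (Yda x) = Yda (opS x) + opT x := by
      simp only [opT_apply, opS_apply, map_sum, map_smul, Yda_dY, Yda_da, map_sub, smul_sub,
        Finset.sum_sub_distrib, sub_add_cancel]
    have h3 : opT (Yda x) = Yda (opT x) := by
      simp only [opT_apply, map_sum, map_smul, Yda_da]
    simp [h1, h2, h3, hx]
  comp_mem x hx m s := by
    rw [mem_tracelessSer] at *
    obtain ⟨h1, h2, h3⟩ := hx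
    refine ⟨ext_of_comp fun m' s' => ?_, ext_of_comp fun m' s' => ?_, ext_of_comp fun m' s' => ?_⟩
    · rw [comp_box, comp_comp, map_zero]
      split_ifs <;> simp [← comp_box, h1]
    · rw [comp_opS, comp_comp, map_zero]
      split_ifs <;> simp [← comp_opS, h2]
    · rw [comp_opT, comp_comp, map_zero]
      split_ifs <;> simp [← comp_opT, h3]
  mem_of_comp x hx := by
    simp only [mem_tracelessSer] at *
    refine ⟨ext_of_comp fun m s => ?_, ext_of_comp fun m s => ?_, ext_of_comp fun m s => ?_⟩
    · rw [comp_box, (hx _ _).1, map_zero]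
    · rw [comp_opS, (hx _ _).2.1, map_zero]
    · rw [comp_opT, (hx _ _).2.2, map_zero]

end Operators

/-! ### Partial derivatives as commuting derivations of C^∞(U). -/

section SmoothDerivations

variable {d : ℕ} {U : TopologicalSpace.Opens (Fin d → ℝ)}

theorem two_le_infty : (2 : WithTop ℕ∞) ≤ ∞ := WithTop.coe_le_coe.2 le_top

theorem Smooth.contDiffAt (f : Smooth U) (x : U) : ContDiffAt ℝ ∞ (ext0 U f.1) x :=
  ContDiffOn.contDiffAt f.2 (U.isOpen.mem_nhds x.2)

theorem Smooth.differentiableAt (f : Smooth U) (x : U) : DifferentiableAt ℝ (ext0 U f.1) x :=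
  (f.contDiffAt x).differentiableAt (by simp)

theorem pd_mul (μ : Fin d) (f g : Smooth U) : pd μ (f * g) = f * pd μ g + pd μ f * g := by
  refine Subtype.ext (funext fun x => ?_)
  have hx : (U : Set (Fin d → ℝ)) ∈ nhds (x : Fin d → ℝ) := U.isOpen.mem_nhds x.2
  have e : ext0 U (f.1 * g.1) =ᶠ[nhds (x : Fin d → ℝ)] ext0 U f.1 * ext0 U g.1 :=
    Filter.eventuallyEq_of_mem hx (ext0_eqOn fun y => by simp [ext0_apply])
  change fderiv ℝ (ext0 U (f.1 * g.1)) x (Pi.single μ 1) =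
    f.1 x * fderiv ℝ (ext0 U g.1) x (Pi.single μ 1) +
      fderiv ℝ (ext0 U f.1) x (Pi.single μ 1) * g.1 x
  rw [e.fderiv_eq, fderiv_mul (f.differentiableAt x) (g.differentiableAt x)]
  simp [ext0_apply, mul_comm]

theorem pd_comm (μ ν : Fin d) (f : Smooth U) : pd μ (pd ν f) = pd ν (pd μ f) := by
  have key : ∀ (μ ν : Fin d) (x : U), (pd μ (pd ν f)).1 x =
      fderiv ℝ (fderiv ℝ (ext0 U f.1)) x (Pi.single μ 1) (Pi.single ν 1) := by
    intro μ ν x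
    have hx : (U : Set (Fin d → ℝ)) ∈ nhds (x : Fin d → ℝ) := U.isOpen.mem_nhds x.2
    have e : ext0 U (pd ν f).1 =ᶠ[nhds (x : Fin d → ℝ)]
        fun y => fderiv ℝ (ext0 U f.1) y (Pi.single ν 1) :=
      Filter.eventuallyEq_of_mem hx (ext0_eqOn fun y => rfl)
    change fderiv ℝ (ext0 U (pd ν f).1) x (Pi.single μ 1) = _
    have hd : DifferentiableAt ℝ (fderiv ℝ (ext0 U f.1)) x :=
      ((f.contDiffAt x).fderiv_right (m := 1)
        (by rw [one_add_one_eq_two]; exact two_le_infty)).differentiableAt (by simp)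
    rw [e.fderiv_eq, fderiv_clm_apply hd (differentiableAt_const _)]
    simp
  refine Subtype.ext (funext fun x => ?_)
  rw [key, key]
  exact ((f.contDiffAt x).isSymmSndFDerivAt (by simpa using two_le_infty)) _ _

end SmoothDerivations

/-! ### Operators acting on the coefficients. -/

section OnCoef

variable {d : ℕ} {R : Type} [CommRing R] [Algebra ℝ R] (T : R →ₗ[ℝ] R)

/-- Additivity suffices for the integer factors that ∂/∂Y and ∂/∂a† produce, although T is not
R-linear. -/
theorem linearMap_mul_natCast (c : R) (n : ℕ) : T (c * (n + 1)) = T c * (n + 1) := by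
  have : ∀ a : R, a * ((n : R) + 1) = (n + 1) • a := fun a => by
    rw [nsmul_eq_mul]; push_cast; ring
  rw [this, map_nsmul, this]

theorem onCoef_dY (A) (f : Ser d R) : onCoef T (dY A f) = dY A (onCoef T f) :=
  coef_ext fun α β => by simp only [coef_onCoef, coef_dY, linearMap_mul_natCast]

theorem onCoef_da (A) (f : Ser d R) : onCoef T (da A f) = da A (onCoef T f) :=
  coef_ext fun α β => by simp only [coef_onCoef, coef_da, linearMap_mul_natCast]

theorem onCoef_mY (A) (f : Ser d R) : onCoef T (mY A f) = mY A (onCoef T f) :=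
  coef_ext fun α β => by simp only [coef_onCoef, coef_mY]; split_ifs <;> simp

theorem onCoef_ma (A) (f : Ser d R) : onCoef T (ma A f) = ma A (onCoef T f) :=
  coef_ext fun α β => by simp only [coef_onCoef, coef_ma]; split_ifs <;> simp

theorem onCoef_Sdag (f : Ser d R) : onCoef T (Sdag f) = Sdag (onCoef T f) := by
  simp only [Sdag_apply, map_sum, onCoef_ma, onCoef_dY]

theorem onCoef_Yda (f : Ser d R) : onCoef T (Yda f) = Yda (onCoef T f) := by
  simp only [Yda_apply, map_sum, onCoef_mY, onCoef_da]

theorem onCoef_h0 (f : Ser d R) : onCoef T (h0 f) = h0 (onCoef T f) := by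
  simp only [h0_apply, map_sum, map_sub, onCoef_mY, onCoef_da, onCoef_ma, onCoef_dY]

theorem onCoef_algebraMap_smul (c : ℝ) (f : Ser d R) :
    onCoef T (algebraMap ℝ R c • f) = algebraMap ℝ R c • onCoef T f := by
  rw [algebraMap_smul, map_smul, algebraMap_smul]

theorem onCoef_box (f : Ser d R) : onCoef T (box f) = box (onCoef T f) := by
  simp only [box_apply, map_sum, onCoef_algebraMap_smul, onCoef_dY]

theorem onCoef_opS (f : Ser d R) : onCoef T (opS f) = opS (onCoef T f) := by
  simp only [opS_apply, map_sum, onCoef_algebraMap_smul, onCoef_dY, onCoef_da]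

theorem onCoef_opT (f : Ser d R) : onCoef T (opT f) = opT (onCoef T f) := by
  simp only [opT_apply, map_sum, onCoef_algebraMap_smul, onCoef_da]

variable {T} (hT : ∀ a b : R, T (a * b) = a * T b + T a * b)
include hT

theorem onCoef_smul (c : R) (f : Ser d R) :
    onCoef T (c • f) = c • onCoef T f + T c • f :=
  coef_ext fun α β => by simp only [coef_onCoef, coef_smul, hT, coef_add]

theorem onCoef_vdY (c : Fin (d + 1) → R) (f : Ser d R) :
    onCoef T (vdY c f) = vdY c (onCoef T f) + vdY (fun A => T (c A)) f := by
  simp only [vdY_apply, map_sum, onCoef_smul hT, onCoef_dY, Finset.sum_add_distrib]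

theorem onCoef_vda (c : Fin (d + 1) → R) (f : Ser d R) :
    onCoef T (vda c f) = vda c (onCoef T f) + vda (fun A => T (c A)) f := by
  simp only [vda_apply, map_sum, onCoef_smul hT, onCoef_da, Finset.sum_add_distrib]

theorem onCoef_glAct (w : Fin (d + 1) → Fin (d + 1) → R) (f : Ser d R) :
    onCoef T (glAct w f) = glAct w (onCoef T f) + glAct (fun C A => T (w C A)) f := by
  simp only [glAct_apply, map_add, map_sum, onCoef_smul hT, onCoef_mY, onCoef_ma, onCoef_da,
    onCoef_dY, Finset.sum_add_distrib]
  exact add_add_add_comm _ _ _ _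

end OnCoef

/-! ### Invariance of the traces under metric-compatible rotations and translations. -/

section Metric

variable {d : ℕ} {R : Type} [CommRing R] [Algebra ℝ R]

/-- An antisymmetric tensor contracted with a symmetric one: the sum equals its own negative. -/
theorem sum_antisymm_smul {w : Fin (d + 1) → Fin (d + 1) → R}
    (hw : ∀ A B, eta d A • w A B + eta d B • w B A = 0) (P : Fin (d + 1) → Fin (d + 1) → Ser d R)
    (hP : ∀ A B, P A B = P B A) :
    ∑ A, algebraMap ℝ R (eta d A) • ∑ C, w C A • P C A = 0 := by
  have h2 : ∀ x : Ser d R, x + x = 0 → x = 0 := fun x hx => by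
    rw [← two_smul ℝ] at hx
    exact (smul_eq_zero_iff_right two_ne_zero).1 hx
  have hη : ∀ A, eta d A * eta d A = 1 := fun A => by unfold eta; split_ifs <;> norm_num
  have hw' : ∀ A C, algebraMap ℝ R (eta d A) * w C A + algebraMap ℝ R (eta d C) * w A C = 0 := by
    intro A C
    -- Multiplying by both diagonal entries of η, each of square one, turns antisymmetry with
    -- lowered indices into antisymmetry with raised ones.
    have h1 := congrArg (fun x => (eta d A * eta d C) • x) (hw A C)
    simp only [smul_add, smul_smul, smul_zero] at h1
    rw [mul_right_comm, hη, one_mul, mul_assoc, hη, mul_one, Algebra.smul_def, Algebra.smul_def,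
      add_comm] at h1
    exact h1
  refine h2 _ ?_
  simp only [Finset.smul_sum, smul_smul]
  nth_rewrite 2 [Finset.sum_comm]
  rw [← Finset.sum_add_distrib]
  refine Finset.sum_eq_zero fun A _ => ?_
  rw [← Finset.sum_add_distrib]
  refine Finset.sum_eq_zero fun C _ => ?_
  rw [hP A C, ← add_smul, hw', zero_smul]

theorem glAct_box {w : Fin (d + 1) → Fin (d + 1) → R}
    (hw : ∀ A B, eta d A • w A B + eta d B • w B A = 0) (f : Ser d R) :
    glAct w (box f) = box (glAct w f) := by
  simp only [box_apply, map_sum, map_smul, glAct_dY, map_sub, smul_sub, Finset.sum_sub_distrib]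
  rw [sum_antisymm_smul hw (fun C A => dY A (dY C f)) (fun A B => dY_dY _ _ _),
    sum_antisymm_smul hw (fun C A => dY C (dY A f)) (fun A B => dY_dY _ _ _), sub_zero, sub_zero]

theorem glAct_opT {w : Fin (d + 1) → Fin (d + 1) → R}
    (hw : ∀ A B, eta d A • w A B + eta d B • w B A = 0) (f : Ser d R) :
    glAct w (opT f) = opT (glAct w f) := by
  simp only [opT_apply, map_sum, map_smul, glAct_da, map_sub, smul_sub, Finset.sum_sub_distrib]
  rw [sum_antisymm_smul hw (fun C A => da A (da C f)) (fun A B => da_da _ _ _),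
    sum_antisymm_smul hw (fun C A => da C (da A f)) (fun A B => da_da _ _ _), sub_zero, sub_zero]

/-- Reduced to `glAct_opT` by writing `opS` as half the commutator of `opT` with S†. -/
theorem glAct_opS {w : Fin (d + 1) → Fin (d + 1) → R}
    (hw : ∀ A B, eta d A • w A B + eta d B • w B A = 0) (f : Ser d R) :
    glAct w (opS f) = opS (glAct w f) := by
  have : ∀ f : Ser d R, opT (Sdag f) = Sdag (opT f) + (2 : ℝ) • opS f := by
    intro x
    simp only [opT_apply, opS_apply, map_sum, map_smul, Sdag_da, map_sub, smul_sub,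
        Finset.sum_sub_distrib, da_dY]; module
  have h2 : ∀ f : Ser d R, opS f = (2 : ℝ)⁻¹ • (opT (Sdag f) - Sdag (opT f)) := fun f => by
    rw [this]; module
  rw [h2, h2, LinearMap.map_smul_of_tower, map_sub, glAct_opT hw, glAct_Sdag, glAct_Sdag,
    glAct_opT hw]

theorem vdY_box (c) (f : Ser d R) : vdY c (box f) = box (vdY c f) := by
  simp only [box_apply, vdY_apply, map_sum, map_smul, Finset.smul_sum]
  rw [Finset.sum_comm]
  exact Finset.sum_congr rfl fun A _ => Finset.sum_congr rfl fun B _ => by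
    rw [dY_dY A B, dY_dY A B f, smul_comm]

theorem vdY_opS (c) (f : Ser d R) : vdY c (opS f) = opS (vdY c f) := by
  simp only [opS_apply, vdY_apply, map_sum, map_smul, Finset.smul_sum]
  rw [Finset.sum_comm]
  exact Finset.sum_congr rfl fun A _ => Finset.sum_congr rfl fun B _ => by
    rw [← da_dY, dY_dY A B f, smul_comm]

theorem vdY_opT (c) (f : Ser d R) : vdY c (opT f) = opT (vdY c f) := by
  simp only [opT_apply, vdY_apply, map_sum, map_smul, Finset.smul_sum]
  rw [Finset.sum_comm]
  exact Finset.sum_congr rfl fun A _ => Finset.sum_congr rfl fun B _ => by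
    rw [← da_dY, ← da_dY, smul_comm]

end Metric

/-! ### The flat covariant derivatives and their commutators with the constraints. -/

namespace Background

variable {d : ℕ} {l : ℝ} {U : TopologicalSpace.Opens (Fin d → ℝ)} (B : Background d l U)

/-- The covariant derivative `∂_μ - ω_μ - e_μ^A ∂/∂Y^A`, so that `∇ + σ` is its exterior
version. -/
def cov (μ : Fin d) : Ser d (Smooth U) →ₗ[ℝ] Ser d (Smooth U) :=
  onCoef (pd μ) - (glAct (B.w μ) + vdY (B.e μ)).restrictScalars ℝ

theorem cov_apply (μ) (f : Ser d (Smooth U)) :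
    B.cov μ f = onCoef (pd μ) f - (glAct (B.w μ) f + vdY (B.e μ) f) := rfl

theorem pd_V (μ) : (fun A => pd μ (B.V A)) = fun A => B.e μ A - ∑ C, B.w μ A C * B.V C :=
  funext fun A => by rw [← B.vielbein μ A, add_sub_cancel_right]

theorem vdY_sub (c c' : Fin (d + 1) → Smooth U) (f : Ser d (Smooth U)) :
    vdY (fun A => c A - c' A) f = vdY c f - vdY c' f := by
  simp only [vdY_apply, sub_smul, Finset.sum_sub_distrib]

theorem vda_sub (c c' : Fin (d + 1) → Smooth U) (f : Ser d (Smooth U)) :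
    vda (fun A => c A - c' A) f = vda c f - vda c' f := by
  simp only [vda_apply, sub_smul, Finset.sum_sub_distrib]

theorem cov_Sdag (μ) (f : Ser d (Smooth U)) : B.cov μ (Sdag f) = Sdag (B.cov μ f) := by
  simp only [cov_apply, onCoef_Sdag, glAct_Sdag, map_sub, map_add, Sdag_vdY]

theorem cov_Yda (μ) (f : Ser d (Smooth U)) :
    B.cov μ (Yda f) = Yda (B.cov μ f) - vda (B.e μ) f := by
  simp only [cov_apply, onCoef_Yda, glAct_Yda, map_sub, map_add, Yda_vdY]; abel

/-- By dV + ωV = e the extra term is opposite to that of `cov_Yda`, so S̄† commutes with `cov μ`. In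
the same way `cov_h0` and `cov_vdY` combine for h. -/
theorem cov_vda (μ) (f : Ser d (Smooth U)) :
    B.cov μ (vda B.V f) = vda B.V (B.cov μ f) + vda (B.e μ) f := by
  simp only [cov_apply, onCoef_vda (pd_mul μ), glAct_vda, map_sub, map_add, vda_vdY, pd_V, vda_sub]
  abel

theorem cov_h0 (μ) (f : Ser d (Smooth U)) :
    B.cov μ (h0 f) = h0 (B.cov μ f) + vdY (B.e μ) f := by
  simp only [cov_apply, onCoef_h0, glAct_h0, map_sub, map_add, h0_vdY]; abel

theorem cov_vdY (μ) (f : Ser d (Smooth U)) :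
    B.cov μ (vdY B.V f) = vdY B.V (B.cov μ f) + vdY (B.e μ) f := by
  simp only [cov_apply, onCoef_vdY (pd_mul μ), glAct_vdY, map_sub, map_add, vdY_vdY _ B.V, pd_V,
    vdY_sub]
  abel

theorem cov_mem_tracelessSer (μ) {f : Ser d (Smooth U)} (hf : f ∈ tracelessSer) :
    B.cov μ f ∈ tracelessSer := by
  rw [mem_tracelessSer] at *
  obtain ⟨h1, h2, h3⟩ := hf
  refine ⟨?_, ?_, ?_⟩
  · rw [cov_apply, map_sub, map_add, ← onCoef_box, ← glAct_box (B.metric μ), ← vdY_box, h1]; simp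
  · rw [cov_apply, map_sub, map_add, ← onCoef_opS, ← glAct_opS (B.metric μ), ← vdY_opS, h2]; simp
  · rw [cov_apply, map_sub, map_add, ← onCoef_opT, ← glAct_opT (B.metric μ), ← vdY_opT, h3]; simp

theorem onCoef_pd_comm (μ ν) (f : Ser d (Smooth U)) :
    onCoef (pd μ) (onCoef (pd ν) f) = onCoef (pd ν) (onCoef (pd μ) f) :=
  coef_ext fun α β => by simp only [coef_onCoef, pd_comm]

/-- The commutator consists of a linear vector field with coefficient the curvature and a constant
one with coefficient the torsion; `flat` and `torsion` say that both vanish. -/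
theorem cov_comm (μ ν) (f : Ser d (Smooth U)) : B.cov μ (B.cov ν f) = B.cov ν (B.cov μ f) := by
  have hw : glAct (fun C A => pd μ (B.w ν C A)) f - glAct (fun C A => pd ν (B.w μ C A)) f =
      glAct (fun C A => ∑ D, (B.w ν C D * B.w μ D A - B.w μ C D * B.w ν D A)) f := by
    have : ∀ C A, ∑ D, (B.w ν C D * B.w μ D A - B.w μ C D * B.w ν D A) =
        pd μ (B.w ν C A) - pd ν (B.w μ C A) := fun C A => by
      rw [← sub_eq_zero, ← neg_eq_zero, ← B.flat μ ν C A]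
      simp only [Finset.sum_sub_distrib]; ring
    simp only [this, glAct_apply, sub_smul, Finset.sum_sub_distrib]
    exact add_sub_add_comm _ _ _ _
  have he : vdY (fun A => pd μ (B.e ν A)) f - vdY (fun A => pd ν (B.e μ A)) f =
      vdY (fun C => ∑ D, B.w ν C D * B.e μ D) f - vdY (fun C => ∑ D, B.w μ C D * B.e ν D) f := by
    rw [← vdY_sub, ← vdY_sub]
    congr 2
    funext A
    rw [← sub_eq_zero, ← B.torsion μ ν A]
    simp only [Finset.sum_sub_distrib]; ring
  simp only [cov_apply, map_sub, map_add, onCoef_glAct (pd_mul _), onCoef_vdY (pd_mul _),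
    glAct_vdY]
  rw [onCoef_pd_comm, glAct_glAct (B.w μ) (B.w ν), vdY_vdY (B.e μ) (B.e ν), ← hw]
  rw [← sub_eq_zero] at he ⊢
  rw [← neg_eq_zero, ← he]
  abel

end Background

/-! ### Finite order of reduced operators. -/

section DiffOp

variable {R : Type*} [CommRing R] [Algebra ℝ R]
variable {M : Type*} [AddCommGroup M] [Module ℝ M] [Module R M] [IsScalarTower ℝ R M]

theorem IsDiffOp.sub {k : ℕ} : ∀ {S T : M →ₗ[ℝ] M}, IsDiffOp R k S → IsDiffOp R k T →
    IsDiffOp R k (S - T) := by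
  induction k with
  | zero => intro S T hS hT f m; simp [hS f m, hT f m, smul_sub]
  | succ k ih =>
    intro S T hS hT f
    have := ih (hS f) (hT f)
    convert this using 1
    ext m; simp [smul_sub]; abel

theorem Reduction.op_finite_order {gh : ℤ → Submodule R M} {Ω : M →ₗ[ℝ] M} (r : Reduction R gh Ω)
    (hΩ : ∃ k, IsDiffOp R k Ω) : ∃ k, IsDiffOp R k r.op := by
  obtain ⟨k, hk⟩ := hΩ
  obtain ⟨j, hj⟩ := r.inv_finite_order
  have hE := IsDiffOp.of_linear r.prE
  have hF := IsDiffOp.of_linear r.prF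
  have hG := IsDiffOp.of_linear r.prG
  have h1 := hE.comp (hk.comp hE)
  have h2 := hE.comp (hk.comp (hF.comp (hj.comp (hG.comp (hk.comp hE)))))
  exact ⟨_, (h1.mono (le_max_left _ _)).sub (h2.mono (le_max_right _ _))⟩

end DiffOp

/-! ### Exterior extension θ^μ K_μ of operators to forms. -/

section Forms

variable {d : ℕ} {R : Type} [CommRing R]

theorem thetaForm_apply (μ : Fin d) (F : Form d R) (I : Finset (Fin d)) :
    thetaForm μ F I =
      if μ ∈ I then (-1 : R) ^ (I.filter (· < μ)).card • F (I.erase μ) else 0 := by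
  simp only [thetaForm, LinearMap.pi_apply]
  split_ifs <;> simp

theorem thetaForm_anticomm_of_lt {μ ν : Fin d} (h : μ < ν) (F : Form d R) :
    thetaForm μ (thetaForm ν F) = -thetaForm ν (thetaForm μ F) := by
  funext I
  simp only [Pi.neg_apply, thetaForm_apply, Finset.mem_erase, h.ne, h.ne', ne_eq, not_false_eq_true,
    true_and]
  by_cases hμ : μ ∈ I
  · by_cases hν : ν ∈ I
    · have h1 : ((I.erase μ).filter (· < ν)).card + 1 = (I.filter (· < ν)).card := by
        rw [← Finset.card_erase_add_one (s := I.filter (· < ν)) (a := μ) (by simp [hμ, h]),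
          Finset.filter_erase]
      have h2 : (I.erase ν).filter (· < μ) = I.filter (· < μ) := by
        rw [Finset.filter_erase, Finset.erase_eq_of_notMem (by simp [h.le])]
      simp only [hμ, hν, if_true, h2, ← h1, smul_smul, pow_succ, Finset.erase_right_comm (a := μ)]
      rw [← neg_smul]; ring_nf
    · simp [hν]
  · simp [hμ]

theorem thetaForm_anticomm (μ ν : Fin d) (F : Form d R) :
    thetaForm μ (thetaForm ν F) = -thetaForm ν (thetaForm μ F) := by
  rcases lt_trichotomy μ ν with h | rfl | h
  · exact thetaForm_anticomm_of_lt h F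
  · have : thetaForm μ (thetaForm μ F) = 0 := by
      funext I
      simp [thetaForm_apply]
    rw [this, neg_zero]
  · rw [thetaForm_anticomm_of_lt h F, neg_neg]

variable [Algebra ℝ R]

/-- The operator `θ^μ K_μ` on forms. -/
def extd (K : Fin d → Ser d R →ₗ[ℝ] Ser d R) : Form d R →ₗ[ℝ] Form d R :=
  ∑ μ, (thetaForm μ).restrictScalars ℝ ∘ₗ (K μ).compLeft _

theorem extd_apply (K : Fin d → Ser d R →ₗ[ℝ] Ser d R) (F : Form d R) :
    extd K F = ∑ μ, thetaForm μ fun I => K μ (F I) := by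
  simp only [extd, LinearMap.sum_apply]; rfl

theorem extd_apply_apply (K : Fin d → Ser d R →ₗ[ℝ] Ser d R) (F : Form d R) (I) :
    extd K F I =
      ∑ μ ∈ I, (-1 : R) ^ (I.filter (· < μ)).card • K μ (F (I.erase μ)) := by
  rw [extd_apply, Finset.sum_apply]
  simp only [thetaForm_apply]
  rw [Finset.sum_ite_mem, Finset.univ_inter]

theorem extd_mem {K : Fin d → Ser d R →ₗ[ℝ] Ser d R} {N N' : Submodule R (Ser d R)}
    (h : ∀ μ, ∀ x ∈ N, K μ x ∈ N') {F : Form d R} (hF : ∀ I, F I ∈ N) (I) : extd K F I ∈ N' := by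
  rw [extd_apply_apply]
  exact N'.sum_mem fun μ _ => N'.smul_mem _ (h μ _ (hF _))

theorem exists_of_extd_ne_zero {K : Fin d → Ser d R →ₗ[ℝ] Ser d R} {F : Form d R} {I}
    (h : extd K F I ≠ 0) : ∃ J, F J ≠ 0 ∧ J.card + 1 = I.card := by
  rw [extd_apply_apply] at h
  obtain ⟨μ, hμ, h1⟩ := Finset.exists_ne_zero_of_sum_ne_zero h
  exact ⟨I.erase μ, fun h0 => h1 (by rw [h0, map_zero, smul_zero]), Finset.card_erase_add_one hμ⟩

theorem map_neg_one_pow_smul (T : Ser d R →ₗ[ℝ] Ser d R) (k : ℕ) (x : Ser d R) :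
    T ((-1 : R) ^ k • x) = (-1 : R) ^ k • T x := by
  rcases neg_one_pow_eq_or R k with h | h <;> simp [h]

/-- `[T, θ^μ K_μ] = θ^μ L_μ` if `[T, K_μ] = L_μ`. -/
theorem map_extd_add {T : Module.End R (Ser d R)} {K L : Fin d → Ser d R →ₗ[ℝ] Ser d R}
    (h : ∀ μ x, T (K μ x) = K μ (T x) + L μ x) (F : Form d R) (I) :
    T (extd K F I) = extd K (fun J => T (F J)) I + extd L F I := by
  simp only [extd_apply_apply, map_sum, map_smul, h, smul_add, Finset.sum_add_distrib]

theorem map_extd_of_comm {T : Module.End R (Ser d R)} {K : Fin d → Ser d R →ₗ[ℝ] Ser d R}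
    (h : ∀ μ x, T (K μ x) = K μ (T x)) (F : Form d R) (I) :
    T (extd K F I) = extd K (fun J => T (F J)) I := by
  simp only [extd_apply_apply, map_sum, map_smul, h]

theorem extd_extd (K L : Fin d → Ser d R →ₗ[ℝ] Ser d R) (F : Form d R) :
    extd K (extd L F) = ∑ μ, ∑ ν, thetaForm μ (thetaForm ν fun I => K μ (L ν (F I))) := by
  rw [extd_apply]
  refine Finset.sum_congr rfl fun μ _ => ?_
  rw [← map_sum]
  congr 1
  funext I
  simp only [extd_apply, Finset.sum_apply, map_sum]
  refine Finset.sum_congr rfl fun ν _ => ?_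
  simp only [thetaForm_apply]
  split_ifs
  · rw [map_neg_one_pow_smul]
  · simp

/-- Symmetric K_μ K_ν against anticommuting θ^μ θ^ν. -/
theorem extd_extd_eq_zero {K : Fin d → Ser d R →ₗ[ℝ] Ser d R}
    (h : ∀ μ ν x, K μ (K ν x) = K ν (K μ x)) (F : Form d R) : extd K (extd K F) = 0 := by
  have h1 : extd K (extd K F) = -extd K (extd K F) := by
    conv_lhs => rw [extd_extd, Finset.sum_comm]
    rw [extd_extd, ← Finset.sum_neg_distrib]
    refine Finset.sum_congr rfl fun μ _ => ?_
    rw [← Finset.sum_neg_distrib]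
    refine Finset.sum_congr rfl fun ν _ => ?_
    rw [thetaForm_anticomm]
    simp only [h ν μ]
  have h2 : (2 : ℝ) • extd K (extd K F) = 0 := by
    rw [two_smul]; nth_rewrite 1 [h1]; exact neg_add_cancel _
  exact (smul_eq_zero_iff_right two_ne_zero).1 h2

theorem lift_apply {S : Type} [Semiring S] [Module S (Ser d R)] (T : Ser d R →ₗ[S] Ser d R)
    (Φ : State d R) : lift T Φ = (fun I => T (Φ.1 I), fun I => T (Φ.2 I)) := rfl

theorem theta_apply (μ : Fin d) (Φ : State d R) :
    theta μ Φ = (thetaForm μ Φ.1, -thetaForm μ Φ.2) := rfl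

theorem db_apply (Φ : State d R) : db Φ = (Φ.2, 0) := rfl

theorem mb_apply (Φ : State d R) : mb Φ = (0, Φ.1) := rfl

theorem Sdb_apply (Φ : State d R) : Sdb Φ = (fun I => Sdag (Φ.2 I), 0) := by
  refine Prod.ext rfl (funext fun I => ?_)
  exact map_zero (Sdag (d := d) (R := R))

theorem mem_ker_lift {T : Module.End R (Ser d R)} {Φ : State d R} :
    Φ ∈ LinearMap.ker (lift T) ↔ (∀ I, T (Φ.1 I) = 0) ∧ ∀ I, T (Φ.2 I) = 0 := by
  rw [LinearMap.mem_ker, lift_apply, Prod.ext_iff, funext_iff, funext_iff]; rfl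

theorem mem_traceless {Φ : State d R} :
    Φ ∈ traceless ↔ (∀ I, Φ.1 I ∈ tracelessSer) ∧ ∀ I, Φ.2 I ∈ tracelessSer := by
  simp only [traceless, Submodule.mem_inf, mem_ker_lift, mem_tracelessSer, forall_and]
  exact ⟨fun ⟨⟨⟨a, b⟩, c, d⟩, e, f⟩ => ⟨⟨a, c, e⟩, b, d, f⟩,
    fun ⟨⟨a, c, e⟩, b, d, f⟩ => ⟨⟨⟨a, b⟩, c, d⟩, e, f⟩⟩

end Forms

/-! ### Coefficientwise description of Γ(Ê) and of the operators on it. -/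

namespace Background

variable {d : ℕ} {l : ℝ} {U : TopologicalSpace.Opens (Fin d → ℝ)} (B : Background d l U)

theorem Vda_eq : B.Vda = vda B.V := rfl

theorem h_eq : B.h = h0 - vdY B.V := by
  simp only [Background.h, h0, vdY, Finset.sum_sub_distrib]

/-- Traceless power series annihilated by `S̄†` and by `h - c`. -/
def W (c : ℝ) : Submodule (Smooth U) (Ser d (Smooth U)) :=
  tracelessSer ⊓ LinearMap.ker (Yda + vda B.V) ⊓
    LinearMap.ker (h0 - vdY B.V - algebraMap ℝ (Smooth U) c • LinearMap.id)

theorem mem_W {c : ℝ} {f : Ser d (Smooth U)} : f ∈ B.W c ↔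
    f ∈ tracelessSer ∧ Yda f + vda B.V f = 0 ∧ h0 f - vdY B.V f = c • f := by
  simp [W, and_assoc, sub_eq_zero]

/-- The term 2 b† ∂/∂b† cancels the shift by -2 on multiples of b†, hence the weights 2 and 0. -/
theorem mem_hatE {Φ : State d (Smooth U)} :
    Φ ∈ B.hatE ↔ (∀ I, Φ.1 I ∈ B.W 2) ∧ ∀ I, Φ.2 I ∈ B.W 0 := by
  have h1 : (lift B.h - 2 + 2 * (mb * db) : Module.End (Smooth U) (State d (Smooth U))) Φ =
      (fun I => h0 (Φ.1 I) - vdY B.V (Φ.1 I) - (2 : ℝ) • Φ.1 I,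
        fun I => h0 (Φ.2 I) - vdY B.V (Φ.2 I)) := by
    rw [h_eq]
    change lift (h0 - vdY B.V) Φ - (2 : Module.End (Smooth U) _) Φ +
      (2 : Module.End (Smooth U) _) (mb (db Φ)) = _
    rw [Module.End.ofNat_apply, Module.End.ofNat_apply, lift_apply, db_apply, mb_apply]
    refine Prod.ext (funext fun I => ?_) (funext fun I => ?_)
    · change h0 (Φ.1 I) - vdY B.V (Φ.1 I) - (2 : ℕ) • Φ.1 I + (2 : ℕ) • 0 = _
      rw [smul_zero, add_zero, two_nsmul]
      exact congrArg _ (two_smul ℝ _).symm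
    · change h0 (Φ.2 I) - vdY B.V (Φ.2 I) - (2 : ℕ) • Φ.2 I + (2 : ℕ) • Φ.2 I = _
      rw [sub_add_cancel]
  have h2 : Φ ∈ LinearMap.ker (lift B.h - 2 + 2 * (mb * db) :
      Module.End (Smooth U) (State d (Smooth U))) ↔
      (∀ I, h0 (Φ.1 I) - vdY B.V (Φ.1 I) = (2 : ℝ) • Φ.1 I) ∧
        ∀ I, h0 (Φ.2 I) - vdY B.V (Φ.2 I) = (0 : ℝ) • Φ.2 I := by
    rw [LinearMap.mem_ker, h1, Prod.ext_iff, funext_iff, funext_iff]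
    simp only [zero_smul]
    exact and_congr (forall_congr' fun I => sub_eq_zero) Iff.rfl
  have h3 : Φ ∈ LinearMap.ker (lift B.Sbar) ↔
      (∀ I, Yda (Φ.1 I) + vda B.V (Φ.1 I) = 0) ∧ ∀ I, Yda (Φ.2 I) + vda B.V (Φ.2 I) = 0 :=
    mem_ker_lift
  simp only [hatE, Submodule.mem_inf, mem_traceless, h2, h3, mem_W, forall_and]
  exact ⟨fun ⟨⟨⟨a, b⟩, c, d⟩, e, f⟩ => ⟨⟨a, e, c⟩, b, f, d⟩,
    fun ⟨⟨a, e, c⟩, b, f, d⟩ => ⟨⟨⟨a, b⟩, c, d⟩, e, f⟩⟩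

theorem cov_mem_W {c : ℝ} (μ) {f : Ser d (Smooth U)} (hf : f ∈ B.W c) : B.cov μ f ∈ B.W c := by
  rw [mem_W] at *
  obtain ⟨h1, h2, h3⟩ := hf
  refine ⟨B.cov_mem_tracelessSer μ h1, ?_, ?_⟩
  · have h4 := congrArg (B.cov μ) h2
    rw [map_add, cov_Yda, cov_vda, map_zero] at h4
    rw [← h4]; abel
  · have h4 := congrArg (B.cov μ) h3
    rw [map_sub, cov_h0, cov_vdY, map_smul] at h4
    rw [← h4]; abel

/-- `∇ + σ` on forms. -/
def formD : Form d (Smooth U) →ₗ[ℝ] Form d (Smooth U) := extd B.cov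

/-- `-σ` on forms. -/
def formSigma : Form d (Smooth U) →ₗ[ℝ] Form d (Smooth U) :=
  extd fun μ => (vdY (B.e μ)).restrictScalars ℝ

/-- `-σ̄` on forms. -/
def formSigmaBar : Form d (Smooth U) →ₗ[ℝ] Form d (Smooth U) :=
  extd fun μ => (vda (B.e μ)).restrictScalars ℝ

theorem sum_theta_lift_apply (K : Fin d → Ser d (Smooth U) →ₗ[ℝ] Ser d (Smooth U))
    (Φ : State d (Smooth U)) : ∑ μ, theta μ (lift (K μ) Φ) = (extd K Φ.1, -extd K Φ.2) := by
  simp only [extd_apply, lift_apply, theta_apply]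
  refine Prod.ext ?_ ?_
  · rw [Prod.fst_sum]
  · rw [Prod.snd_sum, ← Finset.sum_neg_distrib]

theorem sigma_apply (Φ : State d (Smooth U)) :
    B.sigma Φ = (-B.formSigma Φ.1, B.formSigma Φ.2) := by
  have h := sum_theta_lift_apply (fun μ => (vdY (B.e μ)).restrictScalars ℝ) Φ
  have h1 : B.sigma Φ = -∑ μ, theta μ (lift ((vdY (B.e μ)).restrictScalars ℝ) Φ) := by
    simp only [sigma, LinearMap.neg_apply, LinearMap.sum_apply]; rfl
  rw [h1, h, Prod.neg_mk, neg_neg]; rfl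

theorem sigmaBar_apply (Φ : State d (Smooth U)) :
    B.sigmaBar Φ = (-B.formSigmaBar Φ.1, B.formSigmaBar Φ.2) := by
  have h := sum_theta_lift_apply (fun μ => (vda (B.e μ)).restrictScalars ℝ) Φ
  have h1 : B.sigmaBar Φ = -∑ μ, theta μ (lift ((vda (B.e μ)).restrictScalars ℝ) Φ) := by
    simp only [sigmaBar, LinearMap.neg_apply, LinearMap.sum_apply]; rfl
  rw [h1, h, Prod.neg_mk, neg_neg]; rfl

theorem D_apply (Φ : State d (Smooth U)) : B.D Φ = (B.formD Φ.1, -B.formD Φ.2) := by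
  have h := sum_theta_lift_apply B.cov Φ
  have h1 : B.D Φ = ∑ μ, theta μ (lift (B.cov μ) Φ) := by
    simp only [D, nabla, sigma, LinearMap.add_apply, LinearMap.sum_apply,
      LinearMap.coe_restrictScalars, LinearMap.neg_apply, ← sub_eq_add_neg,
      ← Finset.sum_sub_distrib]
    refine Finset.sum_congr rfl fun μ _ => ?_
    refine (map_sub (theta μ) _ _).symm.trans (congrArg _ ?_)
    refine Prod.ext (funext fun I => ?_) (funext fun I => ?_)
    · exact sub_sub _ _ _
    · exact sub_sub _ _ _
  rw [h1, h]; rfl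

theorem hatOmega_apply (Φ : State d (Smooth U)) :
    B.hatOmega Φ = ((B.formD Φ.1 + fun I => Sdag (Φ.2 I)), -B.formD Φ.2) := by
  change B.D Φ + Sdb Φ = _
  rw [D_apply, Sdb_apply, Prod.mk_add_mk, add_zero]

theorem gluing_apply (Φ : State d (Smooth U)) :
    B.gluing Φ = (0, B.formSigma (B.formSigmaBar fun I => rect (Φ.1 I))) := by
  change mb (B.sigma (B.sigmaBar (PR Φ))) = _
  rw [sigmaBar_apply, sigma_apply, mb_apply, map_neg, neg_neg]; rfl

theorem formD_formD (F : Form d (Smooth U)) : B.formD (B.formD F) = 0 :=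
  extd_extd_eq_zero B.cov_comm F

theorem formD_mem_W {c : ℝ} {F : Form d (Smooth U)} (hF : ∀ I, F I ∈ B.W c) (I) :
    B.formD F I ∈ B.W c := extd_mem (fun μ _ hx => B.cov_mem_W μ hx) hF I

theorem Sdag_formD (F : Form d (Smooth U)) (I) :
    Sdag (B.formD F I) = B.formD (fun J => Sdag (F J)) I :=
  map_extd_of_comm (fun μ x => (B.cov_Sdag μ x).symm) F I

theorem Yda_formD (F : Form d (Smooth U)) (I) :
    Yda (B.formD F I) = B.formD (fun J => Yda (F J)) I + B.formSigmaBar F I :=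
  map_extd_add (fun μ x => by
    rw [B.cov_Yda μ x, LinearMap.coe_restrictScalars, sub_add_cancel]) F I

theorem cov_smul (μ) (c : Smooth U) (f : Ser d (Smooth U)) :
    B.cov μ (c • f) = c • B.cov μ f + pd μ c • f := by
  simp only [cov_apply, onCoef_smul (pd_mul μ), map_smul, smul_sub, smul_add]; abel

theorem formD_smul (c : Smooth U) (F : Form d (Smooth U)) :
    B.formD (c • F) = c • B.formD F + ∑ μ, pd μ c • thetaForm μ F := by
  simp only [formD, extd_apply, Pi.smul_apply, cov_smul, Finset.smul_sum, ← map_smul,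
    ← Finset.sum_add_distrib, ← map_add]
  rfl

end Background

/-! ### The sl₂ projectors on power series and the rectangular component. -/

section Projectors

variable {d : ℕ} {R : Type} [CommRing R] [Algebra ℝ R]

/-- The projector onto `ker (Y · ∂/∂a†)` along the image of `S†`. -/
def projY : Module.End R (Ser d R) := (bigradedSl2 (d := d) (R := R)).projF

/-- The projector onto `ker S†` along the image of `Y · ∂/∂a†`. -/
def projS : Module.End R (Ser d R) := (bigradedSl2 (d := d) (R := R)).projE

/-- The inverse of `S†` on its image, with values in the image of `Y · ∂/∂a†`. -/
def invS : Module.End R (Ser d R) := (bigradedSl2 (d := d) (R := R)).invE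

theorem projY_of_Yda {f : Ser d R} (hf : Yda f = 0) : projY f = f := bigradedSl2.projF_of_f hf

theorem projY_Sdag (f : Ser d R) : projY (Sdag f) = 0 := bigradedSl2.projF_e f

theorem Yda_projY (f : Ser d R) : Yda (projY f) = 0 := bigradedSl2.f_projF f

theorem projY_projY (f : Ser d R) : projY (projY f) = projY f := bigradedSl2.projF_projF f

theorem projS_of_Sdag {f : Ser d R} (hf : Sdag f = 0) : projS f = f := bigradedSl2.projE_of_e hf

theorem projS_Yda (f : Ser d R) : projS (Yda f) = 0 := bigradedSl2.projE_f f

theorem Sdag_projS (f : Ser d R) : Sdag (projS f) = 0 := bigradedSl2.e_projE f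

theorem projS_projS (f : Ser d R) : projS (projS f) = projS f := bigradedSl2.projE_projE f

theorem invS_of_Yda {f : Ser d R} (hf : Yda f = 0) : invS f = 0 := bigradedSl2.invE_of_f hf

theorem Sdag_invS (f : Ser d R) : Sdag (invS f) = f - projY f :=
  eq_sub_of_add_eq' (bigradedSl2.eq_projF_add f).symm

theorem exists_invS (f : Ser d R) : ∃ w, invS f = Yda w := bigradedSl2.exists_invE f

theorem projS_invS (f : Ser d R) : projS (invS f) = 0 := by
  obtain ⟨w, hw⟩ := exists_invS f
  rw [hw, projS_Yda]

theorem invS_Sdag (f : Ser d R) : invS (Sdag f) = f - projS f := by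
  obtain ⟨w, hw⟩ := bigradedSl2.eq_projE_add f
  change f = projS f + Yda w at hw
  have h1 : Sdag f = Sdag (Yda w) := by
    conv_lhs => rw [hw, map_add, Sdag_projS, zero_add]
  rw [h1, eq_sub_iff_add_eq', ← sub_eq_zero, sub_eq_zero]
  conv_rhs => rw [hw]
  exact congrArg _ (bigradedSl2.invE_e_f w)

theorem comp_rect (m s) (f : Ser d R) : comp m s (rect f) = if m = s then comp m s f else 0 := by
  refine coef_ext fun α β => ?_
  by_cases h : m = s
  · subst h
    rw [if_pos rfl, coef_comp, coef_comp, coef_rect]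
    split_ifs with h1 h2 <;> first | rfl | omega
  · rw [if_neg h, coef_comp, coef_rect, coef_zero]
    split_ifs with h1 h2 <;> first | rfl | omega

theorem Yda_rect {f : Ser d R} (hf : Yda f = 0) : Yda (rect f) = 0 := by
  refine ext_of_comp fun m s => ?_
  rw [map_zero]
  cases m with
  | zero => exact bigradedSl2.comp_f_zero s _
  | succ m =>
    rw [comp_Yda, comp_rect]
    split_ifs
    · rw [← comp_Yda, hf, map_zero]
    · rw [map_zero]

/-- A weight zero vector in ker (Y·∂/∂a†) is invariant: [S†, Y·∂/∂a†] kills it, so S† of it lies in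
ker (Y·∂/∂a†) ∩ im S† = 0. -/
theorem Sdag_rect {f : Ser d R} (hf : Yda f = 0) : Sdag (rect f) = 0 := by
  refine bigradedSl2.e_eq_zero_of_f_e ?_
  have h1 := Sdag_Yda (rect f)
  have h2 : h0 (rect f) = 0 := by
    refine ext_of_comp fun m s => ?_
    rw [bigradedSl2.comp_h, comp_rect]
    split_ifs with h
    · rw [bigradedSl2.h_comp, h, sub_self, zero_smul, map_zero]
    · rw [map_zero, map_zero]
  rw [Yda_rect hf, map_zero, h2, add_zero] at h1
  exact h1.symm

theorem rect_mem_tracelessSer {f : Ser d R} (hf : f ∈ tracelessSer) : rect f ∈ tracelessSer := by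
  refine isGraded_tracelessSer.mem_of_comp _ fun m s => ?_
  rw [comp_rect]
  split_ifs
  · exact isGraded_tracelessSer.comp_mem _ hf _ _
  · exact zero_mem _

theorem comp_extd {K : Fin d → Ser d R →ₗ[ℝ] Ser d R} {m s m' s' : ℕ}
    (hK : ∀ μ x, comp m s (K μ x) = K μ (comp m' s' x)) (F : Form d R) (I) :
    comp m s (extd K F I) = extd K (fun J => comp m' s' (F J)) I := by
  simp only [extd_apply_apply, map_sum, map_smul, hK]

theorem comp_vdY (m s) (c) (f : Ser d R) : comp m s (vdY c f) = vdY c (comp (m + 1) s f) := by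
  simp only [vdY_apply, map_sum, map_smul, comp_dY]

theorem comp_vda (m s) (c) (f : Ser d R) : comp m s (vda c f) = vda c (comp m (s + 1) f) := by
  simp only [vda_apply, map_sum, map_smul, comp_da]

end Projectors

/-! ### Stability of the constraints under the projectors, and the gluing term. -/

namespace Background

variable {d : ℕ} {l : ℝ} {U : TopologicalSpace.Opens (Fin d → ℝ)} (B : Background d l U)

theorem Sdag_mem_W {f : Ser d (Smooth U)} (hf : f ∈ B.W 0) : Sdag f ∈ B.W 2 := by
  rw [mem_W] at *
  obtain ⟨h1, h2, h3⟩ := hf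
  obtain ⟨h4, h5⟩ := bigradedSl2.shifted_e (doublet B.V) h2 (by rw [h3, zero_smul])
  exact ⟨isGraded_tracelessSer.e_mem _ h1, h4, h5⟩

theorem projY_mem_W {f : Ser d (Smooth U)} (hf : f ∈ B.W 2) : projY f ∈ B.W 2 := by
  rw [mem_W] at *
  obtain ⟨h1, h2, h3⟩ := hf
  obtain ⟨h4, h5⟩ := bigradedSl2.shifted_projF (doublet B.V) h2 h3
  refine ⟨(bigradedSl2.exists_projF_invE isGraded_tracelessSer h1).1, ?_, h5⟩
  rw [Yda_projY, zero_add]; exact h4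

theorem mem_W_of_Sdag_Yda {w : Ser d (Smooth U)} (hw : Yda w ∈ tracelessSer)
    (h : Sdag (Yda w) ∈ B.W 2) : Yda w ∈ B.W 0 := by
  rw [mem_W] at *
  obtain ⟨-, h2, h3⟩ := h
  obtain ⟨h4, h5⟩ := bigradedSl2.shifted_of_e_f (doublet B.V) h2 h3
  exact ⟨hw, h4, by rw [h5, zero_smul]⟩

/-- S† maps this vector to f - projY f, which satisfies the weight 2 constraints; `shifted_of_e_f`
pulls them back along S† on the image of Y·∂/∂a†. -/
theorem invS_mem_W {f : Ser d (Smooth U)} (hf : f ∈ B.W 2) : invS f ∈ B.W 0 := by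
  obtain ⟨-, -, w, hw, h⟩ :=
    bigradedSl2.exists_projF_invE isGraded_tracelessSer (B.mem_W.1 hf).1
  change invS f = Yda w at h
  have h1 := Sdag_invS f
  rw [h] at h1 ⊢
  refine B.mem_W_of_Sdag_Yda (isGraded_tracelessSer.f_mem _ hw) ?_
  rw [h1]
  exact sub_mem hf (B.projY_mem_W hf)

theorem projS_mem_W {f : Ser d (Smooth U)} (hf : f ∈ B.W 0) : projS f ∈ B.W 0 := by
  have h := B.invS_mem_W (B.Sdag_mem_W hf)
  rw [invS_Sdag] at h
  simpa using sub_mem hf h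

/-- On ker S̄† the two terms of S̄† vanish together. This identifies the condition defining E₀ with
membership in the homogeneous kernel. -/
theorem vda_V_eq_zero_iff {c : ℝ} {f : Ser d (Smooth U)} (hf : f ∈ B.W c) :
    vda B.V f = 0 ↔ Yda f = 0 := by
  have h := (B.mem_W.1 hf).2.1
  constructor <;> intro h1 <;> simpa [h1] using h

theorem Yda_formSigmaBar (F : Form d (Smooth U)) (I) :
    Yda (B.formSigmaBar F I) = B.formSigmaBar (fun J => Yda (F J)) I :=
  map_extd_of_comm (K := fun μ => (vda (B.e μ)).restrictScalars ℝ) (fun _ x => Yda_vda _ x) F I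

theorem Sdag_formSigma (F : Form d (Smooth U)) (I) :
    Sdag (B.formSigma F I) = B.formSigma (fun J => Sdag (F J)) I :=
  map_extd_of_comm (K := fun μ => (vdY (B.e μ)).restrictScalars ℝ) (fun _ x => Sdag_vdY _ x) F I

theorem Sdag_formSigmaBar (F : Form d (Smooth U)) (I) :
    Sdag (B.formSigmaBar F I) + B.formSigma F I = B.formSigmaBar (fun J => Sdag (F J)) I := by
  have h := map_extd_add (T := Sdag) (K := fun μ => (vda (B.e μ)).restrictScalars ℝ)
    (L := fun μ => (-1 : ℝ) • (vdY (B.e μ)).restrictScalars ℝ) (fun _ x => by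
      rw [LinearMap.coe_restrictScalars, Sdag_vda, LinearMap.smul_apply, neg_one_smul,
        LinearMap.coe_restrictScalars, sub_eq_add_neg]) F I
  have h2 : extd (fun μ => (-1 : ℝ) • (vdY (B.e μ)).restrictScalars ℝ) F I =
      -B.formSigma F I := by
    simp only [formSigma, extd_apply_apply, ← Finset.sum_neg_distrib, ← smul_neg,
      LinearMap.smul_apply, neg_one_smul]
  rw [h2, ← sub_eq_add_neg] at h
  exact eq_sub_iff_add_eq.1 h

theorem comp_formSigma (m s) (F : Form d (Smooth U)) (I) :
    comp m s (B.formSigma F I) = B.formSigma (fun J => comp (m + 1) s (F J)) I :=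
  comp_extd (K := fun μ => (vdY (B.e μ)).restrictScalars ℝ) (fun _ x => comp_vdY m s _ x) F I

theorem comp_formSigmaBar (m s) (F : Form d (Smooth U)) (I) :
    comp m s (B.formSigmaBar F I) = B.formSigmaBar (fun J => comp m (s + 1) (F J)) I :=
  comp_extd (K := fun μ => (vda (B.e μ)).restrictScalars ℝ) (fun _ x => comp_vda m s _ x) F I

theorem formSigma_formSigma (F : Form d (Smooth U)) : B.formSigma (B.formSigma F) = 0 :=
  extd_extd_eq_zero (K := fun μ => (vdY (B.e μ)).restrictScalars ℝ)
    (fun _ _ _ => vdY_vdY _ _ _) F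

theorem formSigma_eq_zero {F : Form d (Smooth U)} (hF : ∀ J, F J = 0) (I) : B.formSigma F I = 0 := by
  rw [funext hF]; exact congrFun (map_zero B.formSigma) I

theorem formSigmaBar_eq_zero {F : Form d (Smooth U)} (hF : ∀ J, F J = 0) (I) :
    B.formSigmaBar F I = 0 := by
  rw [funext hF]; exact congrFun (map_zero B.formSigmaBar) I

theorem formD_eq_zero {F : Form d (Smooth U)} (hF : ∀ J, F J = 0) (I) : B.formD F I = 0 := by
  rw [funext hF]; exact congrFun (map_zero B.formD) I

/-- Modulo the image of `Y · ∂/∂a†`, `∇ + σ` acts as `σ` on this image. -/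
theorem projS_formD {F : Form d (Smooth U)} (hF : ∀ J, ∃ w, F J = Yda w) (I) :
    projS (B.formD F I) = -projS (B.formSigma F I) := by
  -- Adding e_μ·∂/∂Y back to `cov μ` leaves the component of ∇, which commutes with Y·∂/∂a†.
  have hnab : ∀ μ, ∀ x ∈ LinearMap.range (Yda (d := d) (R := Smooth U)),
      (B.cov μ + (vdY (B.e μ)).restrictScalars ℝ) x ∈
        LinearMap.range (Yda (d := d) (R := Smooth U)) := by
    rintro μ _ ⟨w, rfl⟩
    refine ⟨(B.cov μ + (vdY (B.e μ)).restrictScalars ℝ) w, ?_⟩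
    simp only [LinearMap.add_apply, LinearMap.coe_restrictScalars, map_add, cov_Yda, Yda_vdY]
    abel
  obtain ⟨w, hw⟩ := extd_mem (F := F) hnab (fun J => by
      obtain ⟨w, hw⟩ := hF J
      exact ⟨w, hw.symm⟩) I
  have h : Yda w = B.formD F I + B.formSigma F I := by
    rw [hw]
    simp only [formD, formSigma, extd_apply_apply, ← Finset.sum_add_distrib, ← smul_add]
    rfl
  rw [eq_neg_iff_add_eq_zero, ← map_add, ← h, projS_Yda]

theorem Yda_Sdag_invS_formD {F : Form d (Smooth U)} (hF : ∀ I, Yda (F I) = 0) (J) :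
    Yda (Sdag (invS (B.formD F J))) = B.formSigmaBar F J := by
  rw [Sdag_invS, map_sub, Yda_projY, sub_zero, Yda_formD, B.formD_eq_zero hF, zero_add]

/-- With f = Y·∂/∂a† and x = `invS` ((∇ + σ)F) in im f, one has f S† x = -σ̄F, on which f vanishes;
`f_eq_zero_of_f_f_e` concludes. -/
theorem Yda_invS_formD {F : Form d (Smooth U)} (hF : ∀ I, Yda (F I) = 0) (J) :
    Yda (invS (B.formD F J)) = 0 := by
  obtain ⟨w, hw⟩ := exists_invS (B.formD F J)
  refine bigradedSl2.f_eq_zero_of_f_f_e hw ?_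
  rw [B.Yda_Sdag_invS_formD hF, Yda_formSigmaBar, B.formSigmaBar_eq_zero hF]

/-- The series x = `invS` ((∇ + σ)F) satisfies `h0` x = σ̄F and has only negative weights. In weight
-1, that is m = s + 1, this determines x from the weight zero part of F; for m ≤ s both terms
vanish. -/
theorem comp_invS_formD {F : Form d (Smooth U)} (hF : ∀ I, Yda (F I) = 0) {m s : ℕ}
    (hms : m ≤ s + 1) (J) :
    comp m s (invS (B.formD F J) - B.formSigmaBar (fun J => rect (F J)) J) = 0 := by
  have h0 : h0 (invS (B.formD F J)) = -B.formSigmaBar F J := by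
    have := Sdag_Yda (invS (B.formD F J))
    rw [B.Yda_invS_formD hF, map_zero, B.Yda_Sdag_invS_formD hF] at this
    exact eq_neg_of_add_eq_zero_right this.symm
  rw [map_sub, comp_formSigmaBar]
  simp only [comp_rect]
  rcases hms.lt_or_eq with h | rfl
  · obtain ⟨w, hw⟩ := exists_invS (B.formD F J)
    rw [B.formSigmaBar_eq_zero (fun J => if_neg h.ne), sub_zero]
    exact bigradedSl2.comp_eq_zero_of_f_of_mem (B.Yda_invS_formD hF J) hw (by omega)
  · have h1 := congrArg (comp (s + 1) s) h0
    rw [bigradedSl2.comp_h, bigradedSl2.h_comp, map_neg, comp_formSigmaBar] at h1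
    rw [show (s : ℝ) - (s + 1 : ℕ) = -1 by push_cast; ring, neg_one_smul, neg_inj] at h1
    simp only [if_true]
    rw [h1, sub_self]

/-- The computation of the gluing term. -/
theorem projS_formD_invS_formD {F : Form d (Smooth U)} (hF : ∀ I, Yda (F I) = 0) (I) :
    projS (B.formD (fun J => invS (B.formD F J)) I) =
      -B.formSigma (B.formSigmaBar fun J => rect (F J)) I := by
  set g := B.formSigmaBar (fun J => rect (F J)) with hg
  -- Only components with m ≤ s matter to `projS`; as σ lowers m by one, those of its argument with
  -- m ≤ s + 1 are needed, exactly the range of `comp_invS_formD`.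
  have h2 : projS (B.formSigma ((fun J => invS (B.formD F J)) - g) I) = 0 := by
    refine bigradedSl2.projE_eq_zero fun m s hms => ?_
    rw [comp_formSigma]
    exact B.formSigma_eq_zero (fun J => B.comp_invS_formD hF (by omega) J) I
  -- S† kills σσ̄ on rectangular forms: moving S† past σ̄ produces σ, and σσ = 0.
  have h3 : projS (B.formSigma g I) = B.formSigma g I := by
    refine projS_of_Sdag ?_
    have h4 : (fun J => Sdag (g J)) = -B.formSigma fun J => rect (F J) := by
      funext J
      refine eq_neg_of_add_eq_zero_left ((B.Sdag_formSigmaBar _ J).trans ?_)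
      exact B.formSigmaBar_eq_zero (fun J => Sdag_rect (hF J)) J
    rw [Sdag_formSigma, h4, map_neg, formSigma_formSigma, neg_zero]; rfl
  rw [B.projS_formD fun J => exists_invS _, ← h3, neg_inj, ← sub_eq_zero, ← map_sub, ← Pi.sub_apply,
    ← map_sub, h2]

/-- Although `rect` need not preserve the shifted constraints, the gluing term inherits them from
the operators in `projS_formD_invS_formD`, each of which respects them. -/
theorem gluing_mem {F : Form d (Smooth U)} (hF : ∀ I, F I ∈ B.W 2) (hF' : ∀ I, Yda (F I) = 0) (I) :
    B.formSigma (B.formSigmaBar fun J => rect (F J)) I ∈ B.W 0 ∧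
      Sdag (B.formSigma (B.formSigmaBar fun J => rect (F J)) I) = 0 := by
  have h := B.projS_formD_invS_formD hF' I
  rw [eq_neg_iff_add_eq_zero, add_eq_zero_iff_neg_eq] at h
  rw [← h]
  refine ⟨neg_mem (B.projS_mem_W (B.formD_mem_W (fun J => B.invS_mem_W (B.formD_mem_W hF J)) I)), ?_⟩
  rw [map_neg, Sdag_projS, neg_zero]

end Background

/-! ### Operators on states built from pairs of operators on power series. -/

section States

variable {d : ℕ} {R : Type} [CommRing R]

/-- The operator acting by `S` on the coefficients of a form and by `T` on those multiplied by
`b†`. -/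
def liftPair (S T : Module.End R (Ser d R)) : Module.End R (State d R) :=
  (S.compLeft _).prodMap (T.compLeft _)

theorem liftPair_mem_gh (S T : Module.End R (Ser d R)) {k : ℤ} {Φ : State d R} (hΦ : Φ ∈ gh k) :
    liftPair S T Φ ∈ gh k :=
  ⟨fun I hI => hΦ.1 I fun h => hI ((congrArg S h).trans (map_zero S)),
    fun I hI => hΦ.2 I fun h => hI ((congrArg T h).trans (map_zero T))⟩

variable [Algebra ℝ R]

/-- `b†` times the inverse of `S†`. -/
def invState : Module.End R (State d R) := mb * liftPair invS 0

end States

/-! ### The decomposition of Γ(Ê) and the reduced operator. -/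

namespace Background

variable {d : ℕ} {l : ℝ} {U : TopologicalSpace.Opens (Fin d → ℝ)} (B : Background d l U)

theorem D_mem {Φ : State d (Smooth U)} (hΦ : Φ ∈ B.hatE) : B.D Φ ∈ B.hatE := by
  rw [mem_hatE] at *
  rw [D_apply]
  exact ⟨fun I => B.formD_mem_W hΦ.1 I, fun I => neg_mem (B.formD_mem_W hΦ.2 I)⟩

theorem hatOmega_mem {Φ : State d (Smooth U)} (hΦ : Φ ∈ B.hatE) : B.hatOmega Φ ∈ B.hatE := by
  rw [mem_hatE] at *
  rw [hatOmega_apply]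
  exact ⟨fun I => add_mem (B.formD_mem_W hΦ.1 I) (B.Sdag_mem_W (hΦ.2 I)),
    fun I => neg_mem (B.formD_mem_W hΦ.2 I)⟩

theorem mem_E0 {Φ : State d (Smooth U)} :
    Φ ∈ B.E0 ↔ (∀ I, Φ.1 I ∈ B.W 2 ∧ Yda (Φ.1 I) = 0) ∧ Φ.2 = 0 := by
  have h1 : Φ ∈ LinearMap.ker (db (d := d) (R := Smooth U)) ↔ Φ.2 = 0 := by
    rw [LinearMap.mem_ker, db_apply, Prod.mk_eq_zero]; simp
  rw [E0, Submodule.mem_inf, Submodule.mem_inf, mem_hatE, h1, mem_ker_lift, Vda_eq]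
  constructor
  · rintro ⟨⟨⟨h2, h3⟩, h4⟩, h5, -⟩
    exact ⟨fun I => ⟨h2 I, (B.vda_V_eq_zero_iff (h2 I)).1 (h5 I)⟩, h4⟩
  · rintro ⟨h2, h4⟩
    refine ⟨⟨⟨fun I => (h2 I).1, fun I => ?_⟩, h4⟩,
      fun I => (B.vda_V_eq_zero_iff (h2 I).1).2 (h2 I).2, fun I => ?_⟩
    · rw [h4]; exact zero_mem _
    · rw [h4]; exact map_zero _

theorem mem_E1 {Φ : State d (Smooth U)} :
    Φ ∈ B.E1 ↔ Φ.1 = 0 ∧ ∀ I, Φ.2 I ∈ B.W 0 ∧ Sdag (Φ.2 I) = 0 := by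
  have h1 : Φ ∈ LinearMap.range (mb (d := d) (R := Smooth U)) ↔ Φ.1 = 0 := by
    constructor
    · rintro ⟨Ψ, rfl⟩; rfl
    · intro h; exact ⟨(Φ.2, 0), Prod.ext h.symm rfl⟩
  rw [E1, Submodule.mem_inf, Submodule.mem_inf, mem_hatE, h1, mem_ker_lift]
  constructor
  · rintro ⟨⟨⟨-, h2⟩, h3⟩, -, h4⟩
    exact ⟨h3, fun I => ⟨h2 I, h4 I⟩⟩
  · rintro ⟨h3, h2⟩
    refine ⟨⟨⟨fun I => ?_, fun I => (h2 I).1⟩, h3⟩, fun I => ?_, fun I => (h2 I).2⟩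
    · rw [h3]; exact zero_mem _
    · rw [h3]; exact map_zero _

theorem mem_E {Φ : State d (Smooth U)} :
    Φ ∈ B.E ↔ Φ ∈ B.hatE ∧ (∀ I, Yda (Φ.1 I) = 0) ∧ ∀ I, Sdag (Φ.2 I) = 0 := by
  rw [E, Submodule.mem_sup]
  constructor
  · rintro ⟨Φ, hΦ, Ψ, hΨ, rfl⟩
    obtain ⟨h1, h2⟩ := B.mem_E0.1 hΦ
    obtain ⟨h3, h4⟩ := B.mem_E1.1 hΨ
    refine ⟨add_mem hΦ.1.1 hΨ.1.1, fun I => ?_, fun I => ?_⟩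
    · rw [Prod.fst_add, h3, add_zero]; exact (h1 I).2
    · rw [Prod.snd_add, h2, zero_add]; exact (h4 I).2
  · rintro ⟨h1, h2, h3⟩
    rw [mem_hatE] at h1
    exact ⟨(Φ.1, 0), B.mem_E0.2 ⟨fun I => ⟨h1.1 I, h2 I⟩, rfl⟩,
      (0, Φ.2), B.mem_E1.2 ⟨rfl, fun I => ⟨h1.2 I, h3 I⟩⟩, by simp⟩

theorem disjoint_E0_E1 : Disjoint B.E0 B.E1 := by
  rw [Submodule.disjoint_def]
  intro Φ h0 h1
  exact Prod.ext (B.mem_E1.1 h1).1 (B.mem_E0.1 h0).2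

theorem liftPair_mem {S T : Module.End (Smooth U) (Ser d (Smooth U))}
    (hS : ∀ f ∈ B.W 2, S f ∈ B.W 2) (hT : ∀ f ∈ B.W 0, T f ∈ B.W 0) {Φ : State d (Smooth U)}
    (hΦ : Φ ∈ B.hatE) : liftPair S T Φ ∈ B.hatE := by
  rw [mem_hatE] at *
  exact ⟨fun I => hS _ (hΦ.1 I), fun I => hT _ (hΦ.2 I)⟩

theorem invState_mem {Φ : State d (Smooth U)} (hΦ : Φ ∈ B.hatE) : invState Φ ∈ B.hatE := by
  rw [mem_hatE] at *
  exact ⟨fun I => zero_mem _, fun I => B.invS_mem_W (hΦ.1 I)⟩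

/-- The restriction of `liftPair S T` to `Γ(Ê)`. -/
def hatPair (S T : Module.End (Smooth U) (Ser d (Smooth U)))
    (hS : ∀ f ∈ B.W 2, S f ∈ B.W 2) (hT : ∀ f ∈ B.W 0, T f ∈ B.W 0) :
    Module.End (Smooth U) B.hatE :=
  (liftPair S T).restrict fun _ hΦ => B.liftPair_mem hS hT hΦ

/-- The projector onto `Γ(E)`. -/
def prE : Module.End (Smooth U) B.hatE :=
  B.hatPair projY projS (fun _ h => B.projY_mem_W h) fun _ h => B.projS_mem_W h

/-- The projector onto `Γ(G)`. -/
def prG : Module.End (Smooth U) B.hatE :=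
  B.hatPair (1 - projY) 0 (fun _ h => sub_mem h (B.projY_mem_W h)) fun _ _ => zero_mem _

/-- The projector onto `Γ(F)`. -/
def prF : Module.End (Smooth U) B.hatE :=
  B.hatPair 0 (1 - projS) (fun _ _ => zero_mem _) fun _ h => sub_mem h (B.projS_mem_W h)

/-- The inverse of `S† ∂/∂b†` from `Γ(G)` to `Γ(F)`. -/
def invHat : Module.End (Smooth U) B.hatE := invState.restrict fun _ hΦ => B.invState_mem hΦ

theorem prE_fst (Φ : B.hatE) (I) : (B.prE Φ).1.1 I = projY (Φ.1.1 I) := rfl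

theorem prE_snd (Φ : B.hatE) (I) : (B.prE Φ).1.2 I = projS (Φ.1.2 I) := rfl

theorem prG_fst (Φ : B.hatE) (I) : (B.prG Φ).1.1 I = Φ.1.1 I - projY (Φ.1.1 I) := rfl

theorem prG_snd (Φ : B.hatE) (I) : (B.prG Φ).1.2 I = 0 := rfl

theorem prF_fst (Φ : B.hatE) (I) : (B.prF Φ).1.1 I = 0 := rfl

theorem prF_snd (Φ : B.hatE) (I) : (B.prF Φ).1.2 I = Φ.1.2 I - projS (Φ.1.2 I) := rfl

theorem invHat_fst (Φ : B.hatE) (I) : (B.invHat Φ).1.1 I = 0 := rfl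

theorem invHat_snd (Φ : B.hatE) (I) : (B.invHat Φ).1.2 I = invS (Φ.1.1 I) := rfl

/-- The operator `∇ + σ + S† ∂/∂b†` on `Γ(Ê)`. -/
def omegaHat : B.hatE →ₗ[ℝ] B.hatE := restrictOp B.hatOmega B.hatE fun _ h => B.hatOmega_mem h

theorem omegaHat_fst (Φ : B.hatE) (I) :
    (B.omegaHat Φ).1.1 I = B.formD Φ.1.1 I + Sdag (Φ.1.2 I) :=
  congrArg (fun Ψ : State d (Smooth U) => Ψ.1 I) (B.hatOmega_apply Φ.1)

theorem omegaHat_snd (Φ : B.hatE) (I) : (B.omegaHat Φ).1.2 I = -B.formD Φ.1.2 I :=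
  congrArg (fun Ψ : State d (Smooth U) => Ψ.2 I) (B.hatOmega_apply Φ.1)

theorem hat_ext {Φ Ψ : B.hatE} (h1 : ∀ I, Φ.1.1 I = Ψ.1.1 I) (h2 : ∀ I, Φ.1.2 I = Ψ.1.2 I) :
    Φ = Ψ := Subtype.ext (Prod.ext (funext h1) (funext h2))

theorem hat_zero_fst (I) : (0 : B.hatE).1.1 I = 0 := rfl

theorem hat_zero_snd (I) : (0 : B.hatE).1.2 I = 0 := rfl

theorem splitting : CompleteOrthogonalIdempotents ![B.prE, B.prG, B.prF] := by
  have hEE : B.prE * B.prE = B.prE := LinearMap.ext fun Φ => B.hat_ext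
    (fun I => by simp only [Module.End.mul_apply, prE_fst, projY_projY])
    fun I => by simp only [Module.End.mul_apply, prE_snd, projS_projS]
  have hGG : B.prG * B.prG = B.prG := LinearMap.ext fun Φ => B.hat_ext
    (fun I => by simp only [Module.End.mul_apply, prG_fst, map_sub, projY_projY, sub_self, sub_zero])
    fun I => by simp only [Module.End.mul_apply, prG_snd]
  have hFF : B.prF * B.prF = B.prF := LinearMap.ext fun Φ => B.hat_ext
    (fun I => by simp only [Module.End.mul_apply, prF_fst])
    fun I => by
      simp only [Module.End.mul_apply, prF_snd, map_sub, projS_projS, sub_self, sub_zero]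
  have hEG : B.prE * B.prG = 0 := LinearMap.ext fun Φ => B.hat_ext
    (fun I => by
      simp only [Module.End.mul_apply, prE_fst, prG_fst, map_sub, projY_projY, sub_self,
        LinearMap.zero_apply, hat_zero_fst])
    fun I => by
      simp only [Module.End.mul_apply, prE_snd, prG_snd, map_zero, LinearMap.zero_apply,
        hat_zero_snd]
  have hGE : B.prG * B.prE = 0 := LinearMap.ext fun Φ => B.hat_ext
    (fun I => by
      simp only [Module.End.mul_apply, prE_fst, prG_fst, projY_projY, sub_self,
        LinearMap.zero_apply, hat_zero_fst])
    fun I => by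
      simp only [Module.End.mul_apply, prG_snd, LinearMap.zero_apply, hat_zero_snd]
  have hEF : B.prE * B.prF = 0 := LinearMap.ext fun Φ => B.hat_ext
    (fun I => by
      simp only [Module.End.mul_apply, prE_fst, prF_fst, map_zero, LinearMap.zero_apply,
        hat_zero_fst])
    fun I => by
      simp only [Module.End.mul_apply, prE_snd, prF_snd, map_sub, projS_projS, sub_self,
        LinearMap.zero_apply, hat_zero_snd]
  have hFE : B.prF * B.prE = 0 := LinearMap.ext fun Φ => B.hat_ext
    (fun I => by
      simp only [Module.End.mul_apply, prF_fst, LinearMap.zero_apply, hat_zero_fst])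
    fun I => by
      simp only [Module.End.mul_apply, prE_snd, prF_snd, projS_projS, sub_self,
        LinearMap.zero_apply, hat_zero_snd]
  have hGF : B.prG * B.prF = 0 := LinearMap.ext fun Φ => B.hat_ext
    (fun I => by
      simp only [Module.End.mul_apply, prG_fst, prF_fst, map_zero, sub_zero, LinearMap.zero_apply,
        hat_zero_fst])
    fun I => by
      simp only [Module.End.mul_apply, prG_snd, LinearMap.zero_apply, hat_zero_snd]
  have hFG : B.prF * B.prG = 0 := LinearMap.ext fun Φ => B.hat_ext
    (fun I => by
      simp only [Module.End.mul_apply, prF_fst, LinearMap.zero_apply, hat_zero_fst])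
    fun I => by
      simp only [Module.End.mul_apply, prG_snd, prF_snd, map_zero, sub_zero, LinearMap.zero_apply,
        hat_zero_snd]
  have hsum : B.prE + B.prG + B.prF = 1 := LinearMap.ext fun Φ => B.hat_ext
    (fun I => by
      change projY (Φ.1.1 I) + (Φ.1.1 I - projY (Φ.1.1 I)) + 0 = Φ.1.1 I
      rw [add_zero, add_sub_cancel])
    fun I => by
      change projS (Φ.1.2 I) + 0 + (Φ.1.2 I - projS (Φ.1.2 I)) = Φ.1.2 I
      rw [add_zero, add_sub_cancel]
  refine ⟨⟨fun i => ?_, fun i j hij => ?_⟩, ?_⟩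
  · fin_cases i
    exacts [hEE, hGG, hFF]
  · fin_cases i <;> fin_cases j <;> first | exact (hij rfl).elim | assumption
  · rw [Fin.sum_univ_three]; exact hsum

theorem prF_invHat (Φ : B.hatE) : B.prF (B.invHat Φ) = B.invHat Φ := B.hat_ext
  (fun I => by simp only [prF_fst, invHat_fst])
  fun I => by simp only [prF_snd, invHat_snd, projS_invS, sub_zero]

theorem invHat_prG (Φ : B.hatE) : B.invHat (B.prG Φ) = B.invHat Φ := B.hat_ext
  (fun I => by simp only [invHat_fst])
  fun I => by simp only [invHat_snd, prG_fst, map_sub, invS_of_Yda (Yda_projY _), sub_zero]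

theorem formD_fst_invHat (Φ : B.hatE) (I) : B.formD (B.invHat Φ).1.1 I = 0 :=
  B.formD_eq_zero (fun _ => rfl) I

theorem formD_fst_prF (Φ : B.hatE) (I) : B.formD (B.prF Φ).1.1 I = 0 :=
  B.formD_eq_zero (fun _ => rfl) I

theorem prG_omegaHat_invHat (Φ : B.hatE) : B.prG (B.omegaHat (B.invHat Φ)) = B.prG Φ := B.hat_ext
  (fun I => by
    simp only [prG_fst, omegaHat_fst, formD_fst_invHat, invHat_snd, Sdag_invS, zero_add, map_sub,
      projY_projY, sub_self, sub_zero])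
  fun I => by simp only [prG_snd]

theorem invHat_omegaHat_prF (Φ : B.hatE) : B.invHat (B.omegaHat (B.prF Φ)) = B.prF Φ := B.hat_ext
  (fun I => by simp only [prF_fst, invHat_fst])
  fun I => by
    simp only [invHat_snd, omegaHat_fst, formD_fst_prF, prF_snd, map_sub, Sdag_projS, zero_add,
      sub_zero, invS_Sdag]

/-- The reduction of the intermediate system to the unfolded one. -/
def reduction : Reduction (Smooth U) B.ghHat B.omegaHat where
  prE := B.prE
  prG := B.prG
  prF := B.prF
  splitting := B.splitting
  prE_ghost _ _ h := liftPair_mem_gh _ _ h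
  prG_ghost _ _ h := liftPair_mem_gh _ _ h
  prF_ghost _ _ h := liftPair_mem_gh _ _ h
  inv := B.invHat.restrictScalars ℝ
  inv_finite_order := ⟨0, IsDiffOp.of_linear _⟩
  inv_range := B.prF_invHat
  inv_support := B.invHat_prG
  right_inv Φ := by
    rw [LinearMap.coe_restrictScalars, prF_invHat, prG_omegaHat_invHat]
  left_inv Φ := by
    rw [LinearMap.coe_restrictScalars, invHat_prG, invHat_omegaHat_prF]

/-- The commutator with a function c is multiplication by θ^μ ∂_μ c, whence order one. In the
square, the cross terms of ∇ + σ with S† ∂/∂b† cancel because S† commutes with `cov μ` while θ^μ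
anticommutes with ∂/∂b†. -/
theorem isBRST_omegaHat : IsBRST (Smooth U) B.ghHat B.omegaHat where
  finite_order := by
    refine ⟨1, fun c c' Φ => ?_⟩
    have key : ∀ (c : Smooth U) (F : Form d (Smooth U)) (I),
        B.formD (c • F) I = c • B.formD F I + ∑ μ, pd μ c • thetaForm μ F I := fun c F I => by
      rw [formD_smul, Pi.add_apply, Finset.sum_apply]; rfl
    have h1 : ∀ (c : Smooth U) (Φ : B.hatE) (I), (B.omegaHat (c • Φ)).1.1 I =
        c • (B.omegaHat Φ).1.1 I + ∑ μ, pd μ c • thetaForm μ Φ.1.1 I := fun c Φ I => by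
      rw [omegaHat_fst, omegaHat_fst]
      change B.formD (c • Φ.1.1) I + Sdag (c • Φ.1.2 I) = _
      rw [key, map_smul, smul_add]; abel
    have h2 : ∀ (c : Smooth U) (Φ : B.hatE) (I), (B.omegaHat (c • Φ)).1.2 I =
        c • (B.omegaHat Φ).1.2 I - ∑ μ, pd μ c • thetaForm μ Φ.1.2 I := fun c Φ I => by
      rw [omegaHat_snd, omegaHat_snd]
      change -(B.formD (c • Φ.1.2) I) = _
      rw [key, smul_neg]; abel
    have h3 : ∀ (c : Smooth U) (F : Form d (Smooth U)) (μ) (I),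
        thetaForm μ (c • F) I = c • thetaForm μ F I := fun c F μ I => by rw [map_smul]; rfl
    change B.omegaHat (c • c' • Φ) - c • B.omegaHat (c' • Φ) =
      c' • (B.omegaHat (c • Φ) - c • B.omegaHat Φ)
    refine B.hat_ext (fun I => ?_) fun I => ?_
    · change (B.omegaHat (c • c' • Φ)).1.1 I - c • (B.omegaHat (c' • Φ)).1.1 I =
        c' • ((B.omegaHat (c • Φ)).1.1 I - c • (B.omegaHat Φ).1.1 I)
      rw [h1 c, h1 c, add_sub_cancel_left, add_sub_cancel_left, Finset.smul_sum]
      refine Finset.sum_congr rfl fun μ _ => ?_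
      exact (congrArg (fun x => pd μ c • x) (h3 c' Φ.1.1 μ I)).trans (smul_comm _ _ _)
    · change (B.omegaHat (c • c' • Φ)).1.2 I - c • (B.omegaHat (c' • Φ)).1.2 I =
        c' • ((B.omegaHat (c • Φ)).1.2 I - c • (B.omegaHat Φ).1.2 I)
      rw [h2 c, h2 c, sub_sub_cancel_left, sub_sub_cancel_left, smul_neg, Finset.smul_sum]
      refine congrArg _ (Finset.sum_congr rfl fun μ _ => ?_)
      exact (congrArg (fun x => pd μ c • x) (h3 c' Φ.1.2 μ I)).trans (smul_comm _ _ _)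
  ghost k Φ hΦ := by
    have hΦ' : (Φ : State d (Smooth U)) ∈ gh k := hΦ
    change (B.omegaHat Φ : State d (Smooth U)) ∈ gh (k + 1)
    constructor
    · intro I hI
      rw [omegaHat_fst] at hI
      by_cases h : B.formD Φ.1.1 I = 0
      · have h1 : Φ.1.2 I ≠ 0 := fun h0 => hI (by rw [h, h0, map_zero, add_zero])
        have := hΦ'.2 I h1
        omega
      · obtain ⟨J, hJ, hc⟩ := exists_of_extd_ne_zero h
        have := hΦ'.1 J hJ
        omega
    · intro I hI
      rw [omegaHat_snd] at hI
      obtain ⟨J, hJ, hc⟩ := exists_of_extd_ne_zero (neg_ne_zero.1 hI)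
      have := hΦ'.2 J hJ
      omega
  nilpotent := by
    have h1 : ∀ Φ : B.hatE, (B.omegaHat Φ).1.1 = B.formD Φ.1.1 + fun I => Sdag (Φ.1.2 I) :=
      fun Φ => funext fun I => B.omegaHat_fst Φ I
    have h2 : ∀ Φ : B.hatE, (B.omegaHat Φ).1.2 = -B.formD Φ.1.2 :=
      fun Φ => funext fun I => B.omegaHat_snd Φ I
    refine LinearMap.ext fun Φ => B.hat_ext (fun I => ?_) fun I => ?_
    · rw [LinearMap.comp_apply, omegaHat_fst, omegaHat_snd, h1, map_add, formD_formD, zero_add,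
        map_neg, Sdag_formD, add_neg_cancel]; rfl
    · rw [LinearMap.comp_apply, omegaHat_snd, h2, map_neg, formD_formD, neg_zero]
      exact neg_zero

theorem isBRST_reduction : IsBRST (Smooth U) B.ghHat B.reduction.op where
  finite_order := B.reduction.op_finite_order B.isBRST_omegaHat.finite_order
  ghost k Φ hΦ := by
    -- The factor b† in the inverse lowers the ghost number by one, compensating the second BRST
    -- operator in the correction term.
    have hinv : ∀ (Φ : B.hatE), Φ ∈ B.ghHat (k + 1) → B.invHat Φ ∈ B.ghHat k := by
      intro Φ hΦ
      have hΦ' : (Φ : State d (Smooth U)) ∈ gh (k + 1) := hΦ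
      refine ⟨fun I hI => (hI rfl).elim, fun I hI => ?_⟩
      have := hΦ'.1 I fun h => hI (by
        change invS (Φ.1.1 I) = 0
        rw [h, map_zero])
      omega
    have h1 := B.isBRST_omegaHat.ghost _ _ (B.reduction.prE_ghost _ _ hΦ)
    rw [Reduction.op_apply]
    exact sub_mem (B.reduction.prE_ghost _ _ h1) (B.reduction.prE_ghost _ _
      (B.isBRST_omegaHat.ghost _ _ (B.reduction.prF_ghost _ _ (hinv _
        (B.reduction.prG_ghost _ _ h1)))))
  nilpotent := B.reduction.op_nilpotent B.isBRST_omegaHat.nilpotent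

theorem range_prE : LinearMap.range B.prE = B.E.comap B.hatE.subtype := by
  ext Φ
  rw [Submodule.mem_comap, Submodule.subtype_apply, mem_E]
  constructor
  · rintro ⟨Ψ, rfl⟩
    exact ⟨Subtype.prop _, fun I => Yda_projY _, fun I => Sdag_projS _⟩
  · rintro ⟨-, h1, h2⟩
    exact ⟨Φ, B.hat_ext (fun I => projY_of_Yda (h1 I)) fun I => projS_of_Sdag (h2 I)⟩

theorem G_le : B.G ≤ B.hatE := by
  rintro _ ⟨Φ, hΦ, rfl⟩
  rw [Sdb_apply, mem_hatE]
  exact ⟨fun I => B.Sdag_mem_W ((B.mem_hatE.1 hΦ).2 I), fun I => zero_mem _⟩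

theorem range_prG : LinearMap.range B.prG = B.G.comap B.hatE.subtype := by
  ext Φ
  rw [Submodule.mem_comap, Submodule.subtype_apply]
  constructor
  · rintro ⟨Ψ, rfl⟩
    refine ⟨_, (B.invHat Ψ).2, ?_⟩
    rw [Sdb_apply]
    exact Prod.ext (funext fun I => Sdag_invS _) rfl
  · rintro ⟨Ψ, -, hΨ⟩
    rw [Sdb_apply] at hΨ
    refine ⟨Φ, B.hat_ext (fun I => ?_) fun I => ?_⟩
    · change Φ.1.1 I - projY (Φ.1.1 I) = Φ.1.1 I
      rw [← hΨ, projY_Sdag, sub_zero]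
    · rw [← hΨ]; rfl

/-- On E the term S† ∂/∂b† vanishes, so the BRST operator acts as ∇ + σ; the correction through F
and G is computed by `projS_formD_invS_formD`. -/
theorem op_apply_of_mem_E {Φ : B.hatE} (hΦ : (Φ : State d (Smooth U)) ∈ B.E) :
    (B.reduction.op Φ : State d (Smooth U)) =
      B.prE (restrictOp B.D B.hatE (fun _ h => B.D_mem h) Φ) - B.gluing Φ := by
  obtain ⟨-, h1, h2⟩ := B.mem_E.1 hΦ
  have h3 : B.prE Φ = Φ := B.hat_ext (fun I => projY_of_Yda (h1 I)) fun I => projS_of_Sdag (h2 I)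
  have h4 : B.omegaHat Φ = restrictOp B.D B.hatE (fun _ h => B.D_mem h) Φ := by
    refine B.hat_ext (fun I => ?_) fun I => ?_
    · rw [omegaHat_fst, h2, add_zero]
      exact congrArg (fun Ψ : State d (Smooth U) => Ψ.1 I) (B.D_apply Φ.1).symm
    · rw [omegaHat_snd]
      exact congrArg (fun Ψ : State d (Smooth U) => Ψ.2 I) (B.D_apply Φ.1).symm
  have h5 : B.reduction.op Φ = B.prE (B.omegaHat Φ) -
      B.prE (B.omegaHat (B.invHat (B.omegaHat Φ))) := by
    have : B.reduction.op Φ = B.prE (B.omegaHat (B.prE Φ)) -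
      B.prE (B.omegaHat (B.prF (B.invHat (B.prG (B.omegaHat (B.prE Φ)))))) := rfl
    rw [this, h3, prF_invHat, invHat_prG]
  have h6 : ∀ I, (B.omegaHat Φ).1.1 I = B.formD Φ.1.1 I := fun I => by
    rw [omegaHat_fst, h2, add_zero]
  have h7 : (B.invHat (B.omegaHat Φ)).1.2 = fun I => invS (B.formD Φ.1.1 I) :=
    funext fun I => by rw [invHat_snd, h6]
  rw [h5, Submodule.coe_sub, ← h4, gluing_apply]
  congr 1
  refine Prod.ext (funext fun I => ?_) (funext fun I => ?_)
  -- The b†-independent part of the correction lies in the image of S† and is projected out.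
  · rw [prE_fst, omegaHat_fst, formD_fst_invHat, zero_add, projY_Sdag]; rfl
  · rw [prE_snd, omegaHat_snd, h7, map_neg, B.projS_formD_invS_formD h1, neg_neg]

theorem D_mem_E1 {Φ : State d (Smooth U)} (hΦ : Φ ∈ B.E1) : B.D Φ ∈ B.E1 := by
  rw [mem_E1] at *
  obtain ⟨h1, h2⟩ := hΦ
  rw [D_apply]
  refine ⟨by rw [h1, map_zero], fun I =>
    ⟨neg_mem (B.formD_mem_W (fun J => (h2 J).1) I), ?_⟩⟩
  change Sdag (-(B.formD Φ.2 I)) = 0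
  rw [map_neg, Sdag_formD, B.formD_eq_zero fun J => (h2 J).2, neg_zero]

theorem gluing_mem_E1 {Φ : State d (Smooth U)} (hΦ : Φ ∈ B.E0) : B.gluing Φ ∈ B.E1 := by
  rw [gluing_apply, mem_E1]
  have h := (B.mem_E0.1 hΦ).1
  exact ⟨rfl, fun I => B.gluing_mem (fun J => (h J).1) (fun J => (h J).2) I⟩

theorem coef_eq_zero_of_mem_E0 {Φ : State d (Smooth U)} (hΦ : Φ ∈ B.E0) (I : Finset (Fin d))
    {α β : Fin (d + 1) →₀ ℕ} (h : α.degree < β.degree) : coef α β (Φ.1 I) = 0 := by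
  have h1 := congrArg (coef α β)
    (bigradedSl2.comp_eq_zero_of_f (((B.mem_E0.1 hΦ).1 I).2) h)
  simpa [coef_comp] using h1

theorem PR_mem {Φ : State d (Smooth U)} (hΦ : Φ ∈ B.E0) :
    PR Φ ∈ traceless ∧ lift Sdag (PR Φ) = 0 ∧ lift Yda (PR Φ) = 0 := by
  obtain ⟨h1, h2⟩ := B.mem_E0.1 hΦ
  have h3 : ∀ I, (PR Φ).2 I = 0 := fun I => by
    change rect (Φ.2 I) = 0
    rw [h2]; exact map_zero _
  refine ⟨mem_traceless.2 ⟨fun I => rect_mem_tracelessSer (B.mem_W.1 (h1 I).1).1, fun I => ?_⟩,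
    mem_ker_lift.2 ⟨fun I => Sdag_rect (h1 I).2, fun I => ?_⟩,
    mem_ker_lift.2 ⟨fun I => Yda_rect (h1 I).2, fun I => ?_⟩⟩
  · rw [h3]; exact zero_mem _
  · rw [h3, map_zero]
  · rw [h3, map_zero]

end Background

end AdSParent

end

theorem mainTheorem2 {d : ℕ} (hd : 3 ≤ d) {l : ℝ} (hl : 0 < l)
    (U : TopologicalSpace.Opens (Fin d → ℝ)) (B : AdSParent.Background d l U) :
    ∃ (hD : ∀ Φ ∈ B.hatE, B.D Φ ∈ B.hatE) (hΩ : ∀ Φ ∈ B.hatE, B.hatOmega Φ ∈ B.hatE)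
      (r : AdSParent.Reduction (AdSParent.Smooth U) B.ghHat
        (AdSParent.restrictOp B.hatOmega B.hatE hΩ)),
      -- the intermediate system and the reduced system are BRST systems
      AdSParent.IsBRST (AdSParent.Smooth U) B.ghHat (AdSParent.restrictOp B.hatOmega B.hatE hΩ) ∧
      AdSParent.IsBRST (AdSParent.Smooth U) B.ghHat r.op ∧
      -- the reduction is onto `Γ(E)`, `E = E₀ ⊕ E₁`, with `G = Im S† ∂/∂b†` and with a complement
      -- `F` whose elements are of the form `b† χ`
      Disjoint B.E0 B.E1 ∧
      LinearMap.range r.prE = B.E.comap B.hatE.subtype ∧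
      LinearMap.range r.prG = B.G.comap B.hatE.subtype ∧
      B.G ≤ B.hatE ∧
      (∀ Φ : B.hatE, (r.prF Φ : AdSParent.State d (AdSParent.Smooth U)) ∈
        LinearMap.range AdSParent.mb) ∧
      -- the reduced operator is `P_E (∇ + σ) - b† σ σ̄ P_R`
      (∀ Φ : B.hatE, (Φ : AdSParent.State d (AdSParent.Smooth U)) ∈ B.E →
        (r.op Φ : AdSParent.State d (AdSParent.Smooth U)) =
          r.prE (AdSParent.restrictOp B.D B.hatE hD Φ) - B.gluing Φ) ∧
      -- no projection is needed on `E₁`, and the last term takes values in `E₁`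
      (∀ Φ ∈ B.E1, B.D Φ ∈ B.E1) ∧
      (∀ Φ ∈ B.E0, B.gluing Φ ∈ B.E1) ∧
      -- on `E₀`, the degree of `a† ∂/∂a† - Y ∂/∂Y` takes the values `0, -1, -2, …` only, and `P_R`
      -- takes values in traceless elements described by rectangular Young tableaux
      (∀ Φ ∈ B.E0, ∀ (I : Finset (Fin d)) (α β : Fin (d + 1) →₀ ℕ), α.degree < β.degree →
        AdSParent.coef α β (Φ.1 I) = 0) ∧
      (∀ Φ ∈ B.E0, AdSParent.PR Φ ∈ AdSParent.traceless ∧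
        AdSParent.lift AdSParent.Sdag (AdSParent.PR Φ) = 0 ∧
        AdSParent.lift AdSParent.Yda (AdSParent.PR Φ) = 0) := by
  exact ⟨fun _ h => B.D_mem h, fun _ h => B.hatOmega_mem h, B.reduction, B.isBRST_omegaHat,
    B.isBRST_reduction, B.disjoint_E0_E1, B.range_prE, B.range_prG, B.G_le,
    fun Φ => ⟨((B.prF Φ).1.2, 0), rfl⟩, fun _ h => B.op_apply_of_mem_E h, fun _ h => B.D_mem_E1 h,
    fun _ h => B.gluing_mem_E1 h, fun _ h I _ _ hαβ => B.coef_eq_zero_of_mem_E0 h I hαβ,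
    fun _ h => B.PR_mem h⟩
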